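/- Let $\mathcal H=L^2([0,1])$ with inner product $\langle x,y\rangle=\int_0^1xy$ and norm $\|\cdot\|_{\mathcal H}$, and for a kernel $k(t,s)$ let $\|k\|_{\mathcal S}=\big(\iint k^2(t,s)\,ds\,dt\big)^{1/2}$ be the Hilbert–Schmidt norm of the corresponding integral operator. Let $\{\varepsilon_k\}_{k\in\mathbb Z}$ be i.i.d. random functions in $\mathcal H$, let $\delta\in\mathcal H$ be non-negative, and let $\beta(t,s)\ge 0$ be a measurable kernel on $[0,1]^2$ with operator $\beta(x)(t)=\int\beta(t,s)x(s)\,ds$. Let $\{y_k\}_{k\in\mathbb Z}$ be a strictly stationary process in $\mathcal H$, with $y_k^2\in\mathcal H$ almost surely, solving $$y_k=\varepsilon_k\sigma_k,\qquad \sigma_k^2=\delta+\beta(y_{k-1}^2),\qquad k\in\mathbb Z .$$ Assume that * $E\varepsilon_0^2(t)=1$ for all $t\in[0,1]$; * $E\{K(\varepsilon_1^2)\}^4<1$, where $K(\varepsilon_1^2)=\big(\iint\beta^2(t,s)\varepsilon_1^4(s)\,ds\,dt\big)^{1/2}$; * $E\|Z_0\|_{\mathcal H}^4<\infty$, where $Z_k=y_k^2-m_2$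 and $m_2=E y_0^2$. Let $C(x)=E[\langle Z_1,x\rangle Z_1]$ be the covariance operator of $Z_k$. Fix $K\ge1$, and assume that the $K+1$ largest eigenvalues of $C$, counted with multiplicity, satisfy $\lambda_1>\lambda_2>\dots>\lambda_{K+1}>0$. Let $e_1,\dots,e_{K+1}$ be corresponding orthonormal eigenfunctions. For a sample of size $N$ let $\hat\lambda_1\ge\dots\ge\hat\lambda_K$ be the $K$ largest eigenvalues, counted with multiplicity, of $\hat C(x)=\frac1N\sum_{k=1}^N\langle Z_k,x\rangle Z_k$, with corresponding orthonormal eigenfunctions $\hat e_1,\dots,\hat e_K$ (all depending on $N$), chosen in any way. Let $\beta(K)$ and $\hat\beta(K)$ be the operators with kernels $$\beta(t,s;K)=\sum_{i=1}^K\sum_{j=1}^K\lambda_j^{-1}E\big(\langle Z_1,e_j\rangle\langle Z_2,e_i\rangle\big)e_j(s)e_i(t),$$ $$\hat\beta(t,s;K)=\frac1{N-1}\sum_{k=1}^{N-1}\sum_{j=1}^K\sum_{i=1}^K\hat\lambda_j^{-1}\langle Z_k,\hat e_j\rangle\langle Z_{k+1},\hat e_i\rangle\hat e_j(s)\hat e_i(t)$$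 (with $\hat\lambda_j^{-1}:=0$ if $\hat\lambda_j=0$). Then $$\|\beta(K)-\hat\beta(K)\|_{\mathcal S}=O_P(N^{-1/2})\qquad\text{as }N\to\infty,$$ that is, for every $\eta>0$ there is $M$ such that $P\big(\|\beta(K)-\hat\beta(K)\|_{\mathcal S}>MN^{-1/2}\big)\le\eta$ for all large $N$. -/

import Mathlib

open MeasureTheory ProbabilityTheory Filter
open scoped ENNReal Topology

noncomputable section

namespace FunctionalARCH

/-- The Hilbert space `L²([0,1])` of (classes of) square integrable real functions on the unit
interval with Lebesgue measure. -/
abbrev H : Type := Lp ℝ 2 (volume : Measure unitInterval)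

/-- `L²([0,1])` carries its Borel σ-algebra. -/
instance instMeasurableSpaceH : MeasurableSpace H := borel H

instance instBorelSpaceH : BorelSpace H := ⟨rfl⟩

/-- The kernel operator `β(f)(t) = ∫ β(t,s) f(s) ds`. -/
def kernelOp (β : unitInterval → unitInterval → ℝ) (f : unitInterval → ℝ) (t : unitInterval) : ℝ :=
  ∫ s, β t s * f s

/-- The Hilbert-Schmidt norm `(∫∫ k(t,s)² ds dt)^{1/2}` of the operator with kernel `k`. -/
def hsNorm (k : unitInterval → unitInterval → ℝ) : ℝ :=
  Real.sqrt (∫ t, ∫ s, (k t s) ^ 2)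

/-- The contraction coefficient `K(x²) = (∫∫ β²(t,s) x⁴(s) ds dt)^{1/2}`, which may be infinite. -/
def contraction (β : unitInterval → unitInterval → ℝ) (x : H) : ℝ≥0∞ :=
  (∫⁻ t, ∫⁻ s, ENNReal.ofReal ((β t s) ^ 2 * (x s) ^ 4)) ^ (1 / 2 : ℝ)

/-- The pointwise square of `x` as an element of `L²([0,1])`
(with the value `0` if `x²` is not square integrable). -/
def sq (x : H) : H :=
  open Classical in
  if h : MemLp (fun t => (x t) ^ 2) 2 (volume : Measure unitInterval) then h.toLp _ else 0

variable {Ω : Type*} [MeasurableSpace Ω]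

/-- `y` is a functional ARCH(1) process in `L²([0,1])` with volatility `σ`, innovations `ε`,
intercept `δ` and kernel `β`. The squares `y_k²` have to lie in `L²([0,1])` because the operator
`β` acts on nonnegative elements of that space. -/
structure IsFARCH (P : Measure Ω) (β : unitInterval → unitInterval → ℝ) (δ : H)
    (ε σ y : ℤ → Ω → H) : Prop where
  measurable_innovation : ∀ k, Measurable (ε k)
  indep_innovation : iIndepFun ε P
  identDistrib_innovation : ∀ k, IdentDistrib (ε k) (ε 0) P P
  measurable_kernel : Measurable (Function.uncurry β)
  /-- The kernel is nonnegative almost everywhere, that is, the operator `β` maps nonnegative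
  functions to nonnegative functions. -/
  kernel_nonneg : ∀ᵐ p : unitInterval × unitInterval, 0 ≤ β p.1 p.2
  intercept_nonneg : ∀ᵐ t, 0 ≤ δ t
  measurable_process : ∀ k, Measurable (y k)
  memLp_sq : ∀ k, ∀ᵐ ω ∂P, MemLp (fun t => (y k ω t) ^ 2) 2 (volume : Measure unitInterval)
  /-- `y_k = ε_k σ_k` -/
  process_eq : ∀ k, ∀ᵐ ω ∂P, ∀ᵐ t, y k ω t = ε k ω t * σ k ω t
  /-- `σ_k² = δ + β(y_{k-1}²)` -/
  volatility_eq : ∀ k, ∀ᵐ ω ∂P, ∀ᵐ t,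
    (σ k ω t) ^ 2 = δ t + kernelOp β (fun s => (y (k - 1) ω s) ^ 2) t

/-- Strict stationarity: the law of the whole process is invariant under the time shift. -/
def IsStrictlyStationary (P : Measure Ω) (y : ℤ → Ω → H) : Prop :=
  IdentDistrib (fun ω k => y (k + 1) ω) (fun ω k => y k ω) P P

/-- `E X²(t) = 1` for every `t ∈ [0,1]`, where `X(t)` is evaluated through a jointly measurable
version of the random function `X`. -/
def HasUnitSecondMoment (P : Measure Ω) (X : Ω → H) : Prop :=
  ∃ x : Ω → unitInterval → ℝ, Measurable (Function.uncurry x) ∧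
    (∀ᵐ ω ∂P, ∀ᵐ t, X ω t = x ω t) ∧ ∀ t, ∫ ω, (x ω t) ^ 2 ∂P = 1

/-- The mean function `m₂ = E y_k²` of a stationary process, as an expectation in `L²([0,1])`. -/
def meanSq (P : Measure Ω) (y : ℤ → Ω → H) : H := ∫ ω, sq (y 0 ω) ∂P

/-- The centred squares `Z_k = y_k² - m₂`. -/
def centredSq (P : Measure Ω) (y : ℤ → Ω → H) (k : ℤ) (ω : Ω) : H :=
  sq (y k ω) - meanSq P y

/-- The covariance operator `C(x) = E[⟨Z₁, x⟩ Z₁]`. -/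
def covOp (P : Measure Ω) (Z : ℤ → Ω → H) (x : H) : H :=
  ∫ ω, inner ℝ (Z 1 ω) x • Z 1 ω ∂P

/-- The empirical covariance operator `Ĉ(x) = N⁻¹ ∑_{k=1}^N ⟨Z_k, x⟩ Z_k`. -/
def empCovOp (Z : ℤ → Ω → H) (N : ℕ) (ω : Ω) (x : H) : H :=
  (N : ℝ)⁻¹ • ∑ k ∈ Finset.Icc 1 N, inner ℝ (Z k ω) x • Z k ω

/-- `lam` and `e` are the `n` largest eigenvalues of `A`, counted with multiplicity and in
descending order, and corresponding orthonormal eigenfunctions: every eigenvalue that has an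
eigenfunction orthogonal to all of `e` is at most each of `lam`. -/
structure IsLeadingEigensystem (A : H → H) {n : ℕ} (lam : Fin n → ℝ) (e : Fin n → H) : Prop where
  orthonormal : Orthonormal ℝ e
  antitone : Antitone lam
  eigen : ∀ j, A (e j) = lam j • e j
  leading : ∀ (μ : ℝ) (v : H), v ≠ 0 → A v = μ • v → (∀ j, inner ℝ (e j) v = 0) →
    ∀ j, μ ≤ lam j

/-- The kernel
`β(t,s;K) = ∑_{i,j ≤ K} λ_j⁻¹ E(⟨Z₁, e_j⟩ ⟨Z₂, e_i⟩) e_j(s) e_i(t)`. -/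
def betaK (P : Measure Ω) (Z : ℤ → Ω → H) {K : ℕ} (lam : Fin K → ℝ) (e : Fin K → H)
    (t s : unitInterval) : ℝ :=
  ∑ i, ∑ j, (lam j)⁻¹ * (∫ ω, inner ℝ (Z 1 ω) (e j) * inner ℝ (Z 2 ω) (e i) ∂P) * e j s * e i t

/-- The kernel of the estimator,
`β̂(t,s;K) = (N-1)⁻¹ ∑_{k=1}^{N-1} ∑_{i,j ≤ K} λ̂_j⁻¹ ⟨Z_k, ê_j⟩ ⟨Z_{k+1}, ê_i⟩ ê_j(s) ê_i(t)`,
for given empirical eigenpairs. -/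
def betaHat (Z : ℤ → Ω → H) (N : ℕ) (ω : Ω) {K : ℕ} (lam : Fin K → ℝ) (e : Fin K → H)
    (t s : unitInterval) : ℝ :=
  ((N : ℝ) - 1)⁻¹ * ∑ k ∈ Finset.Icc 1 (N - 1), ∑ j, ∑ i,
    (lam j)⁻¹ * inner ℝ (Z k ω) (e j) * inner ℝ (Z (k + 1) ω) (e i) * e j s * e i t

/-- `X_N = O_P(r_N)` as `N → ∞`. -/
def IsBigOP (P : Measure Ω) (X : ℕ → Ω → ℝ) (r : ℕ → ℝ) : Prop :=
  ∀ η : ℝ, 0 < η → ∃ M : ℝ, ∀ᶠ N in atTop, P {ω | M * r N < |X N ω|} ≤ ENNReal.ofReal η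

end FunctionalARCH

end

open FunctionalARCH

noncomputable section

namespace FunctionalARCH

-- Both kernels are the same function (`tensorKernel`) of two inputs: the leading eigenpairs of a
-- covariance operator, and a lag-one moment of `Z k ⊗ Z (k+1)` in the Hilbert tensor square of `H`.
-- The proof combines a deterministic perturbation bound with a variance bound.
--
-- Perturbation: since `lam 0 > ... > lam K > 0`, the kernel is locally Lipschitz in the operator
-- and in the lag-one moment (`IsTopSystem.exists_hsNorm_tensorKernel_sub_le`). Weyl's inequality
-- handles the eigenvalues. A residual argument handles the eigenvectors up to sign, and the signs
-- cancel because every eigenvector enters the kernel twice. `IsBigOP.of_le_mul_add` turns a bound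
-- valid only near the limit into a statement in probability.
--
-- Variance: the sample means of `Z k ⊗ Z (k+d)`, for `d = 0` and `d = 1`, deviate by order
-- `N^(-1/2)` (`isBigOP_norm_mean_tensor_sub`), because the relevant covariances are bounded above
-- by a geometric sequence. Let `Y k = (y k)^2` and restart its recursion from 0 at time `q`
-- (`traj`). All ingredients are nonnegative, so the restarted path lies between 0 and `Y`, and it
-- is independent of the past up to `q`. Hence the covariance of a nonnegative past variable `T`
-- with a future `S` is at most `E⟨T, S - S'⟩`, where `S'` is the restarted version of `S`
-- (`integral_inner_centred_le`).
--
-- The obstacle is that the contraction coefficient controls `β(ε² w)` but not `ε² w`: the gap `Y -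
-- traj` is seen to decay only after `β` is applied. The last innovation is therefore integrated out
-- pointwise in `t` with `E ε²(t) = 1` (`lintegral_mul_innovation`). This gives decay of an overlap
-- that is linear in the gap, and interpolation with fourth moments upgrades it to second moments
-- (`lintegral_sq_inner_sub_traj_le`). Independence from the past requires `Y k` to be a function of
-- the innovations up to time `k`, which `exists_causal` supplies.

local instance twoNeTop : Fact ((2 : ℝ≥0∞) ≠ ∞) := ⟨ENNReal.ofNat_ne_top⟩

/-! ### Measurability of evaluation and of maps into `H`. -/

instance instSecondCountableH : SecondCountableTopology H := Lp.SecondCountableTopology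

theorem ae_tendsto_zero_of_tsum_lintegral {α : Type*} [MeasurableSpace α] {μ : Measure α}
    {f : ℕ → α → ℝ≥0∞} (hf : ∀ n, AEMeasurable (f n) μ) (h : ∑' n, ∫⁻ a, f n a ∂μ ≠ ∞) :
    ∀ᵐ a ∂μ, Tendsto (fun n => f n a) atTop (𝓝 0) := by
  rw [← lintegral_tsum hf] at h
  filter_upwards [ae_lt_top' (AEMeasurable.tsum hf) h] with a ha
  exact ENNReal.tendsto_atTop_zero_of_tsum_ne_top ha.ne

theorem eLpNorm_two_eq {α : Type*} [MeasurableSpace α] (μ : Measure α) (f : α → ℝ) :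
    eLpNorm f 2 μ = (∫⁻ t, ‖f t‖ₑ ^ 2 ∂μ) ^ (1 / 2 : ℝ) := by
  simp [eLpNorm_eq_lintegral_rpow_enorm_toReal (two_ne_zero) (ENNReal.ofNat_ne_top)]

theorem eLpNorm_two_sq {α : Type*} [MeasurableSpace α] (μ : Measure α) (f : α → ℝ) :
    eLpNorm f 2 μ ^ 2 = ∫⁻ t, ‖f t‖ₑ ^ 2 ∂μ := by
  rw [eLpNorm_two_eq, ← ENNReal.rpow_natCast, ← ENNReal.rpow_mul]
  norm_num

theorem enorm_sq_eq_lintegral (x : H) : ‖x‖ₑ ^ 2 = ∫⁻ t, ‖x t‖ₑ ^ 2 := by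
  rw [Lp.enorm_def, eLpNorm_two_sq]

/-- Elements of `H` are only classes, so Fubini arguments in `(ω, t)` need a jointly measurable
choice of representatives. Replace `x` by the first member of a dense sequence within `2^(-n)`. The
squared `L²` errors are summable, so these approximations converge to `x` almost everywhere, and
their pointwise limit is jointly measurable. -/
theorem exists_measurable_eval :
    ∃ e : H → unitInterval → ℝ, Measurable (Function.uncurry e) ∧ ∀ x, e x =ᵐ[volume] x := by
  classical
  have hex : ∀ (n : ℕ) (x : H), ∃ k, ‖x - TopologicalSpace.denseSeq H k‖ₑ < (1 / 2 : ℝ≥0∞) ^ n := by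
    intro n x
    have := (TopologicalSpace.denseRange_denseSeq H).exists_dist_lt x
      (ε := (1 / 2 : ℝ) ^ n) (by positivity)
    obtain ⟨k, hk⟩ := this
    refine ⟨k, ?_⟩
    rw [dist_eq_norm] at hk
    rw [← ofReal_norm]
    have h2 : ((1 / 2 : ℝ≥0∞)) ^ n = ENNReal.ofReal ((1 / 2 : ℝ) ^ n) := by
      rw [ENNReal.ofReal_pow (by norm_num), ENNReal.ofReal_div_of_pos (by norm_num)]
      norm_num
    rw [h2]
    exact (ENNReal.ofReal_lt_ofReal_iff (by positivity)).2 hk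
  let idx : ℕ → H → ℕ := fun n x => Nat.find (hex n x)
  have hidx : ∀ n, Measurable (idx n) := fun n => measurable_find (hex n) fun k => by
    exact measurableSet_lt (by fun_prop) (by fun_prop)
  let g : ℕ → H × unitInterval → ℝ := fun n p => TopologicalSpace.denseSeq H (idx n p.1) p.2
  have hg : ∀ n, Measurable (g n) := by
    intro n
    have h1 : Measurable fun p : ℕ × unitInterval => TopologicalSpace.denseSeq H p.1 p.2 :=
      measurable_from_prod_countable_right
        (fun k => (Lp.stronglyMeasurable (TopologicalSpace.denseSeq H k)).measurable)
    exact h1.comp (((hidx n).comp measurable_fst).prodMk measurable_snd)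
  refine ⟨fun x t => limUnder atTop fun n => g n (x, t), ?_, fun x => ?_⟩
  · exact (StronglyMeasurable.limUnder (l := atTop) (f := g) fun n => (hg n).stronglyMeasurable).measurable
  have h0 : ∀ᵐ t, Tendsto (fun n => ‖(x - TopologicalSpace.denseSeq H (idx n x)) t‖ₑ ^ 2) atTop (𝓝 0) := by
    refine ae_tendsto_zero_of_tsum_lintegral (fun n => ?_) ?_
    · exact ((Lp.stronglyMeasurable _).measurable.enorm.pow_const 2).aemeasurable
    · refine ne_top_of_le_ne_top ?_ (ENNReal.tsum_le_tsum (g := fun n => (1 / 2 : ℝ≥0∞) ^ n)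
        fun n => ?_)
      · rw [ENNReal.tsum_geometric]; simp
      · rw [← enorm_sq_eq_lintegral]
        have h1 := (Nat.find_spec (hex n x)).le
        have h2 : (1 / 2 : ℝ≥0∞) ^ n ≤ 1 := pow_le_one₀ (by simp) (by simp)
        calc _ ≤ ((1 / 2 : ℝ≥0∞) ^ n) ^ 2 := by gcongr
          _ ≤ _ := by rw [pow_two]; exact mul_le_of_le_one_right (by simp) h2
  have h1 : ∀ᵐ t, ∀ n, (x - TopologicalSpace.denseSeq H (idx n x)) t =
      x t - TopologicalSpace.denseSeq H (idx n x) t :=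
    ae_all_iff.2 fun n => Lp.coeFn_sub _ _
  filter_upwards [h0, h1] with t ht h1
  refine Tendsto.limUnder_eq ?_
  simp only [h1] at ht
  rw [tendsto_iff_edist_tendsto_0]
  have h3 := (ENNReal.continuous_rpow_const (y := 1 / 2)).tendsto 0 |>.comp ht
  simp only [one_div, inv_pos, Nat.ofNat_pos, ENNReal.zero_rpow_of_pos] at h3
  refine h3.congr fun n => ?_
  simp only [Function.comp, g]
  rw [edist_comm, edist_eq_enorm_sub, ← ENNReal.rpow_natCast, ← ENNReal.rpow_mul]
  norm_num

/-- A jointly measurable evaluation map `H × [0,1] → ℝ`. -/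
def ev : H → unitInterval → ℝ := exists_measurable_eval.choose

@[fun_prop]
theorem measurable_ev : Measurable (Function.uncurry ev) := exists_measurable_eval.choose_spec.1

theorem ev_ae_eq (x : H) : ev x =ᵐ[volume] x := exists_measurable_eval.choose_spec.2 x

@[fun_prop]
theorem measurable_ev_comp {α : Type*} [MeasurableSpace α] {f : α → H} {g : α → unitInterval}
    (hf : Measurable f) (hg : Measurable g) : Measurable fun a => ev (f a) (g a) :=
  measurable_ev.comp (hf.prodMk hg)

/-- Every open set is a countable union of balls. Measurability into `H` thus reduces to that of
scalar distances, which are integrals over `t`. -/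
theorem measurable_of_measurable_edist {α X : Type*} [MeasurableSpace α] [PseudoEMetricSpace X]
    [SecondCountableTopology X] [MeasurableSpace X] [BorelSpace X] {f : α → X}
    (h : ∀ c, Measurable fun a => edist (f a) c) : Measurable f := by
  refine measurable_of_isOpen fun U hU => ?_
  choose! r hr hrU using fun x (hx : x ∈ U) => EMetric.isOpen_iff.1 hU x hx
  obtain ⟨T, hT, hTU⟩ := TopologicalSpace.isOpen_iUnion_countable
    (fun x : U => Metric.eball (x : X) (r x)) fun x => Metric.isOpen_eball
  have : U = ⋃ x ∈ T, Metric.eball (x : X) (r x) := by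
    rw [hTU]
    ext z
    simp only [Set.mem_iUnion]
    exact ⟨fun hz => ⟨⟨z, hz⟩, Metric.mem_eball_self (hr z hz)⟩, fun ⟨x, hx⟩ => hrU x x.2 hx⟩
  rw [this, Set.preimage_iUnion₂]
  exact MeasurableSet.biUnion hT fun x _ => measurableSet_lt (h x) measurable_const

open Classical in
/-- The element of `H` represented by `f`, and `0` if `f` is not square integrable. -/
def lpOf (f : unitInterval → ℝ) : H :=
  if h : MemLp f 2 (volume : Measure unitInterval) then h.toLp _ else 0

theorem lpOf_ae_eq {f : unitInterval → ℝ} (h : MemLp f 2 volume) : lpOf f =ᵐ[volume] f := by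
  rw [lpOf, dif_pos h]
  exact h.coeFn_toLp

theorem lpOf_of_not_memLp {f : unitInterval → ℝ} (h : ¬ MemLp f 2 volume) : lpOf f = 0 := by
  rw [lpOf, dif_neg h]

theorem lpOf_congr {f g : unitInterval → ℝ} (h : f =ᵐ[volume] g) : lpOf f = lpOf g := by
  by_cases hf : MemLp f 2 volume
  · have hg := hf.ae_eq h
    exact Lp.ext ((lpOf_ae_eq hf).trans (h.trans (lpOf_ae_eq hg).symm))
  · rw [lpOf_of_not_memLp hf, lpOf_of_not_memLp fun hg => hf (hg.ae_eq h.symm)]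

theorem lpOf_coe (x : H) : lpOf x = x := Lp.ext (lpOf_ae_eq (Lp.memLp x))

theorem sq_eq_lpOf (x : H) : sq x = lpOf fun t => x t ^ 2 := rfl

theorem measurable_eLpNorm_two {α : Type*} [MeasurableSpace α] {F : α → unitInterval → ℝ}
    (hF : Measurable (Function.uncurry F)) : Measurable fun a => eLpNorm (F a) 2 volume := by
  simp only [eLpNorm_two_eq]
  refine Measurable.pow_const (Measurable.lintegral_prod_right' (f := fun p => ‖F p.1 p.2‖ₑ ^ 2) ?_) _
  exact hF.enorm.pow_const 2

theorem measurable_lpOf {α : Type*} [MeasurableSpace α] {F : α → unitInterval → ℝ}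
    (hF : Measurable (Function.uncurry F)) : Measurable fun a => lpOf (F a) := by
  classical
  refine measurable_of_measurable_edist fun c => ?_
  have hs : ∀ a, AEStronglyMeasurable (F a) volume := fun a =>
    hF.of_uncurry_left.aestronglyMeasurable
  have h1 : ∀ a, edist (lpOf (F a)) c =
      if eLpNorm (F a) 2 volume < ∞ then eLpNorm (fun t => F a t - c t) 2 volume
        else edist 0 c := by
    intro a
    split_ifs with h
    · rw [Lp.edist_def]
      exact eLpNorm_congr_ae ((lpOf_ae_eq ⟨hs a, h⟩).sub ae_eq_rfl)
    · rw [lpOf_of_not_memLp fun h' => h h'.2]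
  simp only [h1]
  refine Measurable.ite (measurableSet_lt (measurable_eLpNorm_two hF) measurable_const) ?_
    measurable_const
  exact measurable_eLpNorm_two (F := fun a t => F a t - c t)
    (hF.sub ((Lp.stronglyMeasurable c).measurable.comp measurable_snd))

theorem measurable_sq : Measurable sq := by
  have : sq = fun x => lpOf fun t => ev x t ^ 2 := by
    ext1 x
    rw [sq_eq_lpOf]
    exact lpOf_congr ((ev_ae_eq x).mono fun t ht => by simp [ht])
  rw [this]
  exact measurable_lpOf (by fun_prop)


/-! ### Kernel operators and one step of the squared recursion. -/

section Kernel

variable {β : unitInterval → unitInterval → ℝ}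

theorem kernelOp_congr {f g : unitInterval → ℝ} (h : f =ᵐ[volume] g) :
    kernelOp β f = kernelOp β g := by
  ext t
  exact integral_congr_ae (h.mono fun s hs => by simp only [hs])

theorem measurable_kernelOp (hβ : Measurable (Function.uncurry β)) {α : Type*} [MeasurableSpace α]
    {F : α → unitInterval → ℝ} (hF : Measurable (Function.uncurry F)) :
    Measurable (Function.uncurry fun a t => kernelOp β (F a) t) := by
  refine (StronglyMeasurable.integral_prod_right'
    (f := fun p : (α × unitInterval) × unitInterval => β p.1.2 p.2 * F p.1.1 p.2) ?_).measurable
  have h1 : Measurable fun p : (α × unitInterval) × unitInterval => β p.1.2 p.2 :=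
    hβ.comp (by fun_prop : Measurable fun p : (α × unitInterval) × unitInterval => (p.1.2, p.2))
  have h2 : Measurable fun p : (α × unitInterval) × unitInterval => F p.1.1 p.2 :=
    hF.comp (by fun_prop : Measurable fun p : (α × unitInterval) × unitInterval => (p.1.1, p.2))
  exact (h1.mul h2).stronglyMeasurable

theorem measurable_kernelOp_ev (hβ : Measurable (Function.uncurry β)) :
    Measurable (Function.uncurry fun (u : H) t => kernelOp β u t) := by
  have := measurable_kernelOp hβ measurable_ev
  convert this using 3 with u t
  rw [kernelOp_congr (ev_ae_eq u)]

theorem lintegral_mul_le_eLpNorm {α : Type*} [MeasurableSpace α] {μ : Measure α} {f g : α → ℝ}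
    (hf : AEStronglyMeasurable f μ) (hg : AEStronglyMeasurable g μ) :
    ∫⁻ s, ‖f s * g s‖ₑ ∂μ ≤ eLpNorm f 2 μ * eLpNorm g 2 μ := by
  have := ENNReal.lintegral_mul_le_Lp_mul_Lq μ Real.HolderConjugate.two_two hf.enorm hg.enorm
  simp only [eLpNorm_two_eq, enorm_mul]
  convert this using 3 <;> norm_num

theorem enorm_integral_mul_le {α : Type*} [MeasurableSpace α] {μ : Measure α} {f g : α → ℝ}
    (hf : AEStronglyMeasurable f μ) (hg : AEStronglyMeasurable g μ) :
    ‖∫ s, f s * g s ∂μ‖ₑ ≤ eLpNorm f 2 μ * eLpNorm g 2 μ :=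
  (enorm_integral_le_lintegral_enorm _).trans (lintegral_mul_le_eLpNorm hf hg)

theorem eLpNorm_integral_kernel_le {k : unitInterval → unitInterval → ℝ}
    (hk : ∀ t, AEStronglyMeasurable (k t) volume) {w : unitInterval → ℝ}
    (hw : MemLp w 2 volume) :
    eLpNorm (fun t => ∫ s, k t s * w s) 2 volume ≤
      (∫⁻ t, ∫⁻ s, ‖k t s‖ₑ ^ 2) ^ (1 / 2 : ℝ) * eLpNorm w 2 volume := by
  have hw' := hw.2.ne
  rw [eLpNorm_two_eq]
  have h2 : eLpNorm w 2 volume = (eLpNorm w 2 volume ^ 2) ^ (1 / 2 : ℝ) := by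
    rw [← ENNReal.rpow_natCast, ← ENNReal.rpow_mul]; norm_num
  rw [h2, ← ENNReal.mul_rpow_of_nonneg _ _ (by norm_num)]
  gcongr
  rw [← lintegral_mul_const' _ _ (by finiteness)]
  gcongr with t
  rw [← eLpNorm_two_sq, ← mul_pow]
  gcongr
  exact enorm_integral_mul_le (hk t) hw.1

theorem contraction_eq (x : H) :
    contraction β x = (∫⁻ t, ∫⁻ s, ‖β t s * x s ^ 2‖ₑ ^ 2) ^ (1 / 2 : ℝ) := by
  simp only [contraction]
  congr! 5 with t s
  rw [← enorm_pow, Real.enorm_eq_ofReal (by positivity)]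
  congr 1
  ring

theorem contraction_eq_ev (x : H) :
    contraction β x = (∫⁻ t, ∫⁻ s, ‖β t s * ev x s ^ 2‖ₑ ^ 2) ^ (1 / 2 : ℝ) := by
  rw [contraction_eq]
  congr 1
  refine lintegral_congr fun t => lintegral_congr_ae ((ev_ae_eq x).mono fun s hs => ?_)
  simp only [hs]

theorem measurable_contraction (hβ : Measurable (Function.uncurry β)) :
    Measurable (contraction β) := by
  simp only [funext fun x => contraction_eq_ev (β := β) x]
  refine Measurable.pow_const ?_ _
  refine Measurable.lintegral_prod_right' (f := fun p : H × unitInterval =>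
    ∫⁻ s, ‖β p.2 s * ev p.1 s ^ 2‖ₑ ^ 2) ?_
  refine Measurable.lintegral_prod_right' (f := fun q : (H × unitInterval) × unitInterval =>
    ‖β q.1.2 q.2 * ev q.1.1 q.2 ^ 2‖ₑ ^ 2) ?_
  have h1 : Measurable fun p : (H × unitInterval) × unitInterval => β p.1.2 p.2 :=
    hβ.comp (by fun_prop :
      Measurable fun p : (H × unitInterval) × unitInterval => (p.1.2, p.2))
  fun_prop

/-- The factor `x²` is absorbed into the kernel: `β(t,s) x²(s)` has Hilbert-Schmidt norm
`contraction β x`. The product `x² w` itself is not controlled in this way. -/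
theorem eLpNorm_kernelOp_sq_mul_le (hβ : Measurable (Function.uncurry β)) (x : H)
    {w : unitInterval → ℝ} (hw : MemLp w 2 volume) :
    eLpNorm (kernelOp β fun s => x s ^ 2 * w s) 2 volume ≤
      contraction β x * eLpNorm w 2 volume := by
  rw [contraction_eq]
  have h : (kernelOp β fun s => x s ^ 2 * w s) = fun t => ∫ s, (β t s * x s ^ 2) * w s := by
    ext t
    simp only [kernelOp, mul_assoc]
  rw [h]
  exact eLpNorm_integral_kernel_le (fun t => (hβ.of_uncurry_left.aestronglyMeasurable).mul
    ((Lp.aestronglyMeasurable x).pow 2)) hw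

/-- The Hilbert-Schmidt norm of the operator with kernel `β`, as an extended number. -/
def kernelENorm (β : unitInterval → unitInterval → ℝ) : ℝ≥0∞ :=
  (∫⁻ t, ∫⁻ s, ‖β t s‖ₑ ^ 2) ^ (1 / 2 : ℝ)

theorem eLpNorm_kernelOp_le (hβ : Measurable (Function.uncurry β)) (u : H) :
    eLpNorm (kernelOp β u) 2 volume ≤ kernelENorm β * ‖u‖ₑ := by
  rw [Lp.enorm_def]
  exact eLpNorm_integral_kernel_le (fun t => hβ.of_uncurry_left.aestronglyMeasurable) (Lp.memLp u)

theorem memLp_kernelOp (hβ : Measurable (Function.uncurry β)) (hβ2 : kernelENorm β ≠ ∞) (u : H) :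
    MemLp (kernelOp β u) 2 volume := by
  refine ⟨(measurable_kernelOp_ev hβ).of_uncurry_left.aestronglyMeasurable, ?_⟩
  exact (eLpNorm_kernelOp_le hβ u).trans_lt (ENNReal.mul_lt_top hβ2.lt_top enorm_lt_top)

theorem ae_integrable_kernel_mul (hβ : Measurable (Function.uncurry β))
    (hβ2 : kernelENorm β ≠ ∞) (u : H) : ∀ᵐ t, Integrable (fun s => β t s * u s) volume := by
  have h1 : ∫⁻ t, ∫⁻ s, ‖β t s‖ₑ ^ 2 ≠ ∞ := by
    intro h
    exact hβ2 (by rw [kernelENorm, h]; simp)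
  have h2 : Measurable fun t => ∫⁻ s, ‖β t s‖ₑ ^ 2 :=
    Measurable.lintegral_prod_right' (f := fun p : unitInterval × unitInterval =>
      ‖β p.1 p.2‖ₑ ^ 2) (hβ.enorm.pow_const 2)
  filter_upwards [ae_lt_top h2 h1] with t ht
  have hm : AEStronglyMeasurable (β t) volume := hβ.of_uncurry_left.aestronglyMeasurable
  have : MemLp (β t) 2 volume := by
    refine ⟨hm, ?_⟩
    rw [eLpNorm_two_eq]
    exact ENNReal.rpow_lt_top_of_nonneg (by norm_num) ht.ne
  exact this.integrable_mul (Lp.memLp u)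

theorem kernelOp_sub (hβ : Measurable (Function.uncurry β)) (hβ2 : kernelENorm β ≠ ∞) (u v : H) :
    kernelOp β (u - v : H) =ᵐ[volume] fun t => kernelOp β u t - kernelOp β v t := by
  filter_upwards [ae_integrable_kernel_mul hβ hβ2 u, ae_integrable_kernel_mul hβ hβ2 v]
    with t hu hv
  rw [kernelOp, kernelOp, kernelOp, ← integral_sub hu hv]
  refine integral_congr_ae ((Lp.coeFn_sub u v).mono fun s hs => ?_)
  simp only [hs, Pi.sub_apply]
  ring

theorem kernelOp_nonneg (hβ0 : ∀ᵐ p : unitInterval × unitInterval, 0 ≤ β p.1 p.2)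
    {f : unitInterval → ℝ} (hf : ∀ᵐ s, 0 ≤ f s) : ∀ᵐ t, 0 ≤ kernelOp β f t := by
  have h : ∀ᵐ t : unitInterval, ∀ᵐ s : unitInterval, 0 ≤ β t s :=
    Measure.ae_ae_of_ae_prod (p := fun p : unitInterval × unitInterval => 0 ≤ β p.1 p.2) hβ0
  filter_upwards [h] with t ht
  refine integral_nonneg_of_ae ?_
  filter_upwards [ht, hf] with s h1 h2 using mul_nonneg h1 h2

/-- One step `u ↦ x² (δ + β(u))` of the recursion of the squared process. -/
def step (β : unitInterval → unitInterval → ℝ) (δ x u : H) : H :=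
  lpOf fun t => x t ^ 2 * (δ t + kernelOp β u t)

theorem measurable_step (hβ : Measurable (Function.uncurry β)) (δ : H) :
    Measurable fun p : H × H => step β δ p.1 p.2 := by
  have h : ∀ p : H × H, step β δ p.1 p.2 =
      lpOf fun t => ev p.1 t ^ 2 * (ev δ t + kernelOp β p.2 t) := fun p => by
    refine lpOf_congr ?_
    filter_upwards [ev_ae_eq p.1, ev_ae_eq δ] with t h1 h2
    simp only [h1, h2]
  simp only [h]
  refine measurable_lpOf ?_
  have h2 : Measurable fun p : (H × H) × unitInterval => kernelOp β p.1.2 p.2 :=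
    (measurable_kernelOp_ev hβ).comp
      (by fun_prop : Measurable fun p : (H × H) × unitInterval => (p.1.2, p.2))
  have h1 : Measurable fun p : (H × H) × unitInterval =>
      ev p.1.1 p.2 ^ 2 * (ev δ p.2 + kernelOp β p.1.2 p.2) := by fun_prop
  exact h1

/-- The dominating element `v'` of `H` is what guarantees that the step is square integrable, so
that `lpOf` does not fall back on its default value 0. In the difference of the two steps the
intercept cancels. -/
theorem step_monotone (hβ : Measurable (Function.uncurry β)) (hβ2 : kernelENorm β ≠ ∞)
    (hβ0 : ∀ᵐ p : unitInterval × unitInterval, 0 ≤ β p.1 p.2) {δ x u v v' : H}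
    (hδ : ∀ᵐ t, 0 ≤ δ t) (hu : ∀ᵐ t, 0 ≤ u t) (huv : ∀ᵐ t, u t ≤ v t)
    (hv' : ∀ᵐ t, v' t = x t ^ 2 * (δ t + kernelOp β v t)) :
    (∀ᵐ t, 0 ≤ step β δ x u t) ∧ (∀ᵐ t, step β δ x u t ≤ v' t) ∧
      ∀ᵐ t, (v' - step β δ x u : H) t = x t ^ 2 * kernelOp β (v - u : H) t := by
  have hsub : ∀ᵐ s, 0 ≤ (v - u : H) s := by
    filter_upwards [Lp.coeFn_sub v u, huv] with s h1 h2
    rw [h1]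
    exact sub_nonneg.2 h2
  have h1 := kernelOp_nonneg hβ0 hu
  have h2 := kernelOp_nonneg hβ0 hsub
  have h3 := kernelOp_sub hβ hβ2 v u
  have hmeas : AEStronglyMeasurable (fun t => x t ^ 2 * (δ t + kernelOp β u t)) volume :=
    ((Lp.aestronglyMeasurable x).pow 2).mul
      ((Lp.aestronglyMeasurable δ).add (memLp_kernelOp hβ hβ2 u).1)
  have hmem : MemLp (fun t => x t ^ 2 * (δ t + kernelOp β u t)) 2 volume := by
    refine (Lp.memLp v').mono hmeas ?_
    filter_upwards [h1, h2, h3, hv', hδ] with t h1 h2 h3 h4 h5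
    rw [h3] at h2
    rw [h4, Real.norm_of_nonneg (by positivity), Real.norm_of_nonneg
      (mul_nonneg (by positivity) (by linarith))]
    gcongr
    linarith
  have h6 := lpOf_ae_eq hmem
  refine ⟨?_, ?_, ?_⟩
  · filter_upwards [h6, h1, hδ] with t h6 h1 h5
    rw [step, h6]
    positivity
  · filter_upwards [h6, h1, h2, h3, hv', hδ] with t h6 h1 h2 h3 h4 h5
    rw [step, h6, h4]
    rw [h3] at h2
    gcongr
    linarith
  · filter_upwards [h6, h3, hv', Lp.coeFn_sub v' (step β δ x u)] with t h6 h3 h4 h7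
    rw [h7, Pi.sub_apply, step, h6, h4, h3]
    ring

end Kernel

/-! ### The squared process and its moment bounds. -/

theorem sq_lintegral_le_lintegral_sq {α : Type*} [MeasurableSpace α] {μ : Measure α}
    [IsProbabilityMeasure μ] {f : α → ℝ≥0∞} (hf : AEMeasurable f μ) :
    (∫⁻ a, f a ∂μ) ^ 2 ≤ ∫⁻ a, f a ^ 2 ∂μ := by
  have h := ENNReal.lintegral_mul_norm_pow_le (μ := μ) (hf.pow_const 2)
    (aemeasurable_const (b := (1 : ℝ≥0∞))) (p := 1 / 2) (q := 1 / 2)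
    (by norm_num) (by norm_num) (by norm_num)
  have h2 : ∀ c : ℝ≥0∞, (c ^ 2) ^ (1 / 2 : ℝ) = c := fun c => by
    rw [← ENNReal.rpow_natCast, ← ENNReal.rpow_mul]; norm_num
  have h3 : ∀ c : ℝ≥0∞, (c ^ (1 / 2 : ℝ)) ^ 2 = c := fun c => by
    rw [← ENNReal.rpow_natCast, ← ENNReal.rpow_mul]; norm_num
  simp only [h2, ENNReal.one_rpow, mul_one, lintegral_const, measure_univ] at h
  calc _ ≤ ((∫⁻ a, f a ^ 2 ∂μ) ^ (1 / 2 : ℝ)) ^ 2 := by gcongr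
    _ = _ := h3 _

/-- The squared process `Y_k = y_k²` of a functional ARCH(1) process, its recursion and its
moment bounds. -/
structure IsSquaredARCH {Ω : Type*} [MeasurableSpace Ω] (P : Measure Ω)
    (β : unitInterval → unitInterval → ℝ) (δ : H) (ε Y : ℤ → Ω → H) : Prop where
  measurable_innovation : ∀ k, Measurable (ε k)
  indep_innovation : iIndepFun ε P
  measurable_kernel : Measurable (Function.uncurry β)
  kernel_nonneg : ∀ᵐ p : unitInterval × unitInterval, 0 ≤ β p.1 p.2
  kernel_finite : kernelENorm β ≠ ∞
  intercept_nonneg : ∀ᵐ t, 0 ≤ δ t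
  unit : ∀ k, ∀ᵐ t, ∫⁻ ω, ‖ev (ε k ω) t‖ₑ ^ 2 ∂P = 1
  contracting : ∃ ρ : ℝ≥0∞, ρ < 1 ∧ ∀ k, ∫⁻ ω, contraction β (ε k ω) ^ 2 ∂P ≤ ρ ^ 2
  measurable : ∀ k, Measurable (Y k)
  nonneg : ∀ k, ∀ᵐ ω ∂P, ∀ᵐ t, 0 ≤ Y k ω t
  recursion : ∀ k, ∀ᵐ ω ∂P, ∀ᵐ t,
    Y (k + 1) ω t = ε (k + 1) ω t ^ 2 * (δ t + kernelOp β (Y k ω) t)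
  moment : ∃ M : ℝ≥0∞, M ≠ ∞ ∧ ∀ k, ∫⁻ ω, ‖Y k ω‖ₑ ^ 4 ∂P ≤ M

section Extraction

variable {Ω : Type*} [MeasurableSpace Ω] {P : Measure Ω} [IsProbabilityMeasure P]
  {β : unitInterval → unitInterval → ℝ} {δ : H} {ε σ y : ℤ → Ω → H}

/-- Two jointly measurable versions agree for almost every `(ω, t)`, so by Fubini the normalisation
passes to `ev` for almost every `t`. -/
theorem HasUnitSecondMoment.lintegral_ev_sq {X : Ω → H} (hX : Measurable X)
    (h : HasUnitSecondMoment P X) : ∀ᵐ t, ∫⁻ ω, ‖ev (X ω) t‖ₑ ^ 2 ∂P = 1 := by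
  obtain ⟨x, hxm, hx, h1⟩ := h
  have h2 : ∀ᵐ ω ∂P, ∀ᵐ t, ev (X ω) t = x ω t := by
    filter_upwards [hx] with ω hω
    filter_upwards [hω, ev_ae_eq (X ω)] with t h3 h4
    rw [h4, h3]
  have hx' : Measurable fun p : Ω × unitInterval => x p.1 p.2 := hxm
  have h3 : ∀ᵐ t, ∀ᵐ ω ∂P, ev (X ω) t = x ω t := by
    refine (Measure.ae_ae_comm (p := fun ω t => ev (X ω) t = x ω t) ?_).1 h2
    exact measurableSet_eq_fun (by fun_prop) hx'
  filter_upwards [h3] with t ht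
  -- A non-integrable function would have Bochner integral 0, not 1.
  have hint : Integrable (fun ω => x ω t ^ 2) P := by
    by_contra hc
    have := h1 t
    rw [integral_undef hc] at this
    exact zero_ne_one this
  have h4 : ∫⁻ ω, ‖ev (X ω) t‖ₑ ^ 2 ∂P = ∫⁻ ω, ENNReal.ofReal (x ω t ^ 2) ∂P := by
    refine lintegral_congr_ae (ht.mono fun ω hω => ?_)
    simp only [hω]
    rw [← enorm_pow, Real.enorm_eq_ofReal (by positivity)]
  rw [h4, ← ofReal_integral_eq_lintegral_ofReal hint (ae_of_all _ fun ω => by positivity), h1 t,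
    ENNReal.ofReal_one]

theorem lintegral_sq_contraction_le (hβ : Measurable (Function.uncurry β)) {X : Ω → H}
    (hX : Measurable X) :
    ∫⁻ ω, contraction β (X ω) ^ 2 ∂P ≤ (∫⁻ ω, contraction β (X ω) ^ (4 : ℝ) ∂P) ^ (1 / 2 : ℝ) := by
  have h := sq_lintegral_le_lintegral_sq (μ := P)
    (((measurable_contraction hβ).comp hX).pow_const 2).aemeasurable
  have h2 : ∀ c : ℝ≥0∞, (c ^ 2) ^ (1 / 2 : ℝ) = c := fun c => by
    rw [← ENNReal.rpow_natCast, ← ENNReal.rpow_mul]; norm_num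
  rw [← h2 (∫⁻ ω, contraction β (X ω) ^ 2 ∂P)]
  gcongr
  refine h.trans (le_of_eq ?_)
  refine lintegral_congr fun ω => ?_
  simp only [Function.comp]
  rw [← pow_mul, ← ENNReal.rpow_natCast]
  norm_num

/-- By Jensen `E ε⁴(s) ≥ (E ε²(s))² = 1`, so inserting `ε⁴(s)` under the expectation only increases
`∬ β²`. Thus the contraction hypothesis already makes `β` Hilbert-Schmidt. -/
theorem kernelENorm_ne_top (hβ : Measurable (Function.uncurry β)) {X : Ω → H}
    (hX : Measurable X) (hunit : ∀ᵐ t, ∫⁻ ω, ‖ev (X ω) t‖ₑ ^ 2 ∂P = 1)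
    (hc : ∫⁻ ω, contraction β (X ω) ^ 2 ∂P ≠ ∞) : kernelENorm β ≠ ∞ := by
  have h3 : ∀ c : ℝ≥0∞, (c ^ (1 / 2 : ℝ)) ^ 2 = c := fun c => by
    rw [← ENNReal.rpow_natCast, ← ENNReal.rpow_mul]; norm_num
  suffices h : ∫⁻ t, ∫⁻ s, ‖β t s‖ₑ ^ 2 ≤ ∫⁻ ω, contraction β (X ω) ^ 2 ∂P by
    exact ENNReal.rpow_ne_top_of_nonneg (by norm_num) (ne_top_of_le_ne_top hc h)
  simp only [contraction_eq_ev, h3]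
  have hm : Measurable fun p : (Ω × unitInterval) × unitInterval =>
      ‖β p.1.2 p.2 * ev (X p.1.1) p.2 ^ 2‖ₑ ^ 2 := by
    have h1 : Measurable fun p : (Ω × unitInterval) × unitInterval => β p.1.2 p.2 :=
      hβ.comp (by fun_prop :
        Measurable fun p : (Ω × unitInterval) × unitInterval => (p.1.2, p.2))
    fun_prop
  have hm2 : Measurable fun p : Ω × unitInterval =>
      ∫⁻ s, ‖β p.2 s * ev (X p.1) s ^ 2‖ₑ ^ 2 := hm.lintegral_prod_right'
  rw [lintegral_lintegral_swap (f := fun ω t => ∫⁻ s, ‖β t s * ev (X ω) s ^ 2‖ₑ ^ 2)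
    hm2.aemeasurable]
  gcongr with t
  have hm3 : Measurable fun p : Ω × unitInterval => ‖β t p.2 * ev (X p.1) p.2 ^ 2‖ₑ ^ 2 :=
    hm.comp (by fun_prop : Measurable fun p : Ω × unitInterval => ((p.1, t), p.2))
  rw [lintegral_lintegral_swap (f := fun ω s => ‖β t s * ev (X ω) s ^ 2‖ₑ ^ 2)
    hm3.aemeasurable]
  refine lintegral_mono_ae (hunit.mono fun s hs => ?_)
  have hm4 : Measurable fun ω => ‖ev (X ω) s‖ₑ ^ 2 := by fun_prop
  have h5 := sq_lintegral_le_lintegral_sq (μ := P) hm4.aemeasurable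
  rw [hs, one_pow] at h5
  calc ‖β t s‖ₑ ^ 2 = ‖β t s‖ₑ ^ 2 * 1 := (mul_one _).symm
    _ ≤ ‖β t s‖ₑ ^ 2 * ∫⁻ ω, (‖ev (X ω) s‖ₑ ^ 2) ^ 2 ∂P := by gcongr
    _ = ∫⁻ ω, ‖β t s * ev (X ω) s ^ 2‖ₑ ^ 2 ∂P := by
      rw [← lintegral_const_mul _ (hm4.pow_const 2)]
      simp only [enorm_mul, enorm_pow, mul_pow]

omit [IsProbabilityMeasure P] in
theorem IsStrictlyStationary.identDistrib_pair (h : IsStrictlyStationary P y) (k d : ℤ) :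
    IdentDistrib (fun ω => (y k ω, y (k + d) ω)) (fun ω => (y 0 ω, y (0 + d) ω)) P P := by
  have hstep : ∀ k : ℤ, IdentDistrib (fun ω => (y (k + 1) ω, y (k + 1 + d) ω))
      (fun ω => (y k ω, y (k + d) ω)) P P := fun k => by
    rw [add_right_comm]
    exact IdentDistrib.comp (u := fun f : ℤ → H => (f k, f (k + d))) h (by fun_prop)
  induction k using Int.induction_on with
  | zero =>
    have := hstep 0
    exact (this.symm.trans this)
  | succ k ih => exact (hstep k).trans ih
  | pred k ih =>
    have := hstep (-(k : ℤ) - 1)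
    simp only [sub_add_cancel] at this
    exact this.symm.trans ih

omit [IsProbabilityMeasure P] in
theorem IsStrictlyStationary.identDistrib (h : IsStrictlyStationary P y) (k : ℤ) :
    IdentDistrib (y k) (y 0) P P :=
  (h.identDistrib_pair k 0).comp measurable_fst

theorem lintegral_enorm_sq_pow_four_ne_top
    (h : ∫⁻ ω, ‖centredSq P y 0 ω‖ₑ ^ (4 : ℝ) ∂P < ∞) :
    ∫⁻ ω, ‖sq (y 0 ω)‖ₑ ^ 4 ∂P ≠ ∞ := by
  have h1 : ∀ ω, ‖sq (y 0 ω)‖ₑ ^ 4 ≤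
      8 * (‖centredSq P y 0 ω‖ₑ ^ (4 : ℝ) + ‖meanSq P y‖ₑ ^ 4) := fun ω => by
    have h2 : ‖sq (y 0 ω)‖ₑ ≤ ‖centredSq P y 0 ω‖ₑ + ‖meanSq P y‖ₑ := by
      have : sq (y 0 ω) = centredSq P y 0 ω + meanSq P y := by simp [centredSq]
      rw [this]
      exact enorm_add_le _ _
    have h3 := ENNReal.rpow_add_le_mul_rpow_add_rpow ‖centredSq P y 0 ω‖ₑ ‖meanSq P y‖ₑ
      (p := 4) (by norm_num)
    have h4 : (2 : ℝ≥0∞) ^ ((4 : ℝ) - 1) = 8 := by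
      rw [show ((4 : ℝ) - 1) = ((3 : ℕ) : ℝ) by norm_num, ENNReal.rpow_natCast]; norm_num
    have h5 : ∀ c : ℝ≥0∞, c ^ (4 : ℝ) = c ^ 4 := fun c => by
      rw [← ENNReal.rpow_natCast]; norm_num
    rw [h4, h5, h5, h5] at h3
    rw [h5]
    exact (by gcongr : ‖sq (y 0 ω)‖ₑ ^ 4 ≤ _).trans h3
  refine ne_top_of_le_ne_top ?_ (lintegral_mono h1)
  rw [lintegral_const_mul' _ _ (by norm_num), lintegral_add_right _ measurable_const]
  simp only [lintegral_const, measure_univ, mul_one]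
  exact ENNReal.mul_ne_top (by norm_num) (ENNReal.add_ne_top.2 ⟨h.ne, by finiteness⟩)

theorem sq_nonneg_ae (x : H) : ∀ᵐ t, 0 ≤ sq x t := by
  by_cases h : MemLp (fun t => x t ^ 2) 2 volume
  · filter_upwards [lpOf_ae_eq h] with t ht
    rw [sq_eq_lpOf, ht]
    positivity
  · rw [sq_eq_lpOf, lpOf_of_not_memLp h]
    filter_upwards [Lp.coeFn_zero ℝ 2 (volume : Measure unitInterval)] with t ht
    rw [ht]
    rfl

theorem IsFARCH.isSquaredARCH (hA : IsFARCH P β δ ε σ y) (hstat : IsStrictlyStationary P y)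
    (hunit : HasUnitSecondMoment P (ε 0))
    (hcontr : ∫⁻ ω, contraction β (ε 1 ω) ^ (4 : ℝ) ∂P < 1)
    (hmoment : ∫⁻ ω, ‖centredSq P y 0 ω‖ₑ ^ (4 : ℝ) ∂P < ∞) :
    IsSquaredARCH P β δ ε fun k ω => sq (y k ω) := by
  have hβ := hA.measurable_kernel
  have hε := hA.measurable_innovation
  have hc : ∀ k, ∫⁻ ω, contraction β (ε k ω) ^ 2 ∂P = ∫⁻ ω, contraction β (ε 1 ω) ^ 2 ∂P := by
    intro k
    have := ((hA.identDistrib_innovation k).trans (hA.identDistrib_innovation 1).symm).comp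
      ((measurable_contraction hβ).pow_const 2)
    exact this.lintegral_eq
  have hc1 : ∫⁻ ω, contraction β (ε 1 ω) ^ 2 ∂P < 1 :=
    (lintegral_sq_contraction_le hβ (hε 1)).trans_lt (ENNReal.rpow_lt_one hcontr (by norm_num))
  have hu : ∀ k, ∀ᵐ t, ∫⁻ ω, ‖ev (ε k ω) t‖ₑ ^ 2 ∂P = 1 := by
    intro k
    filter_upwards [hunit.lintegral_ev_sq (hε 0)] with t ht
    rw [← ht]
    have hm : Measurable fun x : H => ‖ev x t‖ₑ ^ 2 := by fun_prop
    exact ((hA.identDistrib_innovation k).comp hm).lintegral_eq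
  refine ⟨hε, hA.indep_innovation, hβ, hA.kernel_nonneg, ?_, hA.intercept_nonneg, hu, ?_, ?_, ?_,
    ?_, ?_⟩
  · exact kernelENorm_ne_top hβ (hε 1) (hu 1) (hc1.trans ENNReal.one_lt_top).ne
  · refine ⟨(∫⁻ ω, contraction β (ε 1 ω) ^ 2 ∂P) ^ (1 / 2 : ℝ),
      ENNReal.rpow_lt_one hc1 (by norm_num), fun k => ?_⟩
    rw [hc k, ← ENNReal.rpow_natCast, ← ENNReal.rpow_mul]
    norm_num
  · exact fun k => measurable_sq.comp (hA.measurable_process k)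
  · exact fun k => ae_of_all _ fun ω => sq_nonneg_ae _
  · intro k
    filter_upwards [hA.memLp_sq k, hA.memLp_sq (k + 1), hA.process_eq (k + 1),
      hA.volatility_eq (k + 1)] with ω h1 h2 h3 h4
    have h5 := lpOf_ae_eq h1
    rw [← sq_eq_lpOf] at h5
    filter_upwards [h3, h4, lpOf_ae_eq h2] with t h3 h4 h6
    rw [sq_eq_lpOf, h6, h3, mul_pow, h4, kernelOp_congr h5]
    simp only [add_sub_cancel_right]
  · refine ⟨_, lintegral_enorm_sq_pow_four_ne_top hmoment, fun k => le_of_eq ?_⟩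
    have hm : Measurable fun x : H => ‖sq x‖ₑ ^ 4 := measurable_sq.enorm.pow_const 4
    exact ((hstat.identDistrib k).comp hm).lintegral_eq

end Extraction

/-! ### σ-algebras of innovations and products of independent factors. -/

section Sigma

variable {Ω : Type*}

/-- The σ-algebra generated by the innovations with index in `S`. -/
abbrev innovSigma (ε : ℤ → Ω → H) (S : Set ℤ) : MeasurableSpace Ω :=
  ⨆ j ∈ S, instMeasurableSpaceH.comap (ε j)

theorem innovSigma_mono (ε : ℤ → Ω → H) {S T : Set ℤ} (h : S ⊆ T) :
    innovSigma ε S ≤ innovSigma ε T :=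
  biSup_mono h

theorem measurable_innovSigma (ε : ℤ → Ω → H) {S : Set ℤ} {j : ℤ} (hj : j ∈ S) :
    Measurable[innovSigma ε S] (ε j) :=
  (comap_measurable (ε j)).mono
    (le_biSup (fun j => instMeasurableSpaceH.comap (ε j)) hj) le_rfl

variable [mΩ : MeasurableSpace Ω] {P : Measure Ω} {ε : ℤ → Ω → H}

theorem innovSigma_le (hε : ∀ k, Measurable (ε k)) (S : Set ℤ) : innovSigma ε S ≤ mΩ :=
  iSup₂_le fun j _ => (hε j).comap_le

theorem indep_innovSigma (hε : ∀ k, Measurable (ε k)) (hind : iIndepFun ε P) {S T : Set ℤ}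
    (h : Disjoint S T) : Indep (innovSigma ε S) (innovSigma ε T) P :=
  indep_iSup_of_disjoint (fun j => (hε j).comap_le) hind h

omit mΩ in
theorem measurable_prod_innov {g : H → ℝ≥0∞} (hg : Measurable g) (q : ℤ) (n : ℕ) :
    Measurable[innovSigma ε (Set.Iic (q + n))]
      fun ω => ∏ i ∈ Finset.range n, g (ε (q + i + 1) ω) := by
  refine Finset.measurable_fun_prod _ fun i hi => hg.comp (measurable_innovSigma ε ?_)
  have := Finset.mem_range.1 hi
  simp only [Set.mem_Iic]
  omega

/-- The factors are peeled off from the latest one: it is independent of everything that remains. -/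
theorem lintegral_mul_prod_innov_le (hε : ∀ k, Measurable (ε k)) (hind : iIndepFun ε P)
    {g : H → ℝ≥0∞} (hg : Measurable g) {c : ℝ≥0∞} (hc : ∀ k, ∫⁻ ω, g (ε k ω) ∂P ≤ c) (q : ℤ)
    {f : Ω → ℝ≥0∞} (hf : Measurable[innovSigma ε (Set.Iic q)] f) (n : ℕ) :
    ∫⁻ ω, f ω * ∏ i ∈ Finset.range n, g (ε (q + i + 1) ω) ∂P ≤ (∫⁻ ω, f ω ∂P) * c ^ n := by
  induction n with
  | zero => simp
  | succ n ih =>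
    simp only [Finset.prod_range_succ, ← mul_assoc]
    have h1 : Measurable[innovSigma ε (Set.Iic (q + n))]
        fun ω => f ω * ∏ i ∈ Finset.range n, g (ε (q + i + 1) ω) :=
      (hf.mono (innovSigma_mono ε (Set.Iic_subset_Iic.2 (by omega))) le_rfl).mul
        (measurable_prod_innov hg q n)
    have h2 : Measurable[innovSigma ε {q + n + 1}] fun ω => g (ε (q + n + 1) ω) :=
      hg.comp (measurable_innovSigma ε rfl)
    rw [lintegral_mul_eq_lintegral_mul_lintegral_of_independent_measurableSpace
      (innovSigma_le hε _) (innovSigma_le hε _)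
      (indep_innovSigma hε hind (by simp)) h1 h2, pow_succ, ← mul_assoc]
    gcongr
    exact hc _

end Sigma

/-! ### The recursion restarted from zero, and the causal version of the process. -/

section Trajectory

/-- The operator with kernel `β` as a map of `H`. -/
def betaOp (β : unitInterval → unitInterval → ℝ) (u : H) : H := lpOf (kernelOp β u)

variable {β : unitInterval → unitInterval → ℝ}

theorem measurable_betaOp (hβ : Measurable (Function.uncurry β)) : Measurable (betaOp β) :=
  measurable_lpOf (measurable_kernelOp_ev hβ)

theorem betaOp_sub (hβ : Measurable (Function.uncurry β)) (hβ2 : kernelENorm β ≠ ∞) (u v : H) :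
    betaOp β (u - v) = betaOp β u - betaOp β v := by
  refine Lp.ext ?_
  filter_upwards [lpOf_ae_eq (memLp_kernelOp hβ hβ2 (u - v)), lpOf_ae_eq (memLp_kernelOp hβ hβ2 u),
    lpOf_ae_eq (memLp_kernelOp hβ hβ2 v), kernelOp_sub hβ hβ2 u v,
    Lp.coeFn_sub (betaOp β u) (betaOp β v)] with t h1 h2 h3 h4 h5
  rw [h5, Pi.sub_apply, betaOp, h1, betaOp, h2, betaOp, h3, h4]

theorem enorm_betaOp (hβ : Measurable (Function.uncurry β)) (hβ2 : kernelENorm β ≠ ∞) (u : H) :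
    ‖betaOp β u‖ₑ = eLpNorm (kernelOp β u) 2 volume := by
  rw [betaOp, Lp.enorm_def, eLpNorm_congr_ae (lpOf_ae_eq (memLp_kernelOp hβ hβ2 u))]

variable {Ω : Type*}

/-- The squared process started at time `q` from the value `0`. -/
def traj (β : unitInterval → unitInterval → ℝ) (δ : H) (ε : ℤ → Ω → H) (q : ℤ) : ℕ → Ω → H
  | 0 => fun _ => 0
  | n + 1 => fun ω => step β δ (ε (q + n + 1) ω) (traj β δ ε q n ω)

/-- Only the innovations in `(q, q+n]` enter, which makes the restarted path independent of the past
up to `q`. -/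
theorem measurable_traj (hβ : Measurable (Function.uncurry β)) (δ : H) (ε : ℤ → Ω → H) (q : ℤ)
    (n : ℕ) : Measurable[innovSigma ε (Set.Ioc q (q + n))] (traj β δ ε q n) := by
  induction n with
  | zero => exact measurable_const
  | succ n ih =>
    have h1 : Measurable[innovSigma ε (Set.Ioc q (q + ↑(n + 1)))] (ε (q + n + 1)) :=
      measurable_innovSigma ε (by simp only [Set.mem_Ioc]; push_cast; omega)
    have h2 : Measurable[innovSigma ε (Set.Ioc q (q + ↑(n + 1)))] (traj β δ ε q n) :=
      ih.mono (innovSigma_mono ε (Set.Ioc_subset_Ioc_right (by push_cast; omega))) le_rfl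
    have h3 := (measurable_step hβ δ).comp (h1.prodMk h2)
    exact h3

variable [mΩ : MeasurableSpace Ω] {P : Measure Ω} {δ : H} {ε Y : ℤ → Ω → H}

namespace IsSquaredARCH

variable (h : IsSquaredARCH P β δ ε Y)
include h

theorem traj_bounds (q : ℤ) (n : ℕ) : ∀ᵐ ω ∂P,
    (∀ᵐ t, 0 ≤ traj β δ ε q n ω t) ∧ ∀ᵐ t, traj β δ ε q n ω t ≤ Y (q + n) ω t := by
  induction n with
  | zero =>
    filter_upwards [h.nonneg q] with ω hω
    have h0 := Lp.coeFn_zero ℝ 2 (volume : Measure unitInterval)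
    simp only [traj]
    constructor
    · filter_upwards [h0] with t ht
      rw [ht]; rfl
    · filter_upwards [h0, hω] with t ht h1
      rw [ht]; simpa using h1
  | succ n ih =>
    filter_upwards [ih, h.recursion (q + n)] with ω h1 h2
    have := step_monotone h.measurable_kernel h.kernel_finite h.kernel_nonneg h.intercept_nonneg
      h1.1 h1.2 h2
    rw [Nat.cast_succ, ← add_assoc]
    exact ⟨this.1, this.2.1⟩

theorem sub_traj_succ (q : ℤ) (n : ℕ) : ∀ᵐ ω ∂P, ∀ᵐ t,
    (Y (q + n + 1) ω - traj β δ ε q (n + 1) ω : H) t =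
      ε (q + n + 1) ω t ^ 2 * kernelOp β (Y (q + n) ω - traj β δ ε q n ω : H) t := by
  filter_upwards [h.traj_bounds q n, h.recursion (q + n)] with ω h1 h2
  exact (step_monotone h.measurable_kernel h.kernel_finite h.kernel_nonneg h.intercept_nonneg
      h1.1 h1.2 h2).2.2

/-- The gap obeys the linear recursion `D ↦ ε² β(D)`. After one more application of `β`, each step
costs one contraction factor. -/
theorem enorm_betaOp_sub_traj_le (q : ℤ) (n : ℕ) : ∀ᵐ ω ∂P,
    ‖betaOp β (Y (q + n) ω - traj β δ ε q n ω)‖ₑ ≤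
      kernelENorm β * ‖Y q ω‖ₑ * ∏ i ∈ Finset.range n, contraction β (ε (q + i + 1) ω) := by
  induction n with
  | zero =>
    refine ae_of_all _ fun ω => ?_
    rw [enorm_betaOp h.measurable_kernel h.kernel_finite]
    simpa [traj] using eLpNorm_kernelOp_le h.measurable_kernel (Y q ω)
  | succ n ih =>
    filter_upwards [ih, h.sub_traj_succ q n] with ω h1 h2
    rw [Nat.cast_succ, ← add_assoc, Finset.prod_range_succ, ← mul_assoc,
      enorm_betaOp h.measurable_kernel h.kernel_finite, kernelOp_congr h2]
    refine (eLpNorm_kernelOp_sq_mul_le h.measurable_kernel _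
      (memLp_kernelOp h.measurable_kernel h.kernel_finite _)).trans ?_
    rw [← enorm_betaOp h.measurable_kernel h.kernel_finite, mul_comm]
    gcongr

/-- Allows the process to be replaced by its causal modification. -/
theorem congr {Y' : ℤ → Ω → H} (hm : ∀ k, Measurable (Y' k)) (hY : ∀ k, Y' k =ᵐ[P] Y k) :
    IsSquaredARCH P β δ ε Y' := by
  refine ⟨h.1, h.2, h.3, h.4, h.5, h.6, h.7, h.8, hm, fun k => ?_, fun k => ?_, ?_⟩
  · filter_upwards [hY k, h.nonneg k] with ω h1 h2
    rwa [h1]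
  · filter_upwards [hY k, hY (k + 1), h.recursion k] with ω h1 h2 h3
    rwa [h1, h2]
  · obtain ⟨M, hM, h1⟩ := h.moment
    refine ⟨M, hM, fun k => ?_⟩
    refine (le_of_eq (lintegral_congr_ae ?_)).trans (h1 k)
    filter_upwards [hY k] with ω hω
    rw [hω]

variable [IsProbabilityMeasure P]

/-- At this stage `Y q` is not known to be independent of later innovations. Cauchy-Schwarz
separates it from the product of contraction factors, and independence is used only inside the
product. -/
theorem lintegral_betaOp_sub_traj_le {ρ M : ℝ≥0∞}
    (hρ : ∀ k, ∫⁻ ω, contraction β (ε k ω) ^ 2 ∂P ≤ ρ ^ 2)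
    (hM : ∀ k, ∫⁻ ω, ‖Y k ω‖ₑ ^ 4 ∂P ≤ M) (q : ℤ) (n : ℕ) :
    ∫⁻ ω, ‖betaOp β (Y (q + n) ω - traj β δ ε q n ω)‖ₑ ∂P ≤
      kernelENorm β * M ^ (1 / 4 : ℝ) * ρ ^ n := by
  refine (lintegral_mono_ae (h.enorm_betaOp_sub_traj_le q n)).trans ?_
  simp only [mul_assoc]
  rw [lintegral_const_mul' _ _ h.kernel_finite]
  gcongr
  have hm1 := (h.measurable q).enorm
  have hm2 : Measurable fun ω => ∏ i ∈ Finset.range n, contraction β (ε (q + i + 1) ω) :=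
    Finset.measurable_fun_prod _ fun i _ =>
      (measurable_contraction h.measurable_kernel).comp (h.measurable_innovation _)
  have h1 := ENNReal.lintegral_mul_norm_pow_le (μ := P) (hm1.pow_const 2).aemeasurable
    (hm2.pow_const 2).aemeasurable (p := 1 / 2) (q := 1 / 2)
    (by norm_num) (by norm_num) (by norm_num)
  have h2 : ∀ c : ℝ≥0∞, (c ^ 2) ^ (1 / 2 : ℝ) = c := fun c => by
    rw [← ENNReal.rpow_natCast, ← ENNReal.rpow_mul]; norm_num
  simp only [h2] at h1
  refine h1.trans ?_
  gcongr
  · have h3 := sq_lintegral_le_lintegral_sq (μ := P) (hm1.pow_const 2).aemeasurable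
    simp only [← pow_mul, Nat.reduceMul] at h3
    rw [← h2 (∫⁻ ω, ‖Y q ω‖ₑ ^ 2 ∂P), ← ENNReal.rpow_mul]
    norm_num
    gcongr
    exact h3.trans (hM q)
  · rw [← h2 (ρ ^ n)]
    gcongr
    have h4 := lintegral_mul_prod_innov_le (P := P) h.measurable_innovation h.indep_innovation
      ((measurable_contraction h.measurable_kernel).pow_const 2) hρ q
      (f := fun _ => 1) measurable_const n
    simp only [one_mul, lintegral_const, measure_univ] at h4
    rw [← pow_mul, mul_comm n 2, pow_mul]
    simpa only [Finset.prod_pow] using h4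

/-- The start recedes to `m - r` while the end stays at `m`. The expected errors form a summable
geometric series, so the convergence is almost sure. -/
theorem tendsto_betaOp_traj (m : ℤ) : ∀ᵐ ω ∂P,
    Tendsto (fun r : ℕ => betaOp β (traj β δ ε (m - r) r ω)) atTop (𝓝 (betaOp β (Y m ω))) := by
  obtain ⟨ρ, hρ1, hρ⟩ := h.contracting
  obtain ⟨M, hM1, hM⟩ := h.moment
  have h1 := fun r : ℕ => h.lintegral_betaOp_sub_traj_le hρ hM (m - r) r
  simp only [sub_add_cancel] at h1
  have h2 : ∀ᵐ ω ∂P, Tendsto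
      (fun r : ℕ => ‖betaOp β (Y m ω - traj β δ ε (m - r) r ω)‖ₑ) atTop (𝓝 0) := by
    refine ae_tendsto_zero_of_tsum_lintegral (fun r => ?_) ?_
    · refine ((measurable_betaOp h.measurable_kernel).comp
        ((h.measurable m).sub ((measurable_traj h.measurable_kernel δ ε _ r).mono
          (innovSigma_le h.measurable_innovation _) le_rfl))).enorm.aemeasurable
    · refine ne_top_of_le_ne_top ?_ (ENNReal.tsum_le_tsum h1)
      rw [ENNReal.tsum_mul_left, ENNReal.tsum_geometric]
      refine ENNReal.mul_ne_top (ENNReal.mul_ne_top h.kernel_finite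
        (ENNReal.rpow_ne_top_of_nonneg (by norm_num) hM1)) ?_
      rw [ENNReal.inv_ne_top]
      exact (tsub_pos_of_lt hρ1).ne'
  filter_upwards [h2] with ω hω
  rw [tendsto_iff_edist_tendsto_0]
  refine hω.congr fun r => ?_
  rw [betaOp_sub h.measurable_kernel h.kernel_finite, edist_comm, edist_eq_enorm_sub]

/-- The limit of `β(traj)` is measurable with respect to the innovations up to `k - 1` and equals
`β(Y (k-1))` almost surely. One last use of the recursion, `Y k = (ε k)² (δ + β(Y (k-1)))`, recovers
the process. The limit is taken after applying `β` because only there the gap is known to vanish. -/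
theorem exists_causal : ∃ Y' : ℤ → Ω → H, IsSquaredARCH P β δ ε Y' ∧
    (∀ k, Measurable[innovSigma ε (Set.Iic k)] (Y' k)) ∧ ∀ k, Y' k =ᵐ[P] Y k := by
  let G : ℤ → Ω → H := fun m ω => limUnder atTop fun r : ℕ => betaOp β (traj β δ ε (m - r) r ω)
  have hG : ∀ m, Measurable[innovSigma ε (Set.Iic m)] (G m) := fun m => by
    have h1 : ∀ r : ℕ, Measurable[innovSigma ε (Set.Iic m)]
        fun ω => betaOp β (traj β δ ε (m - r) r ω) := fun r => by
      refine (measurable_betaOp h.measurable_kernel).comp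
        ((measurable_traj h.measurable_kernel δ ε _ r).mono (innovSigma_mono ε ?_) le_rfl)
      intro j hj
      simpa using hj.2
    have h2 := @StronglyMeasurable.limUnder ℕ Ω H (innovSigma ε (Set.Iic m)) _ _ atTop _
      (fun (r : ℕ) ω => betaOp β (traj β δ ε (m - r) r ω)) _ _ fun r => (h1 r).stronglyMeasurable
    exact h2.measurable
  let Φ : H × H → H := fun p => lpOf fun t => ev p.1 t ^ 2 * (ev δ t + ev p.2 t)
  have hΦ : Measurable Φ := by
    refine measurable_lpOf ?_
    have h1 : Measurable fun p : (H × H) × unitInterval =>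
        ev p.1.1 p.2 ^ 2 * (ev δ p.2 + ev p.1.2 p.2) := by fun_prop
    exact h1
  let Y' : ℤ → Ω → H := fun m ω => Φ (ε m ω, G (m - 1) ω)
  have hm : ∀ k, Measurable[innovSigma ε (Set.Iic k)] (Y' k) := fun k =>
    hΦ.comp ((measurable_innovSigma ε (by simp)).prodMk
      ((hG (k - 1)).mono (innovSigma_mono ε (Set.Iic_subset_Iic.2 (by omega))) le_rfl))
  have hY : ∀ k, Y' k =ᵐ[P] Y k := fun k => by
    have h3 := h.recursion (k - 1)
    simp only [sub_add_cancel] at h3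
    filter_upwards [h.tendsto_betaOp_traj (k - 1), h3] with ω h1 h2
    have h4 : G (k - 1) ω = betaOp β (Y (k - 1) ω) := h1.limUnder_eq
    simp only [Y', Φ, h4]
    rw [← lpOf_coe (Y k ω)]
    refine lpOf_congr ?_
    filter_upwards [h2, ev_ae_eq (ε k ω), ev_ae_eq δ, ev_ae_eq (betaOp β (Y (k - 1) ω)),
      lpOf_ae_eq (memLp_kernelOp h.measurable_kernel h.kernel_finite (Y (k - 1) ω))]
      with t h1 h2 h3 h4 h5
    rw [h1, h2, h3, h4, betaOp, h5]
  exact ⟨Y', h.congr (fun k => (hm k).mono (innovSigma_le h.measurable_innovation _) le_rfl) hY,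
    hm, hY⟩

end IsSquaredARCH

end Trajectory

/-! ### Decay of the overlap between the past and the gap `Y - traj`. -/

namespace IsSquaredARCH

variable {Ω : Type*} [mΩ : MeasurableSpace Ω] {P : Measure Ω} [IsProbabilityMeasure P]
  {β : unitInterval → unitInterval → ℝ} {δ : H} {ε Y : ℤ → Ω → H}
  (h : IsSquaredARCH P β δ ε Y)
include h

/-- For fixed `t` the factor `ε²(t)` of the new innovation is independent of the rest and has mean
1, so it disappears. No higher moment of `ε(t)` is needed, because it enters linearly in `ε²`. -/
theorem lintegral_mul_innovation {k : ℤ} {c : Ω → ℝ≥0∞} {U W : Ω → H}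
    (hc : Measurable[innovSigma ε (Set.Iic k)] c) (hU : Measurable[innovSigma ε (Set.Iic k)] U)
    (hW : Measurable[innovSigma ε (Set.Iic k)] W) :
    ∫⁻ ω, c ω * (∫⁻ t, ‖ev (U ω) t‖ₑ * (‖ev (ε (k + 1) ω) t‖ₑ ^ 2 * ‖ev (W ω) t‖ₑ)) ∂P =
      ∫⁻ ω, c ω * (∫⁻ t, ‖ev (U ω) t‖ₑ * ‖ev (W ω) t‖ₑ) ∂P := by
  have hle := innovSigma_le h.measurable_innovation (Set.Iic k)
  have hc' := hc.mono hle le_rfl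
  have hU' := hU.mono hle le_rfl
  have hW' := hW.mono hle le_rfl
  have hε := h.measurable_innovation (k + 1)
  have m1 : Measurable fun x : Ω × unitInterval => c x.1 *
      (‖ev (U x.1) x.2‖ₑ * (‖ev (ε (k + 1) x.1) x.2‖ₑ ^ 2 * ‖ev (W x.1) x.2‖ₑ)) := by fun_prop
  have m2 : Measurable fun x : Ω × unitInterval =>
      c x.1 * (‖ev (U x.1) x.2‖ₑ * ‖ev (W x.1) x.2‖ₑ) := by fun_prop
  have h1 : ∀ ω, c ω * (∫⁻ t, ‖ev (U ω) t‖ₑ * (‖ev (ε (k + 1) ω) t‖ₑ ^ 2 * ‖ev (W ω) t‖ₑ)) =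
      ∫⁻ t, c ω * (‖ev (U ω) t‖ₑ * (‖ev (ε (k + 1) ω) t‖ₑ ^ 2 * ‖ev (W ω) t‖ₑ)) := fun ω =>
    (lintegral_const_mul (c ω) (by fun_prop)).symm
  have h2 : ∀ ω, c ω * (∫⁻ t, ‖ev (U ω) t‖ₑ * ‖ev (W ω) t‖ₑ) =
      ∫⁻ t, c ω * (‖ev (U ω) t‖ₑ * ‖ev (W ω) t‖ₑ) := fun ω =>
    (lintegral_const_mul (c ω) (by fun_prop)).symm
  rw [lintegral_congr h1, lintegral_congr h2]
  rw [lintegral_lintegral_swap (f := fun ω t =>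
      c ω * (‖ev (U ω) t‖ₑ * (‖ev (ε (k + 1) ω) t‖ₑ ^ 2 * ‖ev (W ω) t‖ₑ))) m1.aemeasurable,
    lintegral_lintegral_swap (f := fun ω t => c ω * (‖ev (U ω) t‖ₑ * ‖ev (W ω) t‖ₑ))
      m2.aemeasurable]
  refine lintegral_congr_ae ((h.unit (k + 1)).mono fun t ht => ?_)
  have hev : Measurable fun x : H => ‖ev x t‖ₑ := by fun_prop
  have hev2 : Measurable fun x : H => ‖ev x t‖ₑ ^ 2 := by fun_prop
  have h3 : Measurable[innovSigma ε (Set.Iic k)]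
      fun ω => c ω * (‖ev (U ω) t‖ₑ * ‖ev (W ω) t‖ₑ) :=
    hc.mul ((hev.comp hU).mul (hev.comp hW))
  have h4 : Measurable[innovSigma ε {k + 1}] fun ω => ‖ev (ε (k + 1) ω) t‖ₑ ^ 2 :=
    hev2.comp (measurable_innovSigma ε rfl)
  have h5 := lintegral_mul_eq_lintegral_mul_lintegral_of_independent_measurableSpace hle
    (innovSigma_le h.measurable_innovation _)
    (indep_innovSigma h.measurable_innovation h.indep_innovation (by simp)) h3 h4
  rw [ht, mul_one] at h5
  simp only []
  rw [← h5]
  refine lintegral_congr fun ω => ?_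
  ring

omit [IsProbabilityMeasure P] in
theorem enorm_sub_traj_le (q : ℤ) (n : ℕ) : ∀ᵐ ω ∂P,
    ‖Y (q + n) ω - traj β δ ε q n ω‖ₑ ≤ ‖Y (q + n) ω‖ₑ := by
  filter_upwards [h.traj_bounds q n] with ω h1
  rw [Lp.enorm_def, Lp.enorm_def]
  refine eLpNorm_mono_ae ?_
  filter_upwards [h1.1, h1.2, Lp.coeFn_sub (Y (q + n) ω) (traj β δ ε q n ω)] with t h1 h2 h3
  rw [h3, Pi.sub_apply, Real.norm_of_nonneg (by linarith), Real.norm_of_nonneg (by linarith)]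
  linarith

omit [IsProbabilityMeasure P] in
theorem enorm_traj_le (q : ℤ) (n : ℕ) : ∀ᵐ ω ∂P,
    ‖traj β δ ε q n ω‖ₑ ≤ ‖Y (q + n) ω‖ₑ := by
  filter_upwards [h.traj_bounds q n] with ω h1
  rw [Lp.enorm_def, Lp.enorm_def]
  refine eLpNorm_mono_ae ?_
  filter_upwards [h1.1, h1.2] with t h1 h2
  rwa [Real.norm_of_nonneg (by linarith), Real.norm_of_nonneg (by linarith)]

omit h in
theorem lintegral_enorm_mul_enorm_le (u v : H) :
    ∫⁻ t, ‖u t‖ₑ * ‖v t‖ₑ ≤ ‖u‖ₑ * ‖v‖ₑ := by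
  rw [Lp.enorm_def, Lp.enorm_def]
  simpa only [enorm_mul] using
    lintegral_mul_le_eLpNorm (Lp.aestronglyMeasurable u) (Lp.aestronglyMeasurable v)

omit h in
theorem enorm_inner_le_lintegral (u v : H) :
    ‖(inner ℝ u v : ℝ)‖ₑ ≤ ∫⁻ t, ‖u t‖ₑ * ‖v t‖ₑ := by
  rw [L2.inner_def]
  refine (enorm_integral_le_lintegral_enorm _).trans (le_of_eq (lintegral_congr fun t => ?_))
  simp [enorm_mul, mul_comm]

/-- The gap at time `q+n+1` is `ε²` times a quantity `W` known at time `q+n`. After the newest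
innovation is removed, `W` is bounded by `n` contraction factors that are independent of `Y p` and
`Y q`. The weight `‖Y p‖²` exhausts the four available moments: what is left is `E ‖Y p‖³ ‖Y q‖ ≤
M`. -/
theorem lintegral_sq_mul_overlap_le
    (hcausal : ∀ k, Measurable[innovSigma ε (Set.Iic k)] (Y k)) {ρ M : ℝ≥0∞}
    (hρ : ∀ k, ∫⁻ ω, contraction β (ε k ω) ^ 2 ∂P ≤ ρ ^ 2)
    (hM : ∀ k, ∫⁻ ω, ‖Y k ω‖ₑ ^ 4 ∂P ≤ M) {p q : ℤ} (hpq : p ≤ q) (n : ℕ) :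
    ∫⁻ ω, ‖Y p ω‖ₑ ^ 2 *
        (∫⁻ t, ‖Y p ω t‖ₑ * ‖(Y (q + n + 1) ω - traj β δ ε q (n + 1) ω : H) t‖ₑ) ∂P ≤
      kernelENorm β * M * ρ ^ n := by
  let W : Ω → H := fun ω => betaOp β (Y (q + n) ω - traj β δ ε q n ω)
  have hW : Measurable[innovSigma ε (Set.Iic (q + n))] W := by
    have h1 : Measurable[innovSigma ε (Set.Iic (q + n))]
        fun ω => Y (q + n) ω - traj β δ ε q n ω :=
      (hcausal _).sub ((measurable_traj h.measurable_kernel δ ε q n).mono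
        (innovSigma_mono ε (fun j hj => hj.2)) le_rfl)
    exact (measurable_betaOp h.measurable_kernel).comp h1
  have hYp : Measurable[innovSigma ε (Set.Iic (q + n))] (Y p) :=
    (hcausal p).mono (innovSigma_mono ε (Set.Iic_subset_Iic.2 (by omega))) le_rfl
  have e1 : ∫⁻ ω, ‖Y p ω‖ₑ ^ 2 *
        (∫⁻ t, ‖Y p ω t‖ₑ * ‖(Y (q + n + 1) ω - traj β δ ε q (n + 1) ω : H) t‖ₑ) ∂P =
      ∫⁻ ω, ‖Y p ω‖ₑ ^ 2 * (∫⁻ t, ‖ev (Y p ω) t‖ₑ *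
        (‖ev (ε (q + n + 1) ω) t‖ₑ ^ 2 * ‖ev (W ω) t‖ₑ)) ∂P := by
    refine lintegral_congr_ae ((h.sub_traj_succ q n).mono fun ω hω => ?_)
    simp only
    congr 1
    refine lintegral_congr_ae ?_
    filter_upwards [hω, ev_ae_eq (Y p ω), ev_ae_eq (ε (q + n + 1) ω), ev_ae_eq (W ω),
      lpOf_ae_eq (memLp_kernelOp h.measurable_kernel h.kernel_finite
        (Y (q + n) ω - traj β δ ε q n ω))] with t h1 h2 h3 h4 h5
    rw [h1, h2, h3, h4]
    simp only [W, betaOp]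
    rw [h5, enorm_mul, enorm_pow]
  have hsq : Measurable fun u : H => ‖u‖ₑ ^ 2 := by fun_prop
  rw [e1]
  refine (le_of_eq (h.lintegral_mul_innovation (hsq.comp hYp) hYp hW)).trans ?_
  have e2 : ∀ᵐ ω ∂P, ‖Y p ω‖ₑ ^ 2 * ∫⁻ t, ‖ev (Y p ω) t‖ₑ * ‖ev (W ω) t‖ₑ ≤
      kernelENorm β * ((‖Y p ω‖ₑ ^ 3 * ‖Y q ω‖ₑ) *
        ∏ i ∈ Finset.range n, contraction β (ε (q + i + 1) ω)) := by
    filter_upwards [h.enorm_betaOp_sub_traj_le q n] with ω hω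
    have h1 : ∫⁻ t, ‖ev (Y p ω) t‖ₑ * ‖ev (W ω) t‖ₑ ≤ ‖Y p ω‖ₑ * ‖W ω‖ₑ := by
      refine (le_of_eq (lintegral_congr_ae ?_)).trans (lintegral_enorm_mul_enorm_le _ _)
      filter_upwards [ev_ae_eq (Y p ω), ev_ae_eq (W ω)] with t h1 h2
      rw [h1, h2]
    calc _ ≤ ‖Y p ω‖ₑ ^ 2 * (‖Y p ω‖ₑ * (kernelENorm β * ‖Y q ω‖ₑ *
          ∏ i ∈ Finset.range n, contraction β (ε (q + i + 1) ω))) := by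
            gcongr
            exact h1.trans (by gcongr)
      _ = _ := by ring
  refine (lintegral_mono_ae e2).trans ?_
  rw [lintegral_const_mul' _ _ h.kernel_finite, mul_assoc]
  gcongr
  have hK : ∀ k, ∫⁻ ω, contraction β (ε k ω) ∂P ≤ ρ := fun k => by
    have h1 := (sq_lintegral_le_lintegral_sq (μ := P)
      ((measurable_contraction h.measurable_kernel).comp
        (h.measurable_innovation k)).aemeasurable).trans (hρ k)
    exact (ENNReal.pow_le_pow_left_iff two_ne_zero).1 h1
  have hf : Measurable[innovSigma ε (Set.Iic q)] fun ω => ‖Y p ω‖ₑ ^ 3 * ‖Y q ω‖ₑ := by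
    have h1 : Measurable[innovSigma ε (Set.Iic q)] (Y p) :=
      (hcausal p).mono (innovSigma_mono ε (Set.Iic_subset_Iic.2 hpq)) le_rfl
    have hcube : Measurable fun u : H => ‖u‖ₑ ^ 3 := by fun_prop
    exact (hcube.comp h1).mul (measurable_enorm.comp (hcausal q))
  refine (lintegral_mul_prod_innov_le h.measurable_innovation h.indep_innovation
    (measurable_contraction h.measurable_kernel) hK q hf n).trans ?_
  gcongr
  have h6 := ENNReal.lintegral_mul_norm_pow_le (μ := P)
    ((h.measurable p).enorm.pow_const 4).aemeasurable
    ((h.measurable q).enorm.pow_const 4).aemeasurable (p := 3 / 4) (q := 1 / 4)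
    (by norm_num) (by norm_num) (by norm_num)
  have h7 : ∀ c : ℝ≥0∞, (c ^ 4) ^ (1 / 4 : ℝ) = c := fun c => by
    rw [← ENNReal.rpow_natCast, ← ENNReal.rpow_mul]; norm_num
  have h8 : ∀ c : ℝ≥0∞, (c ^ 4) ^ (3 / 4 : ℝ) = c ^ 3 := fun c => by
    rw [← ENNReal.rpow_natCast, ← ENNReal.rpow_mul, ← ENNReal.rpow_natCast]; norm_num
  simp only [h7, h8] at h6
  calc _ ≤ _ := h6
    _ ≤ M ^ (3 / 4 : ℝ) * M ^ (1 / 4 : ℝ) := by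
      gcongr
      · exact hM p
      · exact hM q
    _ = M := by
      rw [← ENNReal.rpow_add_of_nonneg _ _ (by norm_num) (by norm_num)]; norm_num

/-- Hölder interpolation between the decaying overlap, which is linear in the gap, and the fourth
moment of the gap, which is bounded since the gap is dominated by `Y`. -/
theorem lintegral_sq_inner_sub_traj_le
    (hcausal : ∀ k, Measurable[innovSigma ε (Set.Iic k)] (Y k)) {ρ M : ℝ≥0∞}
    (hρ : ∀ k, ∫⁻ ω, contraction β (ε k ω) ^ 2 ∂P ≤ ρ ^ 2)
    (hM : ∀ k, ∫⁻ ω, ‖Y k ω‖ₑ ^ 4 ∂P ≤ M) {p q : ℤ} (hpq : p ≤ q) (n : ℕ) :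
    ∫⁻ ω, ‖(inner ℝ (Y p ω) (Y (q + n + 1) ω - traj β δ ε q (n + 1) ω) : ℝ)‖ₑ ^ 2 ∂P ≤
      (kernelENorm β * M * ρ ^ n) ^ (2 / 3 : ℝ) * M ^ (1 / 3 : ℝ) := by
  let D : Ω → H := fun ω => Y (q + n + 1) ω - traj β δ ε q (n + 1) ω
  let V : Ω → ℝ≥0∞ := fun ω => ∫⁻ t, ‖Y p ω t‖ₑ * ‖D ω t‖ₑ
  have hYp := h.measurable p
  have hD : Measurable D := (h.measurable _).sub
    ((measurable_traj h.measurable_kernel δ ε q (n + 1)).mono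
      (innovSigma_le h.measurable_innovation _) le_rfl)
  have hV : Measurable V := by
    have : V = fun ω => ∫⁻ t, ‖ev (Y p ω) t‖ₑ * ‖ev (D ω) t‖ₑ := by
      ext ω
      refine lintegral_congr_ae ?_
      filter_upwards [ev_ae_eq (Y p ω), ev_ae_eq (D ω)] with t h1 h2
      rw [h1, h2]
    rw [this]
    exact Measurable.lintegral_prod_right' (f := fun x : Ω × unitInterval =>
      ‖ev (Y p x.1) x.2‖ₑ * ‖ev (D x.1) x.2‖ₑ) (by fun_prop)
  have h1 : ∀ ω, ‖(inner ℝ (Y p ω) (D ω) : ℝ)‖ₑ ^ 2 ≤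
      (‖Y p ω‖ₑ ^ 2 * V ω) ^ (2 / 3 : ℝ) * (‖D ω‖ₑ ^ 4) ^ (1 / 3 : ℝ) := fun ω => by
    have h2 := enorm_inner_le_lintegral (Y p ω) (D ω)
    have h3 : V ω ≤ ‖Y p ω‖ₑ * ‖D ω‖ₑ := lintegral_enorm_mul_enorm_le _ _
    calc ‖(inner ℝ (Y p ω) (D ω) : ℝ)‖ₑ ^ 2 ≤ V ω ^ 2 := by gcongr
      -- The exponents are forced: bounding `V^(4/3)` by Cauchy-Schwarz must produce `‖Y p‖^(4/3)`,
      -- to complete `(‖Y p‖² V)^(2/3)`, and leave `(‖D‖⁴)^(1/3)`.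
      _ = V ω ^ (2 / 3 : ℝ) * V ω ^ (4 / 3 : ℝ) := by
        rw [← ENNReal.rpow_add_of_nonneg _ _ (by norm_num) (by norm_num), ← ENNReal.rpow_natCast]
        norm_num
      _ ≤ V ω ^ (2 / 3 : ℝ) * (‖Y p ω‖ₑ * ‖D ω‖ₑ) ^ (4 / 3 : ℝ) := by gcongr
      _ = _ := by
        rw [ENNReal.mul_rpow_of_nonneg _ _ (by norm_num), ENNReal.mul_rpow_of_nonneg _ _ (by norm_num),
          ← ENNReal.rpow_natCast, ← ENNReal.rpow_natCast, ← ENNReal.rpow_mul, ← ENNReal.rpow_mul]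
        norm_num
        ring
  refine (lintegral_mono h1).trans ((ENNReal.lintegral_mul_norm_pow_le
    ((hYp.enorm.pow_const 2).mul hV).aemeasurable (hD.enorm.pow_const 4).aemeasurable
    (by norm_num) (by norm_num) (by norm_num)).trans ?_)
  gcongr
  · exact h.lintegral_sq_mul_overlap_le hcausal hρ hM hpq n
  · refine le_trans (lintegral_mono_ae ?_) (hM (q + n + 1))
    have h4 := h.enorm_sub_traj_le q (n + 1)
    simp only [Nat.cast_succ, ← add_assoc] at h4
    filter_upwards [h4] with ω hω
    simp only [D]
    gcongr

end IsSquaredARCH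

/-! ### Variances of sums in a Hilbert space. -/

section HilbertVariance

variable {Ω : Type*} [MeasurableSpace Ω] {P : Measure Ω}
  {G : Type*} [NormedAddCommGroup G] [InnerProductSpace ℝ G]

theorem integrable_inner_of_memLp {f g : Ω → G} (hf : MemLp f 2 P) (hg : MemLp g 2 P) :
    Integrable (fun ω => (inner ℝ (f ω) (g ω) : ℝ)) P := by
  refine (hf.norm.integrable_mul hg.norm).mono' (hf.1.inner hg.1) (ae_of_all _ fun ω => ?_)
  exact norm_inner_le_norm _ _

/-- Adding `X N` increases the second moment by `E‖X N‖²` plus twice its covariances with the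
earlier terms, at most `2C/(1-θ)` by the geometric series. Only upper bounds on the covariances are
needed. -/
theorem integral_norm_sq_sum_le {X : ℕ → Ω → G} (hX : ∀ k, MemLp (X k) 2 P) {C θ : ℝ}
    (hC : 0 ≤ C) (hθ : 0 ≤ θ) (hθ1 : θ < 1)
    (hcov : ∀ k n, ∫ ω, (inner ℝ (X k ω) (X (k + n) ω) : ℝ) ∂P ≤ C * θ ^ n) (N : ℕ) :
    ∫ ω, ‖∑ k ∈ Finset.range N, X k ω‖ ^ 2 ∂P ≤ 2 * C / (1 - θ) * N := by
  have hS : ∀ N, MemLp (fun ω => ∑ k ∈ Finset.range N, X k ω) 2 P := fun N =>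
    memLp_finsetSum _ fun k _ => hX k
  have h1θ : 0 < 1 - θ := by linarith
  induction N with
  | zero => simp
  | succ N ih =>
    have e1 : ∀ ω, ‖∑ k ∈ Finset.range (N + 1), X k ω‖ ^ 2 =
        ‖∑ k ∈ Finset.range N, X k ω‖ ^ 2 +
          (2 * ∑ k ∈ Finset.range N, (inner ℝ (X k ω) (X N ω) : ℝ) +
            inner ℝ (X N ω) (X N ω)) := fun ω => by
      rw [Finset.sum_range_succ, norm_add_sq_real, sum_inner, real_inner_self_eq_norm_sq]
      ring
    have hi : ∀ k l, Integrable (fun ω => (inner ℝ (X k ω) (X l ω) : ℝ)) P := fun k l =>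
      integrable_inner_of_memLp (hX k) (hX l)
    have hi2 : Integrable (fun ω => ∑ k ∈ Finset.range N, (inner ℝ (X k ω) (X N ω) : ℝ)) P :=
      integrable_finsetSum _ fun k _ => hi k N
    have hi0 : Integrable (fun ω => ‖∑ k ∈ Finset.range N, X k ω‖ ^ 2) P :=
      (hS N).integrable_norm_pow two_ne_zero
    have hi3 : Integrable (fun ω => 2 * ∑ k ∈ Finset.range N, (inner ℝ (X k ω) (X N ω) : ℝ) +
        inner ℝ (X N ω) (X N ω)) P := (hi2.const_mul 2).add (hi N N)
    rw [integral_congr_ae (ae_of_all _ e1), integral_add hi0 hi3,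
      integral_add (hi2.const_mul 2) (hi N N), integral_const_mul,
      integral_finsetSum _ fun k _ => hi k N]
    have h2 : ∑ k ∈ Finset.range N, ∫ ω, (inner ℝ (X k ω) (X N ω) : ℝ) ∂P ≤
        ∑ k ∈ Finset.range N, C * θ ^ (N - k) := by
      refine Finset.sum_le_sum fun k hk => ?_
      have := hcov k (N - k)
      rwa [Nat.add_sub_cancel' (Finset.mem_range.1 hk).le] at this
    have h3 : ∫ ω, (inner ℝ (X N ω) (X N ω) : ℝ) ∂P ≤ C * θ ^ 0 := hcov N 0
    have h4 : ∑ k ∈ Finset.range (N + 1), C * θ ^ (N - k) ≤ C / (1 - θ) := by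
      have h6 := Finset.sum_range_reflect (fun k => C * θ ^ k) (N + 1)
      simp only [Nat.add_sub_cancel] at h6
      rw [h6, ← Finset.mul_sum, div_eq_mul_inv]
      gcongr
      rw [← tsum_geometric_of_lt_one hθ hθ1]
      exact (summable_geometric_of_lt_one hθ hθ1).sum_le_tsum _ fun i _ => by positivity
    rw [Finset.sum_range_succ, Nat.sub_self] at h4
    have h5 : 2 * C / (1 - θ) * (N + 1 : ℕ) = 2 * C / (1 - θ) * N + 2 * (C / (1 - θ)) := by
      push_cast
      ring
    rw [h5]
    have h7 : 0 ≤ C * θ ^ 0 := by simpa using hC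
    linarith

variable [IsProbabilityMeasure P] [CompleteSpace G]

omit [IsProbabilityMeasure P] in
theorem integral_inner_const {f : Ω → G} (hf : Integrable f P) (c : G) :
    ∫ ω, (inner ℝ (f ω) c : ℝ) ∂P = inner ℝ (∫ ω, f ω ∂P) c := by
  simp only [real_inner_comm c]
  exact (innerSL ℝ c).integral_comp_comm hf

omit [IsProbabilityMeasure P] in
theorem integral_const_inner {f : Ω → G} (hf : Integrable f P) (c : G) :
    ∫ ω, (inner ℝ c (f ω) : ℝ) ∂P = inner ℝ c (∫ ω, f ω ∂P) :=
  (innerSL ℝ c).integral_comp_comm hf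

omit [IsProbabilityMeasure P] in
-- The inner product of the means is the double integral over two independent copies.
theorem inner_integral_nonneg {f g : Ω → G} (hf : Integrable f P) (hg : Integrable g P)
    (h : ∀ᵐ ω ∂P, ∀ᵐ ω' ∂P, 0 ≤ (inner ℝ (f ω) (g ω') : ℝ)) :
    0 ≤ (inner ℝ (∫ ω, f ω ∂P) (∫ ω, g ω ∂P) : ℝ) := by
  rw [← integral_inner_const hf]
  refine integral_nonneg_of_ae (h.mono fun ω hω => ?_)
  simp only [Pi.zero_apply]
  rw [← integral_const_inner hg]
  exact integral_nonneg_of_ae hω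

/-- If `S'` has the product moment of an independent variable with `T`, then the covariance of `T`
and `S` is controlled by the overlap of `T` with `S - S'`. -/
theorem integral_inner_centred_le {T S S' : Ω → G} (hT : MemLp T 2 P) (hS : MemLp S 2 P)
    (hS' : MemLp S' 2 P)
    (hind : ∫ ω, (inner ℝ (T ω) (S' ω) : ℝ) ∂P = inner ℝ (∫ ω, T ω ∂P) (∫ ω, S' ω ∂P))
    (hpos : ∀ᵐ ω ∂P, ∀ᵐ ω' ∂P, 0 ≤ (inner ℝ (T ω) (S ω' - S' ω') : ℝ)) :
    ∫ ω, (inner ℝ (T ω - ∫ ω, T ω ∂P) (S ω - ∫ ω, S ω ∂P) : ℝ) ∂P ≤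
      ∫ ω, (inner ℝ (T ω) (S ω - S' ω) : ℝ) ∂P := by
  have iT := hT.integrable one_le_two
  have iS := hS.integrable one_le_two
  have iS' := hS'.integrable one_le_two
  -- Positivity gives `⟨ET, ES'⟩ ≤ ⟨ET, ES⟩`, so replacing the product of means by the moment with
  -- `S'` can only enlarge the covariance.
  have h1 := inner_integral_nonneg iT (iS.sub iS') hpos
  simp only [Pi.sub_apply] at h1
  rw [integral_sub iS iS', inner_sub_right, ← hind] at h1
  have h2 : ∫ ω, (inner ℝ (T ω) (S ω - S' ω) : ℝ) ∂P =
      ∫ ω, (inner ℝ (T ω) (S ω) : ℝ) ∂P - ∫ ω, (inner ℝ (T ω) (S' ω) : ℝ) ∂P := by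
    simp only [inner_sub_right]
    exact integral_sub (integrable_inner_of_memLp hT hS) (integrable_inner_of_memLp hT hS')
  have h3 : ∫ ω, (inner ℝ (T ω - ∫ ω, T ω ∂P) (S ω - ∫ ω, S ω ∂P) : ℝ) ∂P =
      ∫ ω, (inner ℝ (T ω) (S ω) : ℝ) ∂P - inner ℝ (∫ ω, T ω ∂P) (∫ ω, S ω ∂P) := by
    have e : ∀ ω, (inner ℝ (T ω - ∫ ω, T ω ∂P) (S ω - ∫ ω, S ω ∂P) : ℝ) =
        inner ℝ (T ω) (S ω) - inner ℝ (T ω) (∫ ω, S ω ∂P) -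
          (inner ℝ (∫ ω, T ω ∂P) (S ω) - inner ℝ (∫ ω, T ω ∂P) (∫ ω, S ω ∂P)) := fun ω => by
      rw [inner_sub_left, inner_sub_right, inner_sub_right]
    have i1 := integrable_inner_of_memLp hT hS
    have i2 := iT.inner_const (𝕜 := ℝ) (∫ ω, S ω ∂P)
    have i3 := iS.const_inner (𝕜 := ℝ) (∫ ω, T ω ∂P)
    have i4 : Integrable (fun ω =>
        (inner ℝ (T ω) (S ω) - inner ℝ (T ω) (∫ ω, S ω ∂P) : ℝ)) P := i1.sub i2
    have i5 : Integrable (fun ω => (inner ℝ (∫ ω, T ω ∂P) (S ω) -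
        inner ℝ (∫ ω, T ω ∂P) (∫ ω, S ω ∂P) : ℝ)) P := i3.sub (integrable_const _)
    rw [integral_congr_ae (ae_of_all _ e), integral_sub i4 i5,
      integral_sub i1 i2, integral_sub i3 (integrable_const _), integral_inner_const iT,
      integral_const_inner iS]
    simp
  rw [h3, h2]
  linarith

end HilbertVariance

/-! ### A uniform geometric bound for weighted overlaps. -/

section Overlap

namespace IsSquaredARCH

variable {Ω : Type*} [mΩ : MeasurableSpace Ω] {P : Measure Ω} [IsProbabilityMeasure P]
  {β : unitInterval → unitInterval → ℝ} {δ : H} {ε Y : ℤ → Ω → H}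
  (h : IsSquaredARCH P β δ ε Y)
include h

theorem exists_overlap_bound
    (hcausal : ∀ k, Measurable[innovSigma ε (Set.Iic k)] (Y k)) :
    ∃ (M : ℝ≥0∞) (C θ : ℝ), 1 ≤ M ∧ M ≠ ∞ ∧ 0 ≤ C ∧ 0 < θ ∧ θ < 1 ∧
      (∀ k, ∫⁻ ω, ‖Y k ω‖ₑ ^ 4 ∂P ≤ M) ∧
      ∀ (p q : ℤ) (n : ℕ) (g : Ω → ℝ≥0∞), p ≤ q → AEMeasurable g P → ∫⁻ ω, g ω ^ 2 ∂P ≤ M →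
        ∫⁻ ω, ‖(inner ℝ (Y p ω) (Y (q + n + 1) ω - traj β δ ε q (n + 1) ω) : ℝ)‖ₑ * g ω ∂P ≤
          ENNReal.ofReal (C * θ ^ n) := by
  obtain ⟨ρ, hρ1, hρ⟩ := h.contracting
  obtain ⟨M, hM1, hM⟩ := h.moment
  have hρt : ρ ≠ ∞ := (hρ1.trans ENNReal.one_lt_top).ne
  let b := kernelENorm β
  -- With `1 ≤ M'` the weight `g = 1` is admissible, and `M' ≤ M'^2` later bounds second moments by
  -- the same constant.
  let M' := max M 1
  have hM't : M' ≠ ∞ := by simp [M', hM1]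
  have hbt : b ≠ ∞ := h.kernel_finite
  have hM' : ∀ k, ∫⁻ ω, ‖Y k ω‖ₑ ^ 4 ∂P ≤ M' := fun k => (hM k).trans (le_max_left _ _)
  let C : ℝ≥0∞ := ((b * M') ^ (2 / 3 : ℝ) * M' ^ (1 / 3 : ℝ)) ^ (1 / 2 : ℝ) * M' ^ (1 / 2 : ℝ)
  have hC : C ≠ ∞ := by
    refine ENNReal.mul_ne_top (ENNReal.rpow_ne_top_of_nonneg (by norm_num) (ENNReal.mul_ne_top ?_ ?_)) ?_
    · exact ENNReal.rpow_ne_top_of_nonneg (by norm_num) (ENNReal.mul_ne_top hbt hM't)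
    · exact ENNReal.rpow_ne_top_of_nonneg (by norm_num) hM't
    · exact ENNReal.rpow_ne_top_of_nonneg (by norm_num) hM't
  have hθ : ρ ^ (1 / 3 : ℝ) < 1 := ENNReal.rpow_lt_one hρ1 (by norm_num)
  have hθt : ρ ^ (1 / 3 : ℝ) ≠ ∞ := (hθ.trans ENNReal.one_lt_top).ne
  -- The rate is `ρ^(1/3)`: the exponent `2/3` of the second-moment bound, halved by Cauchy-Schwarz.
  -- The maximum with `1/2` keeps `θ` positive, because powers of it are divided by later.
  refine ⟨M', C.toReal, max (ρ ^ (1 / 3 : ℝ)).toReal (1 / 2), le_max_right _ _, hM't,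
    ENNReal.toReal_nonneg, by positivity, ?_, hM', ?_⟩
  · refine max_lt ?_ (by norm_num)
    rw [← ENNReal.toReal_one]
    exact (ENNReal.toReal_lt_toReal hθt (by simp)).2 hθ
  intro p q n g hpq hg hgM
  have h1 := h.lintegral_sq_inner_sub_traj_le hcausal hρ hM' hpq n
  have hD : Measurable fun ω => Y (q + n + 1) ω - traj β δ ε q (n + 1) ω := (h.measurable _).sub
    ((measurable_traj h.measurable_kernel δ ε q (n + 1)).mono
      (innovSigma_le h.measurable_innovation _) le_rfl)
  have hV : Measurable fun ω =>
      ‖(inner ℝ (Y p ω) (Y (q + n + 1) ω - traj β δ ε q (n + 1) ω) : ℝ)‖ₑ :=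
    ((h.measurable p).inner hD).enorm
  have h2 := ENNReal.lintegral_mul_norm_pow_le (μ := P) (hV.pow_const 2).aemeasurable
    (hg.pow_const 2) (p := 1 / 2) (q := 1 / 2) (by norm_num) (by norm_num) (by norm_num)
  have h3 : ∀ c : ℝ≥0∞, (c ^ 2) ^ (1 / 2 : ℝ) = c := fun c => by
    rw [← ENNReal.rpow_natCast, ← ENNReal.rpow_mul]; norm_num
  simp only [h3] at h2
  calc _ ≤ _ := h2
    _ ≤ ((kernelENorm β * M' * ρ ^ n) ^ (2 / 3 : ℝ) * M' ^ (1 / 3 : ℝ)) ^ (1 / 2 : ℝ) *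
        M' ^ (1 / 2 : ℝ) := by gcongr
    _ = C * (ρ ^ (1 / 3 : ℝ)) ^ n := by
      simp only [C, b]
      rw [ENNReal.mul_rpow_of_nonneg _ (ρ ^ n) (by norm_num), mul_right_comm _ _ (M' ^ (1 / 3 : ℝ)),
        ENNReal.mul_rpow_of_nonneg _ _ (by norm_num : (0 : ℝ) ≤ 1 / 2), mul_right_comm]
      congr 1
      rw [← ENNReal.rpow_natCast, ← ENNReal.rpow_natCast, ← ENNReal.rpow_mul, ← ENNReal.rpow_mul,
        ← ENNReal.rpow_mul]
      congr 1
      ring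
    _ ≤ ENNReal.ofReal C.toReal *
        ENNReal.ofReal (max (ρ ^ (1 / 3 : ℝ)).toReal (1 / 2)) ^ n := by
      rw [ENNReal.ofReal_toReal hC]
      gcongr
      rw [← ENNReal.ofReal_toReal hθt]
      exact ENNReal.ofReal_le_ofReal (by simp)
    _ = _ := by
      rw [ENNReal.ofReal_mul ENNReal.toReal_nonneg, ENNReal.ofReal_pow (by positivity)]

end IsSquaredARCH

end Overlap

/-! ### Geometric upper bounds for covariances of the process and of its tensor products. -/

section Covariance

theorem enorm_inner_le_enorm {G : Type*} [NormedAddCommGroup G] [InnerProductSpace ℝ G] (x y : G) :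
    ‖(inner ℝ x y : ℝ)‖ₑ ≤ ‖x‖ₑ * ‖y‖ₑ := by
  rw [← ofReal_norm, ← ofReal_norm, ← ofReal_norm, ← ENNReal.ofReal_mul (norm_nonneg _)]
  exact ENNReal.ofReal_le_ofReal (norm_inner_le_norm _ _)

theorem inner_nonneg_of_ae {u v : H} (hu : ∀ᵐ t, 0 ≤ u t) (hv : ∀ᵐ t, 0 ≤ v t) :
    0 ≤ (inner ℝ u v : ℝ) := by
  rw [L2.inner_def]
  refine integral_nonneg_of_ae ?_
  filter_upwards [hu, hv] with t h1 h2
  simpa using mul_nonneg h2 h1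

theorem inner_le_inner_of_ae {u v w : H} (hu : ∀ᵐ t, 0 ≤ u t) (hvw : ∀ᵐ t, v t ≤ w t) :
    (inner ℝ u v : ℝ) ≤ inner ℝ u w := by
  rw [← sub_nonneg, ← inner_sub_right]
  refine inner_nonneg_of_ae hu ?_
  filter_upwards [hvw, Lp.coeFn_sub w v] with t h1 h2
  rw [h2]
  exact sub_nonneg.2 h1

theorem integral_le_of_lintegral_enorm_le {Ω : Type*} [MeasurableSpace Ω] {P : Measure Ω}
    {f : Ω → ℝ} {c : ℝ} (hc : 0 ≤ c) (h : ∫⁻ ω, ‖f ω‖ₑ ∂P ≤ ENNReal.ofReal c) :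
    ∫ ω, f ω ∂P ≤ c := by
  refine (le_abs_self _).trans ?_
  rw [← Real.norm_eq_abs, ← ENNReal.ofReal_le_ofReal_iff hc, ofReal_norm]
  exact (enorm_integral_le_lintegral_enorm f).trans h

theorem lintegral_sq_mul_le_of_pow_four {Ω : Type*} [MeasurableSpace Ω] {P : Measure Ω}
    {f g : Ω → ℝ≥0∞} (hf : AEMeasurable f P) (hg : AEMeasurable g P) {M : ℝ≥0∞}
    (h1 : ∫⁻ ω, f ω ^ 4 ∂P ≤ M) (h2 : ∫⁻ ω, g ω ^ 4 ∂P ≤ M) :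
    ∫⁻ ω, (f ω * g ω) ^ 2 ∂P ≤ M := by
  have h := ENNReal.lintegral_mul_norm_pow_le (hf.pow_const 4) (hg.pow_const 4)
    (p := 1 / 2) (q := 1 / 2) (by norm_num) (by norm_num) (by norm_num)
  have h3 : ∀ c : ℝ≥0∞, (c ^ 4) ^ (1 / 2 : ℝ) = c ^ 2 := fun c => by
    rw [← ENNReal.rpow_natCast, ← ENNReal.rpow_mul, ← ENNReal.rpow_natCast]; norm_num
  simp only [h3] at h
  simp only [mul_pow]
  calc _ ≤ _ := h
    _ ≤ M ^ (1 / 2 : ℝ) * M ^ (1 / 2 : ℝ) := by gcongr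
    _ = M := by rw [← ENNReal.rpow_add_of_nonneg _ _ (by norm_num) (by norm_num)]; norm_num

theorem memLp_two_of_lintegral_sq_le {Ω G : Type*} [MeasurableSpace Ω] {P : Measure Ω}
    [NormedAddCommGroup G] {f : Ω → G} (hf : AEStronglyMeasurable f P) {M : ℝ≥0∞} (hM : M ≠ ∞)
    (h : ∫⁻ ω, ‖f ω‖ₑ ^ 2 ∂P ≤ M) : MemLp f 2 P := by
  refine ⟨hf, ?_⟩
  rw [eLpNorm_lt_top_iff_lintegral_rpow_enorm_lt_top two_ne_zero ENNReal.ofNat_ne_top]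
  refine lt_of_eq_of_lt ?_ (h.trans_lt hM.lt_top)
  simp

variable {Ω : Type*} [mΩ : MeasurableSpace Ω] {P : Measure Ω} [IsProbabilityMeasure P]

omit [IsProbabilityMeasure P] in
theorem integral_inner_comp_of_indep {E₁ E₂ G : Type*}
    [MeasurableSpace E₁] [MeasurableSpace E₂] [NormedAddCommGroup G] [InnerProductSpace ℝ G]
    [CompleteSpace G] {X₁ : Ω → E₁} {X₂ : Ω → E₂} (hind : IndepFun X₁ X₂ P)
    (h₁ : Measurable X₁) (h₂ : Measurable X₂) {f : E₁ → G} {g : E₂ → G}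
    (hf : StronglyMeasurable f) (hg : StronglyMeasurable g)
    (hfi : Integrable (fun ω => f (X₁ ω)) P) (hgi : Integrable (fun ω => g (X₂ ω)) P) :
    ∫ ω, (inner ℝ (f (X₁ ω)) (g (X₂ ω)) : ℝ) ∂P =
      inner ℝ (∫ ω, f (X₁ ω) ∂P) (∫ ω, g (X₂ ω) ∂P) := by
  let B : G →L[ℝ] G →L[ℝ] ℝ := (innerₗ G).mkContinuous₂ 1 fun x y => by
    simpa using norm_inner_le_norm (𝕜 := ℝ) x y
  exact hind.integral_bilin_comp_comp h₁.aemeasurable h₂.aemeasurable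
    ((integrable_map_measure hf.aestronglyMeasurable h₁.aemeasurable).2 hfi)
    ((integrable_map_measure hg.aestronglyMeasurable h₂.aemeasurable).2 hgi) B

namespace IsSquaredARCH

variable {β : unitInterval → unitInterval → ℝ} {δ : H} {ε Y : ℤ → Ω → H}

omit [IsProbabilityMeasure P] in
theorem indepFun_traj (h : IsSquaredARCH P β δ ε Y) {E₁ E₂ : Type*} [MeasurableSpace E₁]
    [MeasurableSpace E₂] {X₁ : Ω → E₁} {X₂ : Ω → E₂} {q : ℤ}
    (h₁ : Measurable[innovSigma ε (Set.Iic q)] X₁)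
    (h₂ : Measurable[innovSigma ε (Set.Ioi q)] X₂) : IndepFun X₁ X₂ P := by
  rw [IndepFun_iff_Indep]
  have := indep_innovSigma (P := P) h.measurable_innovation h.indep_innovation
    (S := Set.Iic q) (T := Set.Ioi q) (Set.Iic_disjoint_Ioi le_rfl)
  exact indep_of_indep_of_le_left (indep_of_indep_of_le_right this h₂.comap_le) h₁.comap_le

omit [IsProbabilityMeasure P] in
theorem measurable_traj_future (h : IsSquaredARCH P β δ ε Y) (q : ℤ) (n : ℕ) :
    Measurable[innovSigma ε (Set.Ioi q)] (traj β δ ε q n) :=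
  (measurable_traj h.measurable_kernel δ ε q n).mono (innovSigma_mono ε fun _ hj => hj.1) le_rfl

omit [IsProbabilityMeasure P] in
theorem measurable_traj' (h : IsSquaredARCH P β δ ε Y) (q : ℤ) (n : ℕ) :
    Measurable (traj β δ ε q n) :=
  (h.measurable_traj_future q n).mono (innovSigma_le h.measurable_innovation _) le_rfl

theorem memLp_process (h : IsSquaredARCH P β δ ε Y) (k : ℤ) : MemLp (Y k) 2 P := by
  obtain ⟨M, hM, h1⟩ := h.moment
  have h2 := sq_lintegral_le_lintegral_sq (μ := P) ((h.measurable k).enorm.pow_const 2).aemeasurable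
  simp only [← pow_mul, Nat.reduceMul] at h2
  refine memLp_two_of_lintegral_sq_le (h.measurable k).aestronglyMeasurable (M := ∫⁻ ω, ‖Y k ω‖ₑ ^ 2 ∂P)
    (fun htop => ?_) le_rfl
  rw [htop] at h2
  exact hM (top_le_iff.1 (by simpa using h2.trans (h1 k)))

/-- At lag 0 the comparison variable is 0. At lag `j+1` it is the path restarted at `k`, which is
independent of `Y k`; the overlap decays like `θ^j`, hence the constant `C/θ`. -/
theorem integral_inner_centred_process_le (h : IsSquaredARCH P β δ ε Y)
    (hcausal : ∀ k, Measurable[innovSigma ε (Set.Iic k)] (Y k)) :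
    ∃ C θ : ℝ, 0 ≤ C ∧ 0 < θ ∧ θ < 1 ∧ ∀ (k : ℤ) (n : ℕ),
      ∫ ω, (inner ℝ (Y k ω - ∫ ω, Y k ω ∂P) (Y (k + n) ω - ∫ ω, Y (k + n) ω ∂P) : ℝ) ∂P ≤
        C * θ ^ n := by
  obtain ⟨M, C, θ, hM1, hMt, hC, hθ, hθ1, hM, hov⟩ := h.exists_overlap_bound hcausal
  refine ⟨max (C / θ) M.toReal, θ, by positivity, hθ, hθ1, fun k n => ?_⟩
  rcases n with _ | j
  · refine (integral_inner_centred_le (h.memLp_process k) (h.memLp_process _)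
      (S' := fun _ => 0) MemLp.zero' (by simp) ?_).trans ?_
    · filter_upwards [h.nonneg k] with ω h1
      filter_upwards [h.nonneg (k + (0 : ℕ))] with ω' h2
      simpa using inner_nonneg_of_ae h1 h2
    · refine le_trans ?_ (le_of_eq_of_le (mul_one M.toReal).symm
        (by simp))
      refine integral_le_of_lintegral_enorm_le (by positivity) ?_
      rw [ENNReal.ofReal_toReal hMt]
      have h2 := sq_lintegral_le_lintegral_sq (μ := P)
        ((h.measurable k).enorm.pow_const 2).aemeasurable
      simp only [← pow_mul, Nat.reduceMul] at h2
      have h3 : ∫⁻ ω, ‖Y k ω‖ₑ ^ 2 ∂P ≤ M := by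
        refine (ENNReal.pow_le_pow_left_iff two_ne_zero).1 ((h2.trans (hM k)).trans ?_)
        exact le_self_pow₀ hM1 two_ne_zero
      refine le_trans (lintegral_mono fun ω => ?_) h3
      simp only [Nat.cast_zero, add_zero, sub_zero, pow_two]
      exact enorm_inner_le_enorm _ _
  · have e : k + ((j + 1 : ℕ) : ℤ) = k + j + 1 := by push_cast; ring
    have hb := h.traj_bounds k (j + 1)
    have hle := h.enorm_traj_le k (j + 1)
    rw [e] at hb hle ⊢
    have hS' : MemLp (traj β δ ε k (j + 1)) 2 P :=
      (h.memLp_process (k + j + 1)).mono (h.measurable_traj' _ _).aestronglyMeasurable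
        (hle.mono fun ω hω => enorm_le_iff_norm_le.1 hω)
    have hind : IndepFun (Y k) (traj β δ ε k (j + 1)) P :=
      h.indepFun_traj (hcausal k) (h.measurable_traj_future k (j + 1))
    refine (integral_inner_centred_le (h.memLp_process k) (h.memLp_process _) hS' ?_ ?_).trans ?_
    · exact integral_inner_comp_of_indep hind (h.measurable k) (h.measurable_traj' _ _)
        stronglyMeasurable_id stronglyMeasurable_id ((h.memLp_process k).integrable one_le_two)
        (hS'.integrable one_le_two)
    · filter_upwards [h.nonneg k] with ω h1
      filter_upwards [hb] with ω' h2
      rw [inner_sub_right, sub_nonneg]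
      exact inner_le_inner_of_ae h1 h2.2
    · calc _ ≤ C * θ ^ j := by
            refine integral_le_of_lintegral_enorm_le (by positivity) ?_
            simpa using hov k k j (fun _ => 1) le_rfl aemeasurable_const (by simpa using hM1)
        _ = C / θ * θ ^ (j + 1) := by
          rw [pow_succ]
          field_simp
        _ ≤ _ := by gcongr; exact le_max_left _ _

/-! ### Covariances of `Y k ⊗ Y (k+d)`, for any bilinear `B` with the inner product rule of a tensor
product. -/

section Tensor

variable {G : Type*} [NormedAddCommGroup G] [InnerProductSpace ℝ G] [CompleteSpace G]
  {B : H →L[ℝ] H →L[ℝ] G}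
  (hB : ∀ x y u v, (inner ℝ (B x y) (B u v) : ℝ) = inner ℝ x u * inner ℝ y v)
include hB

omit [CompleteSpace G] in
theorem enorm_tensor (x y : H) : ‖B x y‖ₑ = ‖x‖ₑ * ‖y‖ₑ := by
  have h : ‖B x y‖ = ‖x‖ * ‖y‖ := by
    rw [← sq_eq_sq₀ (norm_nonneg _) (by positivity), ← real_inner_self_eq_norm_sq, hB,
      real_inner_self_eq_norm_sq, real_inner_self_eq_norm_sq, mul_pow]
  rw [← ofReal_norm, h, ENNReal.ofReal_mul (norm_nonneg _), ofReal_norm, ofReal_norm]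

omit [IsProbabilityMeasure P] [CompleteSpace G] in
theorem memLp_tensor {M : ℝ≥0∞} (hM : M ≠ ∞) {X U V W : Ω → H}
    (hX : Measurable X) (hU : Measurable U) (hV : Measurable V) (hW : Measurable W)
    (h4V : ∫⁻ ω, ‖V ω‖ₑ ^ 4 ∂P ≤ M) (h4W : ∫⁻ ω, ‖W ω‖ₑ ^ 4 ∂P ≤ M)
    (hXV : ∀ᵐ ω ∂P, ‖X ω‖ₑ ≤ ‖V ω‖ₑ) (hUW : ∀ᵐ ω ∂P, ‖U ω‖ₑ ≤ ‖W ω‖ₑ) :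
    MemLp (fun ω => B (X ω) (U ω)) 2 P := by
  refine memLp_two_of_lintegral_sq_le ?_ hM ?_
  · exact (B.continuous₂.stronglyMeasurable.comp_measurable
      (hX.prodMk hU)).aestronglyMeasurable
  · refine le_trans (lintegral_mono_ae ?_)
      (lintegral_sq_mul_le_of_pow_four hV.enorm.aemeasurable hW.enorm.aemeasurable h4V h4W)
    filter_upwards [hXV, hUW] with ω h1 h2
    rw [enorm_tensor hB]
    gcongr

/-- For `n ≤ d` the time windows of the two tensors overlap, and a constant bound is enough. For `n
> d` both later factors are restarted at `q = k + d`, the end of the first window. The tensor gap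
telescopes into two terms, each containing one overlap with a factor from the past. -/
theorem integral_inner_centred_tensor_le (h : IsSquaredARCH P β δ ε Y)
    (hcausal : ∀ k, Measurable[innovSigma ε (Set.Iic k)] (Y k)) (d : ℕ) :
    ∃ C θ : ℝ, 0 ≤ C ∧ 0 < θ ∧ θ < 1 ∧ ∀ (k : ℤ) (n : ℕ),
      ∫ ω, (inner ℝ (B (Y k ω) (Y (k + d) ω) - ∫ ω, B (Y k ω) (Y (k + d) ω) ∂P)
        (B (Y (k + n) ω) (Y (k + n + d) ω) - ∫ ω, B (Y (k + n) ω) (Y (k + n + d) ω) ∂P) : ℝ) ∂P ≤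
        C * θ ^ n := by
  obtain ⟨M, C, θ, hM1, hMt, hC, hθ, hθ1, hM, hov⟩ := h.exists_overlap_bound hcausal
  have hmem : ∀ i j : ℤ, MemLp (fun ω => B (Y i ω) (Y j ω)) 2 P := fun i j =>
    memLp_tensor hB hMt (h.measurable i) (h.measurable j) (h.measurable i) (h.measurable j)
      (hM i) (hM j) (ae_of_all _ fun _ => le_rfl) (ae_of_all _ fun _ => le_rfl)
  have hsq : ∀ i j : ℤ, ∫⁻ ω, (‖Y i ω‖ₑ * ‖Y j ω‖ₑ) ^ 2 ∂P ≤ M := fun i j =>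
    lintegral_sq_mul_le_of_pow_four (h.measurable i).enorm.aemeasurable
      (h.measurable j).enorm.aemeasurable (hM i) (hM j)
  -- The divisions by powers of `θ` compensate for the finitely many lags without decay and for the
  -- shift `n = d + 1 + j`.
  refine ⟨max ((C + C) / θ ^ (d + 1)) (M.toReal / θ ^ d), θ, by positivity, hθ, hθ1, fun k n => ?_⟩
  rcases le_or_gt n d with hn | hn
  · refine (integral_inner_centred_le (hmem _ _) (hmem _ _)
      (S' := fun _ => 0) MemLp.zero' (by simp) ?_).trans ?_
    · filter_upwards [h.nonneg k, h.nonneg (k + d)] with ω h1 h2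
      filter_upwards [h.nonneg (k + n), h.nonneg (k + n + d)] with ω' h3 h4
      rw [sub_zero, hB]
      exact mul_nonneg (inner_nonneg_of_ae h1 h3) (inner_nonneg_of_ae h2 h4)
    · have h5 : M.toReal ≤ M.toReal / θ ^ d * θ ^ n := by
        rw [div_mul_eq_mul_div, le_div_iff₀ (by positivity)]
        exact mul_le_mul_of_nonneg_left (pow_le_pow_of_le_one hθ.le hθ1.le hn)
          ENNReal.toReal_nonneg
      refine le_trans ?_ (h5.trans (by gcongr; exact le_max_right _ _))
      refine integral_le_of_lintegral_enorm_le (by positivity) ?_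
      rw [ENNReal.ofReal_toReal hMt]
      have h6 := ENNReal.lintegral_mul_norm_pow_le (μ := P)
        (((h.measurable k).enorm.mul (h.measurable (k + d)).enorm).pow_const 2).aemeasurable
        (((h.measurable (k + n)).enorm.mul (h.measurable (k + n + d)).enorm).pow_const 2).aemeasurable
        (p := 1 / 2) (q := 1 / 2) (by norm_num) (by norm_num) (by norm_num)
      have h7 : ∀ c : ℝ≥0∞, (c ^ 2) ^ (1 / 2 : ℝ) = c := fun c => by
        rw [← ENNReal.rpow_natCast, ← ENNReal.rpow_mul]; norm_num
      simp only [h7] at h6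
      refine (lintegral_mono fun ω => ?_).trans (h6.trans ?_)
      · refine (enorm_inner_le_enorm _ _).trans (le_of_eq ?_)
        rw [sub_zero, enorm_tensor hB, enorm_tensor hB]
        rfl
      · calc _ ≤ M ^ (1 / 2 : ℝ) * M ^ (1 / 2 : ℝ) := by
              gcongr
              · exact hsq _ _
              · exact hsq _ _
          _ = M := by rw [← ENNReal.rpow_add_of_nonneg _ _ (by norm_num) (by norm_num)]; norm_num
  · obtain ⟨j, rfl⟩ := Nat.exists_eq_add_of_le hn
    simp only [Nat.succ_eq_add_one]
    let q : ℤ := k + d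
    have e1 : k + ((d + 1 + j : ℕ) : ℤ) = q + j + 1 := by simp only [q]; push_cast; ring
    have e2 : k + ((d + 1 + j : ℕ) : ℤ) + d = q + ((j + d : ℕ) : ℤ) + 1 := by
      simp only [q]; push_cast; ring
    rw [e2, e1]
    have hb1 := h.traj_bounds q (j + 1)
    have hb2 := h.traj_bounds q (j + d + 1)
    have hle1 := h.enorm_traj_le q (j + 1)
    have hle2 := h.enorm_traj_le q (j + d + 1)
    rw [Nat.cast_succ, ← add_assoc] at hb1 hb2 hle1 hle2
    have hYq : Measurable[innovSigma ε (Set.Iic q)] (Y k) :=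
      (hcausal k).mono (innovSigma_mono ε (Set.Iic_subset_Iic.2 (by simp [q]))) le_rfl
    have hS' : MemLp (fun ω => B (traj β δ ε q (j + 1) ω) (traj β δ ε q (j + d + 1) ω)) 2 P :=
      memLp_tensor hB hMt (h.measurable_traj' _ _) (h.measurable_traj' _ _) (h.measurable _)
        (h.measurable _) (hM _) (hM _) hle1 hle2
    have hind : IndepFun (fun ω => (Y k ω, Y q ω))
        (fun ω => (traj β δ ε q (j + 1) ω, traj β δ ε q (j + d + 1) ω)) P :=
      h.indepFun_traj (hYq.prodMk (hcausal q))
        ((h.measurable_traj_future q _).prodMk (h.measurable_traj_future q _))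
    have hBs : StronglyMeasurable fun x : H × H => B x.1 x.2 := B.continuous₂.stronglyMeasurable
    refine (integral_inner_centred_le (hmem _ _) (hmem _ _) hS' ?_ ?_).trans ?_
    · exact integral_inner_comp_of_indep hind ((h.measurable k).prodMk (h.measurable q))
        ((h.measurable_traj' _ _).prodMk (h.measurable_traj' _ _)) hBs hBs
        ((hmem k q).integrable one_le_two) (hS'.integrable one_le_two)
    · filter_upwards [h.nonneg k, h.nonneg q] with ω h1 h2
      filter_upwards [hb1, hb2] with ω' h3 h4
      -- Order is preserved by products of nonnegative inner products, so the tensor of restarted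
      -- paths is dominated just as the paths are.
      rw [inner_sub_right, sub_nonneg, hB, hB]
      exact mul_le_mul (inner_le_inner_of_ae h1 h3.2) (inner_le_inner_of_ae h2 h4.2)
        (inner_nonneg_of_ae h2 h4.1) ((inner_nonneg_of_ae h1 h3.1).trans
          (inner_le_inner_of_ae h1 h3.2))
    · calc _ ≤ C * θ ^ j + C * θ ^ (j + d) := by
            refine integral_le_of_lintegral_enorm_le (by positivity) ?_
            have o1 := hov k q j (fun ω => ‖Y q ω‖ₑ * ‖Y (q + ((j + d : ℕ) : ℤ) + 1) ω‖ₑ)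
              (by simp [q]) ((h.measurable _).enorm.mul (h.measurable _).enorm).aemeasurable
              (hsq _ _)
            have o2 := hov q q (j + d) (fun ω => ‖Y k ω‖ₑ * ‖Y (q + j + 1) ω‖ₑ)
              le_rfl ((h.measurable _).enorm.mul (h.measurable _).enorm).aemeasurable
              (hsq _ _)
            rw [ENNReal.ofReal_add (by positivity) (by positivity)]
            refine le_trans ?_ (add_le_add o1 o2)
            rw [← lintegral_add_left (by
              refine Measurable.mul (Measurable.enorm ((h.measurable _).inner
                ((h.measurable _).sub (h.measurable_traj' _ _)))) ?_
              exact (h.measurable _).enorm.mul (h.measurable _).enorm)]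
            refine lintegral_mono_ae ?_
            filter_upwards [hle1] with ω hω
            have e3 : (inner ℝ (B (Y k ω) (Y q ω))
                (B (Y (q + j + 1) ω) (Y (q + ((j + d : ℕ) : ℤ) + 1) ω) -
                  B (traj β δ ε q (j + 1) ω) (traj β δ ε q (j + d + 1) ω)) : ℝ) =
                inner ℝ (Y k ω) (Y (q + j + 1) ω - traj β δ ε q (j + 1) ω) *
                  inner ℝ (Y q ω) (Y (q + ((j + d : ℕ) : ℤ) + 1) ω) +
                inner ℝ (Y q ω) (Y (q + ((j + d : ℕ) : ℤ) + 1) ω - traj β δ ε q (j + d + 1) ω) *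
                  inner ℝ (Y k ω) (traj β δ ε q (j + 1) ω) := by
              rw [inner_sub_right, hB, hB, inner_sub_right, inner_sub_right]
              ring
            rw [e3]
            refine (enorm_add_le _ _).trans ?_
            rw [enorm_mul, enorm_mul]
            refine add_le_add (mul_le_mul_right (enorm_inner_le_enorm _ _) _)
              (mul_le_mul_right ((enorm_inner_le_enorm _ _).trans ?_) _)
            gcongr
        _ ≤ C * θ ^ j + C * θ ^ j := by
            gcongr C * θ ^ j + C * ?_
            exact pow_le_pow_of_le_one hθ.le hθ1.le (by omega)
        _ = (C + C) / θ ^ (d + 1) * θ ^ (d + 1 + j) := by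
            rw [pow_add θ (d + 1) j]
            field_simp
        _ ≤ _ := by gcongr; exact le_max_left _ _

end Tensor

end IsSquaredARCH

end Covariance

/-! ### Leading eigenpairs: variational bounds and perturbation. -/

section TopSystem

variable {E : Type*} [NormedAddCommGroup E] [InnerProductSpace ℝ E]

/-- A system of eigenpairs such that the quadratic form of `A` on the orthogonal complement of the
eigenvectors is bounded by each of the eigenvalues. -/
structure IsTopSystem (A : E →L[ℝ] E) {n : ℕ} (lam : Fin n → ℝ) (e : Fin n → E) : Prop where
  symm : ∀ x y, (inner ℝ (A x) y : ℝ) = inner ℝ x (A y)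
  orthonormal : Orthonormal ℝ e
  antitone : Antitone lam
  eigen : ∀ j, A (e j) = lam j • e j
  bound : ∀ w, (∀ j, (inner ℝ (e j) w : ℝ) = 0) → ∀ j, (inner ℝ (A w) w : ℝ) ≤ lam j * ‖w‖ ^ 2

/-- On the invariant orthogonal complement of the `e j`, a larger value of the quadratic form would
force the norm of the restriction, which is its spectral radius, above `lam j`. A nonzero spectral
value of a compact operator is an eigenvalue, and by positivity it would be one exceeding `lam j`,
against `hlead`. -/
theorem inner_apply_le_of_leading [CompleteSpace E] {A : E →L[ℝ] E} (hcomp : IsCompactOperator A)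
    (hsymm : ∀ x y, (inner ℝ (A x) y : ℝ) = inner ℝ x (A y))
    (hpos : ∀ x, 0 ≤ (inner ℝ (A x) x : ℝ)) {n : ℕ} {lam : Fin n → ℝ} {e : Fin n → E}
    (horth : Orthonormal ℝ e) (heig : ∀ j, A (e j) = lam j • e j)
    (hlead : ∀ (μ : ℝ) (v : E), v ≠ 0 → A v = μ • v → (∀ j, (inner ℝ (e j) v : ℝ) = 0) →
      ∀ j, μ ≤ lam j) (w : E) (hw : ∀ j, (inner ℝ (e j) w : ℝ) = 0) (j : Fin n) :
    (inner ℝ (A w) w : ℝ) ≤ lam j * ‖w‖ ^ 2 := by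
  by_contra! hlt
  have hlam : 0 ≤ lam j := by
    have := hpos (e j)
    rwa [heig, inner_smul_left, real_inner_self_eq_norm_sq, horth.1 j, one_pow, mul_one] at this
  let V : Submodule ℝ E := (Submodule.span ℝ (Set.range e))ᗮ
  have hmem : ∀ v : E, v ∈ V ↔ ∀ j, (inner ℝ (e j) v : ℝ) = 0 := fun v => by
    rw [Submodule.mem_orthogonal]
    constructor
    · exact fun h j => h _ (Submodule.subset_span ⟨j, rfl⟩)
    · intro h u hu
      induction hu using Submodule.span_induction with
      | mem x hx => obtain ⟨j, rfl⟩ := hx; exact h j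
      | zero => simp
      | add x y _ _ hx hy => rw [inner_add_left, hx, hy, add_zero]
      | smul a x _ hx => rw [inner_smul_left, hx, mul_zero]
  have hinv : ∀ v ∈ V, A v ∈ V := fun v hv => by
    rw [hmem] at hv ⊢
    intro j
    rw [← hsymm, heig, inner_smul_left, hv j, mul_zero]
  have hcV : CompleteSpace V := Submodule.instOrthogonalCompleteSpace _
  let S : V →L[ℝ] V := A.restrict hinv
  have hSc : IsCompactOperator S := hcomp.restrict' hinv
  have hSs : S.IsSymmetric := fun x y => hsymm x y
  have hrad := S.spectralRadius_eq_nnnorm hSs.isSelfAdjoint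
  let w' : V := ⟨w, (hmem w).2 hw⟩
  have hw0 : 0 < ‖w‖ := by
    rw [norm_pos_iff]
    rintro rfl
    simp at hlt
  have h1 : lam j < ‖S‖ := by
    have h2 : (inner ℝ (A w) w : ℝ) ≤ ‖S‖ * ‖w‖ ^ 2 := by
      calc (inner ℝ (A w) w : ℝ) ≤ ‖S w'‖ * ‖w'‖ := real_inner_le_norm (S w') w'
        _ ≤ ‖S‖ * ‖w'‖ * ‖w'‖ := by gcongr; exact S.le_opNorm w'
        _ = ‖S‖ * ‖w‖ ^ 2 := by rw [mul_assoc, pow_two]; rfl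
    exact lt_of_mul_lt_mul_right (hlt.trans_le h2) (by positivity)
  have h3 : ((lam j).toNNReal : ℝ≥0∞) < spectralRadius ℝ S := by
    rw [hrad, ENNReal.coe_lt_coe, ← NNReal.coe_lt_coe, Real.coe_toNNReal _ hlam]
    exact h1
  rw [spectralRadius, lt_iSup_iff] at h3
  obtain ⟨μ, h3⟩ := h3
  rw [lt_iSup_iff] at h3
  obtain ⟨hμ, h3⟩ := h3
  rw [ENNReal.coe_lt_coe, ← NNReal.coe_lt_coe, Real.coe_toNNReal _ hlam, coe_nnnorm,
    Real.norm_eq_abs] at h3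
  have hμ0 : μ ≠ 0 := by
    rintro rfl
    rw [abs_zero] at h3
    linarith
  obtain ⟨v, hv⟩ := ((hSc.hasEigenvalue_iff_mem_spectrum hμ0).2 hμ).exists_hasEigenvector
  have hv1 : A v = μ • (v : E) := congrArg Subtype.val hv.apply_eq_smul
  have hv0 : (v : E) ≠ 0 := fun h0 => hv.2 (Subtype.ext h0)
  have h4 : 0 ≤ μ := by
    have := hpos v
    rw [hv1, inner_smul_left, real_inner_self_eq_norm_sq] at this
    have h5 : 0 < ‖(v : E)‖ := norm_pos_iff.2 hv0
    exact nonneg_of_mul_nonneg_left this (by positivity)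
  rw [abs_of_nonneg h4] at h3
  exact not_le.2 h3 (hlead μ v hv0 hv1 ((hmem v).1 v.2) j)

namespace IsTopSystem

variable {A B : E →L[ℝ] E} {n m : ℕ} {lam : Fin n → ℝ} {e : Fin n → E} {mu : Fin m → ℝ}
  {f : Fin m → E}

theorem inner_sub_sum (hA : IsTopSystem A lam e) (w : E) (j : Fin n) :
    (inner ℝ (e j) (w - ∑ k, (inner ℝ (e k) w : ℝ) • e k) : ℝ) = 0 := by
  rw [inner_sub_right, inner_sum]
  simp only [inner_smul_right, orthonormal_iff_ite.1 hA.orthonormal]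
  simp

/-- The upper half of the min-max principle: expand in the eigenvectors, drop those before `i`, and
bound the remainder by `bound`. -/
theorem bound_tail (hA : IsTopSystem A lam e) (i : Fin n) (w : E)
    (hw : ∀ k < i, (inner ℝ (e k) w : ℝ) = 0) : (inner ℝ (A w) w : ℝ) ≤ lam i * ‖w‖ ^ 2 := by
  let c : Fin n → ℝ := fun k => inner ℝ (e k) w
  let s : E := ∑ k, c k • e k
  let r : E := w - s
  have hr : ∀ k, (inner ℝ (e k) r : ℝ) = 0 := hA.inner_sub_sum w
  have hws : w = s + r := by simp [r]
  have hAs : A s = ∑ k, (lam k * c k) • e k := by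
    simp only [s, map_sum, map_smul, hA.eigen, smul_smul]
    exact Finset.sum_congr rfl fun k _ => by rw [mul_comm]
  have hlin : ∀ d : Fin n → ℝ, (inner ℝ (∑ k, d k • e k) r : ℝ) = 0 := fun d => by
    rw [sum_inner]
    exact Finset.sum_eq_zero fun k _ => by rw [inner_smul_left, hr, mul_zero]
  have hss : ‖s‖ ^ 2 = ∑ k, c k * c k := by
    rw [← real_inner_self_eq_norm_sq]
    exact hA.orthonormal.inner_sum c c Finset.univ
  have hAss : (inner ℝ (A s) s : ℝ) = ∑ k, lam k * c k * c k := by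
    rw [hAs]
    exact hA.orthonormal.inner_sum _ c Finset.univ
  have hsr : (inner ℝ s r : ℝ) = 0 := hlin c
  have hAsr : (inner ℝ (A s) r : ℝ) = 0 := by rw [hAs]; exact hlin _
  have h1 : (inner ℝ (A w) w : ℝ) = ∑ k, lam k * c k * c k + inner ℝ (A r) r := by
    rw [hws, map_add, inner_add_left, inner_add_right, inner_add_right, hAss, hAsr,
      hA.symm r s, real_inner_comm, hAsr]
    ring
  have h2 : ‖w‖ ^ 2 = ∑ k, c k * c k + ‖r‖ ^ 2 := by
    rw [hws, norm_add_sq_real, hsr, hss]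
    ring
  have h3 : ∑ k, lam k * c k * c k ≤ ∑ k, lam i * (c k * c k) := by
    refine Finset.sum_le_sum fun k _ => ?_
    rcases lt_or_ge k i with hk | hk
    · simp [c, hw k hk]
    · rw [mul_assoc]
      exact mul_le_mul_of_nonneg_right (hA.antitone hk) (mul_self_nonneg _)
  rw [h1, h2, mul_add, Finset.mul_sum]
  exact add_le_add h3 (hA.bound r hr i)

/-- One half of Weyl's inequality for the leading eigenvalues. -/
theorem sub_le_eigenvalue (hA : IsTopSystem A lam e) (hB : IsTopSystem B mu f) {η : ℝ}
    (hη : ∀ x, ‖(A - B) x‖ ≤ η * ‖x‖) (i : Fin n) (j : Fin m) (hij : (i : ℕ) = j) :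
    lam i - η ≤ mu j := by
  -- Dimension count: among combinations of the first `i+1` eigenvectors of `A`, some nonzero `v` is
  -- orthogonal to the first `i` eigenvectors of `B`. Comparing the two quadratic forms at `v` gives
  -- the inequality.
  let T : (Fin (i + 1) → ℝ) →ₗ[ℝ] (Fin i → ℝ) :=
    { toFun := fun c l => ∑ k : Fin (i + 1), c k *
        (inner ℝ (f ⟨l, by omega⟩) (e ⟨k, by omega⟩) : ℝ)
      map_add' := fun c d => by
        ext l
        simp [add_mul, Finset.sum_add_distrib]
      map_smul' := fun a c => by
        ext l
        simp [mul_assoc, Finset.mul_sum] }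
  obtain ⟨c, hc, hc0⟩ := Submodule.exists_mem_ne_zero_of_ne_bot
    (T.ker_ne_bot_of_finrank_lt (by simp))
  have hc : T c = 0 := hc
  let e' : Fin (i + 1) → E := fun k => e ⟨k, by omega⟩
  have he' : Orthonormal ℝ e' := hA.orthonormal.comp (fun k : Fin (i + 1) => ⟨k, by omega⟩)
    fun a b hab => Fin.ext (by simpa using hab)
  let v : E := ∑ k, c k • e' k
  have hv2 : ‖v‖ ^ 2 = ∑ k, c k * c k := by
    rw [← real_inner_self_eq_norm_sq]
    exact he'.inner_sum c c Finset.univ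
  have hv : 0 < ‖v‖ ^ 2 := by
    rw [hv2]
    obtain ⟨k, hk⟩ := Function.ne_iff.1 hc0
    exact Finset.sum_pos' (fun k _ => mul_self_nonneg _)
      ⟨k, Finset.mem_univ _, mul_self_pos.2 hk⟩
  have hAv : (inner ℝ (A v) v : ℝ) = ∑ k : Fin (i + 1), lam ⟨k, by omega⟩ * c k * c k := by
    have : A v = ∑ k : Fin (i + 1), (lam ⟨k, by omega⟩ * c k) • e' k := by
      simp only [v, e', map_sum, map_smul, hA.eigen, smul_smul]
      exact Finset.sum_congr rfl fun k _ => by rw [mul_comm]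
    rw [this]
    exact he'.inner_sum _ c Finset.univ
  have h1 : lam i * ‖v‖ ^ 2 ≤ inner ℝ (A v) v := by
    rw [hAv, hv2, Finset.mul_sum]
    refine Finset.sum_le_sum fun k _ => ?_
    rw [mul_assoc]
    refine mul_le_mul_of_nonneg_right (hA.antitone ?_) (mul_self_nonneg _)
    exact Fin.le_def.2 (by simpa using Nat.lt_succ_iff.1 k.2)
  have h2 : (inner ℝ (B v) v : ℝ) ≤ mu j * ‖v‖ ^ 2 := by
    refine hB.bound_tail j v fun l hl => ?_
    have h3 := congrFun hc ⟨l, by rw [hij]; exact hl⟩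
    simp only [v, inner_sum, inner_smul_right]
    simpa [T, e'] using h3
  have h3 : (inner ℝ (A v) v : ℝ) - inner ℝ (B v) v ≤ η * ‖v‖ ^ 2 := by
    rw [← inner_sub_left]
    calc _ ≤ ‖(A - B) v‖ * ‖v‖ := real_inner_le_norm ((A - B) v) v
      _ ≤ η * ‖v‖ * ‖v‖ := by gcongr; exact hη v
      _ = _ := by ring
  have h4 : (lam i - η) * ‖v‖ ^ 2 ≤ mu j * ‖v‖ ^ 2 := by linarith
  exact le_of_mul_le_mul_right h4 hv

theorem abs_eigenvalue_sub_le (hA : IsTopSystem A lam e) (hB : IsTopSystem B mu f) {η : ℝ}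
    (hη : ∀ x, ‖(A - B) x‖ ≤ η * ‖x‖) (i : Fin n) (j : Fin m) (hij : (i : ℕ) = j) :
    |mu j - lam i| ≤ η := by
  have h1 := hA.sub_le_eigenvalue hB hη i j hij
  have h2 := hB.sub_le_eigenvalue hA (fun x => by
    rw [← neg_sub, neg_apply, norm_neg]; exact hη x) j i hij.symm
  rw [abs_le]
  constructor <;> linarith

/-- The coefficient along `e k` satisfies `(lam k - lam i) c k = ⟨e k, A u - lam i u⟩`, so the gap
divides the residual. The part outside the span is handled by the quadratic form, which there lies
below `lam i - g`; `htail` is where one eigenvalue beyond those being estimated is needed. -/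
theorem norm_sub_proj_le (hA : IsTopSystem A lam e) {g κ : ℝ} (hg : 0 < g)
    (i : Fin n) (hsep : ∀ k ≠ i, g ≤ |lam k - lam i|)
    (htail : ∃ k, lam k ≤ lam i - g) {u : E}
    (hu : ‖A u - lam i • u‖ ≤ κ) :
    ‖u - (inner ℝ (e i) u : ℝ) • e i‖ ≤ (n + 1) * (κ / g) := by
  let c : Fin n → ℝ := fun k => inner ℝ (e k) u
  let s : E := ∑ k, c k • e k
  let r : E := u - s
  have hr : ∀ k, (inner ℝ (e k) r : ℝ) = 0 := hA.inner_sub_sum u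
  have hκ : 0 ≤ κ := (norm_nonneg _).trans hu
  have hc : ∀ k ≠ i, |c k| ≤ κ / g := fun k hk => by
    have h1 : (inner ℝ (e k) (A u - lam i • u) : ℝ) = (lam k - lam i) * c k := by
      rw [inner_sub_right, ← hA.symm, hA.eigen, inner_smul_left, inner_smul_right]
      simp only [c, conj_trivial]
      ring
    have h2 : |(lam k - lam i) * c k| ≤ κ := by
      rw [← h1]
      refine (abs_real_inner_le_norm _ _).trans ?_
      rwa [hA.orthonormal.1 k, one_mul]
    rw [abs_mul] at h2
    rw [le_div_iff₀ hg, mul_comm]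
    exact (mul_le_mul_of_nonneg_right (hsep k hk) (abs_nonneg _)).trans h2
  have hrn : ‖r‖ ≤ κ / g := by
    obtain ⟨k, hk⟩ := htail
    have hus : u = s + r := by simp [r]
    have hlin : ∀ d : Fin n → ℝ, (inner ℝ (∑ k, d k • e k) r : ℝ) = 0 := fun d => by
      rw [sum_inner]
      exact Finset.sum_eq_zero fun k _ => by rw [inner_smul_left, hr, mul_zero]
    have hAs : A s = ∑ k, (c k * lam k) • e k := by
      simp only [s, map_sum, map_smul, hA.eigen, smul_smul]
    have h1 : (inner ℝ (A u - lam i • u) r : ℝ) = inner ℝ (A r) r - lam i * ‖r‖ ^ 2 := by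
      have h5 : (inner ℝ (A s) r : ℝ) = 0 := by rw [hAs]; exact hlin _
      have h6 : (inner ℝ s r : ℝ) = 0 := hlin c
      rw [inner_sub_left, inner_smul_left]
      conv_lhs => rw [hus]
      rw [map_add, inner_add_left, inner_add_left, h5, h6, real_inner_self_eq_norm_sq]
      simp
    have h2 : -(inner ℝ (A u - lam i • u) r : ℝ) ≤ κ * ‖r‖ := by
      refine (neg_le_abs _).trans ((abs_real_inner_le_norm _ _).trans ?_)
      gcongr
    have h3 := hA.bound r hr k
    have h4 : g * ‖r‖ * ‖r‖ ≤ κ * ‖r‖ := by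
      have : lam k * ‖r‖ ^ 2 ≤ (lam i - g) * ‖r‖ ^ 2 := by gcongr
      rw [h1] at h2
      nlinarith
    rcases (norm_nonneg r).eq_or_lt with h0 | h0
    · rw [← h0]; positivity
    · rw [le_div_iff₀ hg, mul_comm]
      exact le_of_mul_le_mul_right h4 h0
  have hdec : u - c i • e i = ∑ k ∈ Finset.univ.erase i, c k • e k + r := by
    simp only [r, s]
    rw [← Finset.add_sum_erase _ _ (Finset.mem_univ i)]
    abel
  calc ‖u - (inner ℝ (e i) u : ℝ) • e i‖ = ‖∑ k ∈ Finset.univ.erase i, c k • e k + r‖ := by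
        rw [← hdec]
    _ ≤ ∑ k ∈ Finset.univ.erase i, ‖c k • e k‖ + ‖r‖ :=
        (norm_add_le _ _).trans (by gcongr; exact norm_sum_le _ _)
    _ ≤ ∑ k ∈ Finset.univ.erase i, κ / g + κ / g := by
        gcongr with k hk
        rw [norm_smul, hA.orthonormal.1 k, mul_one]
        exact hc k (Finset.ne_of_mem_erase hk)
    _ ≤ n * (κ / g) + κ / g := by
        rw [Finset.sum_const, nsmul_eq_mul]
        gcongr
        exact (Finset.card_erase_le).trans (by simp)
    _ = _ := by ring

/-- With `c = ⟨e i, u⟩` and `s` the sign of `c`, `‖s u - e i‖² = 2 - 2|c| ≤ 4(1 - c²)`, and `1 - c²`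
is the squared distance of `u` from its projection. -/
theorem exists_sign_norm_sub_le (hA : IsTopSystem A lam e) {g κ : ℝ} (hg : 0 < g)
    (i : Fin n) (hsep : ∀ k ≠ i, g ≤ |lam k - lam i|)
    (htail : ∃ k, lam k ≤ lam i - g) {u : E} (hu1 : ‖u‖ = 1)
    (hu : ‖A u - lam i • u‖ ≤ κ) :
    ∃ s : ℝ, s * s = 1 ∧ ‖s • u - e i‖ ≤ 2 * ((n + 1) * (κ / g)) := by
  have h1 := hA.norm_sub_proj_le hg i hsep htail hu
  set c : ℝ := inner ℝ (e i) u with hc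
  have he : ‖e i‖ = 1 := hA.orthonormal.1 i
  have hcn : ‖u - c • e i‖ ^ 2 = 1 - c ^ 2 := by
    rw [norm_sub_sq_real, hu1, norm_smul, he, inner_smul_right, real_inner_comm, ← hc,
      Real.norm_eq_abs, mul_one, sq_abs]
    ring
  have hc1 : |c| ≤ 1 := by
    have := abs_real_inner_le_norm (e i) u
    rwa [he, hu1, one_mul] at this
  obtain ⟨s, hs, hsc⟩ : ∃ s : ℝ, s * s = 1 ∧ s * c = |c| := by
    rcases le_total 0 c with h | h
    · exact ⟨1, by norm_num, by rw [abs_of_nonneg h, one_mul]⟩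
    · exact ⟨-1, by norm_num, by rw [abs_of_nonpos h, neg_one_mul]⟩
  refine ⟨s, hs, ?_⟩
  have h2 : ‖s • u - e i‖ ^ 2 = 2 - 2 * |c| := by
    have h3 : |s| = 1 := by
      have := abs_mul_abs_self s
      rw [hs] at this
      nlinarith [abs_nonneg s]
    rw [norm_sub_sq_real, norm_smul, hu1, he, inner_smul_left, real_inner_comm, ← hc,
      Real.norm_eq_abs, h3]
    simp only [conj_trivial, hsc]
    ring
  have h4 : ‖s • u - e i‖ ^ 2 ≤ (2 * ‖u - c • e i‖) ^ 2 := by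
    rw [mul_pow, hcn, h2, ← sq_abs c]
    nlinarith [abs_nonneg c]
  have h5 : ‖s • u - e i‖ ≤ 2 * ‖u - c • e i‖ :=
    (pow_le_pow_iff_left₀ (norm_nonneg _) (by positivity) two_ne_zero).1 h4
  exact h5.trans (by gcongr)

end IsTopSystem

end TopSystem

/-! ### Hilbert-Schmidt norms of finite-rank kernels. -/

section HilbertSchmidt

theorem hsNorm_congr {k l : unitInterval → unitInterval → ℝ}
    (h : ∀ᵐ t, ∀ᵐ s, k t s = l t s) : hsNorm k = hsNorm l := by
  rw [hsNorm, hsNorm]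
  congr 1
  refine integral_congr_ae (h.mono fun t ht => integral_congr_ae (ht.mono fun s hs => ?_))
  simp only [hs]

theorem integral_sq_eq_norm_sq (u : H) : ∫ t, (u t) ^ 2 = ‖u‖ ^ 2 := by
  rw [← real_inner_self_eq_norm_sq, L2.inner_def]
  refine integral_congr_ae (ae_of_all _ fun t => ?_)
  simp [pow_two]

theorem integrable_coe_sq (u : H) : Integrable (fun t => (u t) ^ 2) volume :=
  (Lp.memLp u).integrable_sq

theorem hsNorm_sum_le {ι : Type*} [Fintype ι] (p q : ι → H) {c : ℝ} (hc : 0 ≤ c)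
    (h : ∀ l, ‖p l‖ * ‖q l‖ ≤ c) :
    hsNorm (fun t s => ∑ l, p l t * q l s) ≤ Fintype.card ι * c := by
  have h1 : ∀ t, ∫ s, (∑ l, p l t * q l s) ^ 2 ≤
      Fintype.card ι * ∑ l, (p l t) ^ 2 * ‖q l‖ ^ 2 := fun t => by
    have hi : ∀ l, Integrable (fun s => (p l t) ^ 2 * (q l s) ^ 2) volume := fun l =>
      (integrable_coe_sq (q l)).const_mul _
    calc ∫ s, (∑ l, p l t * q l s) ^ 2
        ≤ ∫ s, Fintype.card ι * ∑ l, (p l t) ^ 2 * (q l s) ^ 2 := by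
          refine integral_mono_of_nonneg (ae_of_all _ fun s => by positivity)
            ((integrable_finsetSum _ fun l _ => hi l).const_mul _) (ae_of_all _ fun s => ?_)
          simp only [← mul_pow]
          exact sq_sum_le_card_mul_sum_sq
      _ = _ := by
          rw [integral_const_mul, integral_finsetSum _ fun l _ => hi l]
          simp only [integral_const_mul, integral_sq_eq_norm_sq]
  have h2 : ∫ t, ∫ s, (∑ l, p l t * q l s) ^ 2 ≤
      Fintype.card ι * ∑ l, ‖p l‖ ^ 2 * ‖q l‖ ^ 2 := by
    have hi : ∀ l, Integrable (fun t => (p l t) ^ 2 * ‖q l‖ ^ 2) volume := fun l =>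
      (integrable_coe_sq (p l)).mul_const _
    calc ∫ t, ∫ s, (∑ l, p l t * q l s) ^ 2
        ≤ ∫ t, Fintype.card ι * ∑ l, (p l t) ^ 2 * ‖q l‖ ^ 2 :=
          integral_mono_of_nonneg
            (ae_of_all _ fun t => integral_nonneg fun s => by positivity)
            ((integrable_finsetSum _ fun l _ => hi l).const_mul _) (ae_of_all _ h1)
      _ = _ := by
          rw [integral_const_mul, integral_finsetSum _ fun l _ => hi l]
          simp only [integral_mul_const, integral_sq_eq_norm_sq]
  rw [hsNorm]
  refine Real.sqrt_le_iff.2 ⟨by positivity, h2.trans ?_⟩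
  calc (Fintype.card ι : ℝ) * ∑ l, ‖p l‖ ^ 2 * ‖q l‖ ^ 2
      ≤ Fintype.card ι * ∑ _l : ι, c ^ 2 := by
        gcongr with l
        rw [← mul_pow]
        exact pow_le_pow_left₀ (by positivity) (h l) 2
    _ = _ := by
        rw [Finset.sum_const, Finset.card_univ, nsmul_eq_mul]
        ring

variable {G : Type*} [NormedAddCommGroup G] [InnerProductSpace ℝ G] {B : H →L[ℝ] H →L[ℝ] G}

theorem abs_inner_tensor_le
    (hB : ∀ x y u v, (inner ℝ (B x y) (B u v) : ℝ) = inner ℝ x u * inner ℝ y v)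
    (D : G) (x y : H) : |(inner ℝ D (B x y) : ℝ)| ≤ ‖D‖ * (‖x‖ * ‖y‖) := by
  refine (abs_real_inner_le_norm _ _).trans (le_of_eq ?_)
  congr 1
  rw [← sq_eq_sq₀ (norm_nonneg _) (by positivity), ← real_inner_self_eq_norm_sq, hB,
      real_inner_self_eq_norm_sq, real_inner_self_eq_norm_sq, mul_pow]

/-- The kernel `∑ λ_j⁻¹ ⟨D, e_j ⊗ e_i⟩ e_j(s) e_i(t)`. -/
def tensorKernel (B : H →L[ℝ] H →L[ℝ] G) (D : G) {K : ℕ} (lam : Fin K → ℝ) (e : Fin K → H)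
    (t s : unitInterval) : ℝ :=
  ∑ i, ∑ j, (lam j)⁻¹ * inner ℝ D (B (e j) (e i)) * e j s * e i t

/-- Replacing `f j` by `s j • f j` leaves the kernel unchanged, since each vector occurs both in a
coefficient and in the kernel. With aligned signs, coefficients and vectors are compared term by
term. -/
theorem hsNorm_tensorKernel_sub_le
    (hB : ∀ x y u v, (inner ℝ (B x y) (B u v) : ℝ) = inner ℝ x u * inner ℝ y v)
    {K : ℕ} {lam mu : Fin K → ℝ} {e f : Fin K → H} {s : Fin K → ℝ} {D D' : G} {ℓ η η' τ : ℝ}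
    (hℓ : 0 < ℓ) (hη : 0 ≤ η) (hτ : 0 ≤ τ) (he : ∀ j, ‖e j‖ = 1) (hf : ∀ j, ‖f j‖ = 1)
    (hs : ∀ j, s j * s j = 1) (hsf : ∀ j, ‖s j • f j - e j‖ ≤ τ)
    (hlam : ∀ j, ℓ ≤ lam j) (hmu : ∀ j, ℓ / 2 ≤ mu j) (hlm : ∀ j, |mu j - lam j| ≤ η)
    (hD : ‖D' - D‖ ≤ η') :
    hsNorm (fun t s => tensorKernel B D lam e t s - tensorKernel B D' mu f t s) ≤
      Fintype.card (Fin K × Fin K × Bool) *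
        (2 / ℓ ^ 2 * η * ‖D‖ + 2 / ℓ * (η' + 2 * ‖D‖ * τ) + 2 / ℓ * (‖D‖ + η') * τ) := by
  have hη' : 0 ≤ η' := (norm_nonneg _).trans hD
  let a : Fin K → Fin K → ℝ := fun i j => (lam j)⁻¹ * inner ℝ D (B (e j) (e i))
  let f' : Fin K → H := fun j => s j • f j
  let a' : Fin K → Fin K → ℝ := fun i j => (mu j)⁻¹ * inner ℝ D' (B (f' j) (f' i))
  have hsabs : ∀ j, |s j| = 1 := fun j => by
    have := abs_mul_abs_self (s j)
    rw [hs] at this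
    nlinarith [abs_nonneg (s j)]
  have hf' : ∀ j, ‖f' j‖ = 1 := fun j => by
    simp only [f', norm_smul, hf, Real.norm_eq_abs, hsabs, mul_one]
  have hlam0 : ∀ j, 0 < lam j := fun j => hℓ.trans_le (hlam j)
  have hmu0 : ∀ j, 0 < mu j := fun j => (by positivity : (0 : ℝ) < ℓ / 2).trans_le (hmu j)
  have hmuinv : ∀ j, (mu j)⁻¹ ≤ 2 / ℓ := fun j => by
    rw [← inv_div]
    exact inv_anti₀ (by positivity) (hmu j)
  have hDb : ∀ i j, |(inner ℝ D (B (e j) (e i)) : ℝ)| ≤ ‖D‖ := fun i j => by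
    simpa [he] using abs_inner_tensor_le hB D (e j) (e i)
  have hD'b : ∀ i j, |(inner ℝ D' (B (f' j) (f' i)) : ℝ)| ≤ ‖D‖ + η' := fun i j => by
    have h1 : |(inner ℝ D' (B (f' j) (f' i)) : ℝ)| ≤ ‖D'‖ := by
      simpa [hf'] using abs_inner_tensor_le hB D' (f' j) (f' i)
    have h2 : ‖D'‖ ≤ ‖D‖ + ‖D' - D‖ := by
      simpa using norm_add_le D (D' - D)
    linarith
  have hDD : ∀ i j, |(inner ℝ D' (B (f' j) (f' i)) : ℝ) - inner ℝ D (B (e j) (e i))| ≤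
      η' + 2 * ‖D‖ * τ := fun i j => by
    have e1 : (inner ℝ D' (B (f' j) (f' i)) : ℝ) - inner ℝ D (B (e j) (e i)) =
        inner ℝ (D' - D) (B (f' j) (f' i)) + inner ℝ D (B (f' j - e j) (f' i)) +
          inner ℝ D (B (e j) (f' i - e i)) := by
      simp only [inner_sub_left, map_sub, inner_sub_right, sub_apply]
      ring
    have h1 := abs_inner_tensor_le hB (D' - D) (f' j) (f' i)
    have h2 := abs_inner_tensor_le hB D (f' j - e j) (f' i)
    have h3 := abs_inner_tensor_le hB D (e j) (f' i - e i)
    rw [hf', hf', mul_one, mul_one] at h1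
    rw [hf', mul_one] at h2
    rw [he, one_mul] at h3
    have h4 : ‖D‖ * ‖f' j - e j‖ ≤ ‖D‖ * τ := by gcongr; exact hsf j
    have h5 : ‖D‖ * ‖f' i - e i‖ ≤ ‖D‖ * τ := by gcongr; exact hsf i
    rw [e1]
    refine (abs_add_three _ _ _).trans ?_
    linarith
  have haa : ∀ i j, |a i j - a' i j| ≤ 2 / ℓ ^ 2 * η * ‖D‖ + 2 / ℓ * (η' + 2 * ‖D‖ * τ) :=
    fun i j => by
    have e1 : a i j - a' i j = ((lam j)⁻¹ - (mu j)⁻¹) * inner ℝ D (B (e j) (e i)) -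
        (mu j)⁻¹ * (inner ℝ D' (B (f' j) (f' i)) - inner ℝ D (B (e j) (e i))) := by
      simp only [a, a']
      ring
    have h1 : |(lam j)⁻¹ - (mu j)⁻¹| ≤ 2 / ℓ ^ 2 * η := by
      rw [inv_sub_inv (hlam0 j).ne' (hmu0 j).ne', abs_div, abs_of_pos (mul_pos (hlam0 j) (hmu0 j)),
        div_mul_eq_mul_div]
      have : ℓ * (ℓ / 2) ≤ lam j * mu j :=
        mul_le_mul (hlam j) (hmu j) (by positivity) (hlam0 j).le
      rw [div_le_div_iff₀ (mul_pos (hlam0 j) (hmu0 j)) (by positivity)]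
      calc |mu j - lam j| * ℓ ^ 2 ≤ η * (2 * (ℓ * (ℓ / 2))) := by
            rw [show 2 * (ℓ * (ℓ / 2)) = ℓ ^ 2 by ring]
            gcongr
            exact hlm j
        _ ≤ η * (2 * (lam j * mu j)) := by gcongr
        _ = _ := by ring
    rw [e1]
    refine (abs_sub _ _).trans ?_
    rw [abs_mul, abs_mul, abs_of_pos (inv_pos.2 (hmu0 j))]
    gcongr
    · exact hDb i j
    · exact hmuinv j
    · exact hDD i j
  have ha' : ∀ i j, |a' i j| ≤ 2 / ℓ * (‖D‖ + η') := fun i j => by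
    simp only [a', abs_mul, abs_of_pos (inv_pos.2 (hmu0 j))]
    gcongr
    · exact hmuinv j
    · exact hD'b i j
  -- Each difference of rank-one kernels is split in two: the boolean selects a change of the
  -- `s`-factor with its coefficient (`true`) or of the `t`-factor (`false`).
  let p : Fin K × Fin K × Bool → H := fun l => bif l.2.2 then e l.1 else e l.1 - f' l.1
  let q : Fin K × Fin K × Bool → H := fun l =>
    bif l.2.2 then a l.1 l.2.1 • e l.2.1 - a' l.1 l.2.1 • f' l.2.1 else a' l.1 l.2.1 • f' l.2.1
  have hker : ∀ᵐ t, ∀ᵐ u, tensorKernel B D lam e t u - tensorKernel B D' mu f t u =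
      ∑ l, p l t * q l u := by
    have c1 : ∀ᵐ t, ∀ i, (e i - f' i : H) t = e i t - s i * f i t := ae_all_iff.2 fun i => by
      filter_upwards [Lp.coeFn_sub (e i) (f' i), Lp.coeFn_smul (s i) (f i)] with t h1 h2
      rw [h1, Pi.sub_apply, h2, Pi.smul_apply, smul_eq_mul]
    have c2 : ∀ᵐ t, ∀ i j, (a' i j • f' j : H) t = a' i j * (s j * f j t) :=
      ae_all_iff.2 fun i => ae_all_iff.2 fun j => by
      filter_upwards [Lp.coeFn_smul (a' i j) (f' j), Lp.coeFn_smul (s j) (f j)] with t h1 h2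
      rw [h1, Pi.smul_apply, smul_eq_mul, h2, Pi.smul_apply, smul_eq_mul]
    have c3 : ∀ᵐ t, ∀ i j, (a i j • e j - a' i j • f' j : H) t =
        a i j * e j t - (a' i j • f' j : H) t :=
      ae_all_iff.2 fun i => ae_all_iff.2 fun j => by
      filter_upwards [Lp.coeFn_sub (a i j • e j) (a' i j • f' j), Lp.coeFn_smul (a i j) (e j)]
        with t h1 h2
      rw [h1, Pi.sub_apply, h2, Pi.smul_apply, smul_eq_mul]
    filter_upwards [c1] with t h1
    filter_upwards [c2, c3] with u h2 h3
    simp only [Fintype.sum_prod_type, Fintype.sum_bool, p, q, cond_true, cond_false, h1, h3, h2,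
      tensorKernel, ← Finset.sum_sub_distrib]
    refine Finset.sum_congr rfl fun i _ => Finset.sum_congr rfl fun j _ => ?_
    have h4 : (inner ℝ D' (B (f j) (f i)) : ℝ) = s j * s i * inner ℝ D' (B (f' j) (f' i)) := by
      simp only [f', map_smul, smul_apply, inner_smul_right]
      linear_combination (-(inner ℝ D' (B (f j) (f i)) : ℝ) * (s i * s i)) * hs j -
        (inner ℝ D' (B (f j) (f i)) : ℝ) * hs i
    rw [h4]
    simp only [a, a']
    ring
  rw [hsNorm_congr hker]
  refine hsNorm_sum_le p q (by positivity) ?_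
  have hnn : 0 ≤ 2 / ℓ * (‖D‖ + η') * τ := by positivity
  have hnn2 : 0 ≤ 2 / ℓ ^ 2 * η * ‖D‖ + 2 / ℓ * (η' + 2 * ‖D‖ * τ) := by positivity
  rintro ⟨i, j, b⟩
  cases b
  · simp only [p, q, cond_false]
    rw [norm_smul, hf', mul_one, norm_sub_rev, Real.norm_eq_abs, mul_comm]
    have := mul_le_mul (ha' i j) (hsf i) (norm_nonneg _) (by positivity)
    linarith
  · simp only [p, q, cond_true]
    rw [he, one_mul]
    have e1 : a i j • e j - a' i j • f' j = (a i j - a' i j) • e j - a' i j • (f' j - e j) := by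
      rw [sub_smul, smul_sub]
      abel
    rw [e1]
    refine (norm_sub_le _ _).trans ?_
    rw [norm_smul, norm_smul, he, mul_one, Real.norm_eq_abs, Real.norm_eq_abs]
    exact add_le_add (haa i j) (mul_le_mul (ha' i j) (hsf j) (norm_nonneg _) (by positivity))

end HilbertSchmidt

/-! ### Bounds in probability. -/

section Stochastic

variable {Ω : Type*} [MeasurableSpace Ω] {P : Measure Ω}

theorem isBigOP_of_integral_sq_le {X : ℕ → Ω → ℝ} {c : ℝ} (hc : 0 ≤ c)
    (hX : ∀ N, Integrable (fun ω => X N ω ^ 2) P)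
    (h : ∀ᶠ N : ℕ in atTop, ∫ ω, X N ω ^ 2 ∂P ≤ c / N) :
    IsBigOP P X fun N => (N : ℝ) ^ (-(1 / 2) : ℝ) := by
  intro η hη
  -- The constant makes Chebyshev's bound at most `η`; `c + 1` keeps the threshold positive when `c
  -- = 0`.
  refine ⟨√((c + 1) / η), ?_⟩
  filter_upwards [h, eventually_gt_atTop 0] with N hN hN0
  have hN' : (0 : ℝ) < N := by exact_mod_cast hN0
  set a : ℝ := (c + 1) / η / N with ha
  have ha0 : 0 < a := by positivity
  have hsub : {ω | √((c + 1) / η) * (N : ℝ) ^ (-(1 / 2) : ℝ) < |X N ω|} ⊆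
      {ω | a ≤ X N ω ^ 2} := fun ω hω => by
    have h1 : √((c + 1) / η) * (N : ℝ) ^ (-(1 / 2) : ℝ) = √a := by
      rw [ha, Real.sqrt_div (by positivity) (N : ℝ), Real.rpow_neg hN'.le, ← Real.sqrt_eq_rpow]
      rfl
    have h2 : √a < |X N ω| := h1 ▸ hω
    rw [← Real.sqrt_sq_eq_abs] at h2
    exact (Real.lt_sqrt (Real.sqrt_nonneg _)).1 h2 |>.le.trans' (Real.sq_sqrt ha0.le).ge
  refine (measure_mono hsub).trans ?_
  have hmk := mul_meas_ge_le_integral_of_nonneg (ae_of_all _ fun ω => sq_nonneg (X N ω)) (hX N) a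
  have h3 : P.real {ω | a ≤ X N ω ^ 2} ≤ η := by
    have h4 : a * P.real {ω | a ≤ X N ω ^ 2} ≤ (c + 1) / N :=
      hmk.trans (hN.trans (by gcongr; linarith))
    have h5 : (c + 1) / N = a * η := by
      rw [ha]
      field_simp
    rw [h5] at h4
    exact le_of_mul_le_mul_left h4 ha0
  have hfin : P {ω | a ≤ X N ω ^ 2} ≠ ∞ := by
    refine ne_top_of_le_ne_top ?_ (measure_mono (t := {ω | a ≤ ‖X N ω ^ 2‖}) fun ω hω => ?_)
    · exact ((hX N).measure_norm_ge_lt_top ha0).ne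
    · exact le_trans hω (Real.le_norm_self _)
  rw [measureReal_def] at h3
  exact ENNReal.le_ofReal_iff_toReal_le hfin hη.le |>.2 h3

/-- The bound on `X` is required only where `U` and `V` are below `ρ`; as `r` tends to 0, this
region eventually contains the high-probability events. `X` need not be measurable, which matters
because empirical eigenfunctions are chosen arbitrarily. -/
theorem IsBigOP.of_le_mul_add {X U V : ℕ → Ω → ℝ} {r : ℕ → ℝ} (hr : Tendsto r atTop (𝓝 0))
    (hU : IsBigOP P U r) (hV : IsBigOP P V r) {c ρ : ℝ} (hc : 0 ≤ c)
    (hρ : 0 < ρ)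
    (h : ∀ᶠ N in atTop, ∀ᵐ ω ∂P, |U N ω| ≤ ρ → |V N ω| ≤ ρ → |X N ω| ≤ c * (|U N ω| + |V N ω|)) :
    IsBigOP P X r := by
  intro η hη
  obtain ⟨a, ha⟩ := hU (η / 2) (by positivity)
  obtain ⟨b, hb⟩ := hV (η / 2) (by positivity)
  have small : ∀ a : ℝ, ∀ᶠ N in atTop, a * r N ≤ ρ := fun a => by
    have := hr.const_mul a
    rw [mul_zero] at this
    exact (this.eventually_lt_const hρ).mono fun _ => le_of_lt
  refine ⟨c * (a + b), ?_⟩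
  filter_upwards [ha, hb, h, small a, small b] with N h1 h2 h3 h4 h5
  have hsub : ({ω | c * (a + b) * r N < |X N ω|} : Set Ω) ≤ᵐ[P]
      ({ω | a * r N < |U N ω|} ∪ {ω | b * r N < |V N ω|} : Set Ω) := by
    filter_upwards [h3] with ω hω hlt
    by_contra hcon
    have hcon' : |U N ω| ≤ a * r N ∧ |V N ω| ≤ b * r N := by
      constructor
      · by_contra! hh
        exact hcon (Or.inl hh)
      · by_contra! hh
        exact hcon (Or.inr hh)
    have h6 := hω (hcon'.1.trans h4) (hcon'.2.trans h5)
    have h7 : c * (|U N ω| + |V N ω|) ≤ c * (a * r N + b * r N) := by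
      gcongr
      exacts [hcon'.1, hcon'.2]
    have h8 : c * (a + b) * r N < |X N ω| := hlt
    nlinarith
  calc P {ω | c * (a + b) * r N < |X N ω|} ≤ _ := measure_mono_ae hsub
    _ ≤ _ := measure_union_le _ _
    _ ≤ ENNReal.ofReal (η / 2) + ENNReal.ofReal (η / 2) := add_le_add h1 h2
    _ = ENNReal.ofReal η := by
      rw [← ENNReal.ofReal_add (by positivity) (by positivity), add_halves]

end Stochastic

/-! ### The closed convex cone of compact positive operators. -/

section Covariance

variable {E : Type*} [NormedAddCommGroup E] [InnerProductSpace ℝ E]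

/-- The compact, symmetric, positive operators. -/
def compactPositive (E : Type*) [NormedAddCommGroup E] [InnerProductSpace ℝ E] :
    Set (E →L[ℝ] E) :=
  {A | IsCompactOperator A ∧ (∀ x y, (inner ℝ (A x) y : ℝ) = inner ℝ x (A y)) ∧
    ∀ x, 0 ≤ (inner ℝ (A x) x : ℝ)}

/-- A closed convex set contains the mean of any integrable random element of it, so the covariance
operator inherits compactness and positivity from rank-one operators. -/
theorem isClosed_compactPositive [CompleteSpace E] : IsClosed (compactPositive E) := by
  have h1 : IsClosed (⋂ x, ⋂ y, {A : E →L[ℝ] E | (inner ℝ (A x) y : ℝ) = inner ℝ x (A y)}) :=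
    isClosed_iInter fun x => isClosed_iInter fun y => isClosed_eq (by fun_prop) (by fun_prop)
  have h2 : IsClosed (⋂ x, {A : E →L[ℝ] E | 0 ≤ (inner ℝ (A x) x : ℝ)}) :=
    isClosed_iInter fun x => isClosed_le (by fun_prop) (by fun_prop)
  convert (isClosed_setOfPred_isCompactOperator (𝕜₁ := ℝ) (σ₁₂ := RingHom.id ℝ) (M₁ := E)
    (M₂ := E)).inter (h1.inter h2) using 1
  ext A
  simp [compactPositive]

theorem add_mem_compactPositive {A B : E →L[ℝ] E} (hA : A ∈ compactPositive E)
    (hB : B ∈ compactPositive E) : A + B ∈ compactPositive E := by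
  refine ⟨hA.1.add hB.1, fun x y => ?_, fun x => ?_⟩
  · rw [add_apply, add_apply, inner_add_left, inner_add_right, hA.2.1, hB.2.1]
  · rw [add_apply, inner_add_left]
    exact add_nonneg (hA.2.2 x) (hB.2.2 x)

theorem smul_mem_compactPositive {A : E →L[ℝ] E} (hA : A ∈ compactPositive E) {a : ℝ}
    (ha : 0 ≤ a) : a • A ∈ compactPositive E := by
  refine ⟨hA.1.smul a, fun x y => ?_, fun x => ?_⟩
  · rw [smul_apply, smul_apply, inner_smul_left, inner_smul_right, hA.2.1]
    rfl
  · rw [smul_apply, inner_smul_left]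
    exact mul_nonneg ha (hA.2.2 x)

theorem rankOne_mem_compactPositive (z : E) :
    InnerProductSpace.rankOne ℝ z z ∈ compactPositive E := by
  refine ⟨?_, fun x y => ?_, fun x => ?_⟩
  · rw [InnerProductSpace.rankOne_def']
    exact (isCompactOperator_of_locallyCompactSpace_dom (innerSL ℝ z)).clm_comp
      (ContinuousLinearMap.toSpanSingleton ℝ z)
  · simp only [InnerProductSpace.rankOne_apply, inner_smul_left, inner_smul_right]
    rw [real_inner_comm z x]
    simp [mul_comm]
  · simp only [InnerProductSpace.rankOne_apply, inner_smul_left]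
    simpa using mul_self_nonneg (inner ℝ z x : ℝ)

theorem IsLeadingEigensystem.isTopSystem {A : H →L[ℝ] H} {T : H → H} (hT : ∀ x, T x = A x)
    (hA : A ∈ compactPositive H) {n : ℕ} {lam : Fin n → ℝ} {e : Fin n → H}
    (h : IsLeadingEigensystem T lam e) : IsTopSystem A lam e where
  symm := hA.2.1
  orthonormal := h.orthonormal
  antitone := h.antitone
  eigen j := by rw [← hT, h.eigen]
  bound := inner_apply_le_of_leading hA.1 hA.2.1 hA.2.2 h.orthonormal
    (fun j => by rw [← hT, h.eigen]) fun μ v hv hAv => h.leading μ v hv (by rw [hT, hAv])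

end Covariance

/-! ### Lipschitz dependence of the kernel on the operator and on the lag-one moment. -/

section Perturbation

variable {G : Type*} [NormedAddCommGroup G] [InnerProductSpace ℝ G] {B : H →L[ℝ] H →L[ℝ] G}

/-- Testing with `y = A x` bounds the operator by the norm of the tensor representing it, so
operator errors are controlled by Hilbert space sample means. -/
theorem norm_apply_le_of_inner_tensor
    (hB : ∀ x y u v, (inner ℝ (B x y) (B u v) : ℝ) = inner ℝ x u * inner ℝ y v)
    {A : H →L[ℝ] H} {D : G} (h : ∀ x y, (inner ℝ (A x) y : ℝ) = inner ℝ D (B x y)) (x : H) :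
    ‖A x‖ ≤ ‖D‖ * ‖x‖ := by
  have h1 := abs_inner_tensor_le hB D x (A x)
  rw [← h, real_inner_self_eq_norm_sq, abs_of_nonneg (by positivity)] at h1
  by_cases h0 : ‖A x‖ = 0
  · rw [h0]
    positivity
  · have h2 : 0 < ‖A x‖ := lt_of_le_of_ne (norm_nonneg _) (Ne.symm h0)
    refine le_of_mul_le_mul_right ?_ h2
    linarith

theorem integrable_of_inner_tensor
    (hB : ∀ x y u v, (inner ℝ (B x y) (B u v) : ℝ) = inner ℝ x u * inner ℝ y v)
    {Ω : Type*} [MeasurableSpace Ω] {P : Measure Ω} {X U : Ω → H} (hX : MemLp X 2 P)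
    (hU : MemLp U 2 P) : Integrable (fun ω => B (X ω) (U ω)) P := by
  have hc : Continuous fun p : H × H => B p.1 p.2 := B.continuous₂
  refine (hX.norm.integrable_mul hU.norm).mono'
    (hc.comp_aestronglyMeasurable (hX.1.prodMk hU.1)) (ae_of_all _ fun ω => ?_)
  rw [← toReal_enorm, IsSquaredARCH.enorm_tensor hB, ENNReal.toReal_mul]
  rfl

theorem exists_pos_gap {n : ℕ} {lam : Fin n → ℝ} (h : Function.Injective lam) :
    ∃ g : ℝ, 0 < g ∧ ∀ i k, k ≠ i → g ≤ |lam k - lam i| := by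
  have h1 : ∀ᶠ g : ℝ in 𝓝[>] 0, ∀ i k, k ≠ i → g ≤ |lam k - lam i| := by
    refine eventually_all.2 fun i => eventually_all.2 fun k => ?_
    by_cases hk : k = i
    · exact Eventually.of_forall fun _ h => absurd hk h
    · have : 0 < |lam k - lam i| := abs_pos.2 (sub_ne_zero.2 (h.ne hk))
      filter_upwards [Ioc_mem_nhdsGT this] with g hg _ using hg.2
  obtain ⟨g, hg, hg0⟩ := (h1.and self_mem_nhdsWithin).exists
  exact ⟨g, hg0, hg⟩

/-- The kernel `∑ λ_j⁻¹ ⟨D, e_j ⊗ e_i⟩ e_j(s) e_i(t)` of the leading eigenelements depends in a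
Lipschitz way on the operator and on `D`. -/
theorem IsTopSystem.exists_hsNorm_tensorKernel_sub_le
    (hB : ∀ x y u v, (inner ℝ (B x y) (B u v) : ℝ) = inner ℝ x u * inner ℝ y v) {K : ℕ}
    {A : H →L[ℝ] H} {lam : Fin (K + 1) → ℝ} {e : Fin (K + 1) → H} (hA : IsTopSystem A lam e)
    (hanti : StrictAnti lam) (hpos : 0 < lam (Fin.last K)) (D : G) :
    ∃ c r : ℝ, 0 ≤ c ∧ 0 < r ∧ ∀ (A' : H →L[ℝ] H) (mu : Fin K → ℝ) (f : Fin K → H) (D' : G)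
      (η η' : ℝ), IsTopSystem A' mu f → (∀ x, ‖(A - A') x‖ ≤ η * ‖x‖) → 0 ≤ η → η ≤ r →
      ‖D' - D‖ ≤ η' → η' ≤ r →
      hsNorm (fun t s => tensorKernel B D (fun j => lam j.castSucc) (fun j => e j.castSucc) t s -
        tensorKernel B D' mu f t s) ≤ c * (η + η') := by
  obtain ⟨g, hg, hgap⟩ := exists_pos_gap hanti.injective
  set ℓ := lam (Fin.last K) with hℓ
  -- The constant of `exists_sign_norm_sub_le` for `K + 1` eigenvectors and residual `2η`: one `η`
  -- from the operators and one from the eigenvalues.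
  let T : ℝ := 4 * ((K + 1 : ℕ) + 1) / g
  have hT : 0 ≤ T := by positivity
  -- In the radius, `η ≤ ℓ/2` keeps the perturbed eigenvalues above `ℓ/2`, away from the default
  -- inverse at 0, and `η' ≤ 1` lets products of errors be absorbed into linear terms.
  refine ⟨Fintype.card (Fin K × Fin K × Bool) * (2 / ℓ ^ 2 * ‖D‖ + 2 / ℓ * (1 + 2 * ‖D‖ * T) +
    2 / ℓ * (‖D‖ + 1) * T), min 1 (ℓ / 2), by positivity, by positivity,
    fun A' mu f D' η η' hA' hη hη0 hηr hD hη'r => ?_⟩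
  have hη'0 : 0 ≤ η' := (norm_nonneg _).trans hD
  have hη'1 : η' ≤ 1 := hη'r.trans (min_le_left _ _)
  have hηℓ : η ≤ ℓ / 2 := hηr.trans (min_le_right _ _)
  have hlm : ∀ j : Fin K, |mu j - lam j.castSucc| ≤ η := fun j =>
    hA.abs_eigenvalue_sub_le hA' hη j.castSucc j rfl
  have hlam : ∀ j : Fin K, ℓ ≤ lam j.castSucc := fun j => hA.antitone (Fin.le_last _)
  have hsign : ∀ j : Fin K, ∃ s : ℝ, s * s = 1 ∧ ‖s • f j - e j.castSucc‖ ≤ T * η := fun j => by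
    have hfj : ‖f j‖ = 1 := hA'.orthonormal.1 j
    have h1 : ‖A (f j) - lam j.castSucc • f j‖ ≤ 2 * η := by
      have e1 : A (f j) - lam j.castSucc • f j =
          (A - A') (f j) + (mu j - lam j.castSucc) • f j := by
        rw [sub_apply, hA'.eigen, sub_smul]
        abel
      rw [e1]
      refine (norm_add_le _ _).trans ?_
      rw [norm_smul, hfj, mul_one, Real.norm_eq_abs]
      have := hη (f j)
      rw [hfj, mul_one] at this
      linarith [hlm j]
    obtain ⟨s, hs, h2⟩ := hA.exists_sign_norm_sub_le hg j.castSucc (fun k hk => hgap _ k hk)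
      ⟨j.succ, by
        have h3 : lam j.succ < lam j.castSucc := hanti Fin.castSucc_lt_succ
        have h4 := hgap j.castSucc j.succ Fin.castSucc_lt_succ.ne'
        rw [abs_of_neg (by linarith)] at h4
        linarith⟩ hfj h1
    refine ⟨s, hs, h2.trans (le_of_eq ?_)⟩
    simp only [T]
    ring
  choose s hs hsf using hsign
  refine (hsNorm_tensorKernel_sub_le hB hpos hη0 (mul_nonneg hT hη0)
    (fun j => hA.orthonormal.1 _) (fun j => hA'.orthonormal.1 j) hs hsf hlam
    (fun j => ?_) hlm hD).trans ?_
  · have := (abs_le.1 (hlm j)).1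
    linarith [hlam j]
  · refine (mul_le_mul_of_nonneg_left ?_ (Nat.cast_nonneg _)).trans_eq (mul_assoc _ _ _).symm
    have hD0 := norm_nonneg D
    have p1 : 0 ≤ 2 / ℓ ^ 2 * ‖D‖ * η' := by positivity
    have p2 : 0 ≤ 2 / ℓ * η := by positivity
    have p3 : 0 ≤ 2 / ℓ * (2 * ‖D‖ * T) * η' := by positivity
    have p4 : 0 ≤ 2 / ℓ * (‖D‖ + 1) * T * η' := by positivity
    have p5 : 2 / ℓ * (‖D‖ + η') * (T * η) ≤ 2 / ℓ * (‖D‖ + 1) * (T * η) := by gcongr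
    linarith

end Perturbation

/-! ### The Hilbert tensor square; estimators and covariance operators as tensors. -/

section Tensor

/-- The Hilbert tensor square of `L²([0,1])`. -/
abbrev TensorSquare : Type := UniformSpace.Completion (TensorProduct ℝ H H)

/-- The map `(x, y) ↦ x ⊗ y` into the Hilbert tensor square. -/
def tensor : H →L[ℝ] H →L[ℝ] TensorSquare :=
  (ContinuousLinearMap.compL ℝ H (TensorProduct ℝ H H) TensorSquare
    UniformSpace.Completion.toComplL).comp (TensorProduct.mkL ℝ H H)

theorem inner_tensor (x y u v : H) :
    (inner ℝ (tensor x y) (tensor u v) : ℝ) = inner ℝ x u * inner ℝ y v := by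
  have h : ∀ x y : H, tensor x y =
      ((TensorProduct.tmul ℝ x y : TensorProduct ℝ H H) : TensorSquare) := fun _ _ => rfl
  rw [h, h, UniformSpace.Completion.inner_coe, TensorProduct.inner_tmul]

variable {Ω : Type*} [MeasurableSpace Ω] {P : Measure Ω} {Z : ℤ → Ω → H}

theorem integrable_tensor {X U : Ω → H} (hX : MemLp X 2 P) (hU : MemLp U 2 P) :
    Integrable (fun ω => tensor (X ω) (U ω)) P :=
  integrable_of_inner_tensor inner_tensor hX hU

theorem betaK_eq_tensorKernel (h1 : MemLp (Z 1) 2 P) (h2 : MemLp (Z 2) 2 P) {K : ℕ}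
    (lam : Fin K → ℝ) (e : Fin K → H) :
    betaK P Z lam e = tensorKernel tensor (∫ ω, tensor (Z 1 ω) (Z 2 ω) ∂P) lam e := by
  funext t s
  simp only [betaK, tensorKernel, ← integral_inner_const (integrable_tensor h1 h2), inner_tensor]

omit [MeasurableSpace Ω] in
theorem betaHat_eq_tensorKernel (N : ℕ) (ω : Ω) {K : ℕ} (lam : Fin K → ℝ) (e : Fin K → H) :
    betaHat Z N ω lam e = tensorKernel tensor
      (((N : ℝ) - 1)⁻¹ • ∑ k ∈ Finset.Icc 1 (N - 1), tensor (Z k ω) (Z (k + 1) ω)) lam e := by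
  funext t s
  simp only [betaHat, tensorKernel, inner_smul_left, sum_inner, inner_tensor, Finset.mul_sum,
    Finset.sum_mul]
  rw [Finset.sum_comm]
  refine ((Finset.sum_congr rfl fun j _ => Finset.sum_comm).trans Finset.sum_comm).trans ?_
  refine Finset.sum_congr rfl fun i _ => Finset.sum_congr rfl fun j _ =>
    Finset.sum_congr rfl fun k _ => ?_
  simp only [map_inv₀, conj_trivial]
  ring

/-- The covariance operator as a continuous linear map. -/
def covCLM (P : Measure Ω) (Z : Ω → H) : H →L[ℝ] H :=
  ∫ ω, InnerProductSpace.rankOne ℝ (Z ω) (Z ω) ∂P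

theorem integrable_rankOne {X : Ω → H} (hX : MemLp X 2 P) :
    Integrable (fun ω => InnerProductSpace.rankOne ℝ (X ω) (X ω)) P := by
  refine (hX.norm.integrable_mul hX.norm).mono' ?_ (ae_of_all _ fun ω => ?_)
  · have : Continuous fun x : H => InnerProductSpace.rankOne ℝ x x :=
      (InnerProductSpace.rankOne ℝ (E := H) (F := H)).continuous.clm_apply continuous_id
    exact this.comp_aestronglyMeasurable hX.1
  · rw [InnerProductSpace.norm_rankOne]
    rfl

theorem covOp_eq_covCLM (hZ : MemLp (Z 1) 2 P) (x : H) : covOp P Z x = covCLM P (Z 1) x := by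
  rw [covCLM, ContinuousLinearMap.integral_apply (integrable_rankOne hZ)]
  rfl

theorem covCLM_mem_compactPositive [IsProbabilityMeasure P] {X : Ω → H} (hX : MemLp X 2 P) :
    covCLM P X ∈ compactPositive H := by
  refine Convex.integral_mem (fun A hA B hB a b ha hb _ => ?_) isClosed_compactPositive
    (ae_of_all _ fun ω => rankOne_mem_compactPositive _) (integrable_rankOne hX)
  exact add_mem_compactPositive (smul_mem_compactPositive hA ha) (smul_mem_compactPositive hB hb)

theorem inner_covCLM {X : Ω → H} (hX : MemLp X 2 P) (x y : H) :
    (inner ℝ (covCLM P X x) y : ℝ) = inner ℝ (∫ ω, tensor (X ω) (X ω) ∂P) (tensor x y) := by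
  have h1 : Integrable (fun ω => InnerProductSpace.rankOne ℝ (X ω) (X ω) x) P :=
    (ContinuousLinearMap.apply ℝ H x).integrable_comp (integrable_rankOne hX)
  rw [covCLM, ContinuousLinearMap.integral_apply (integrable_rankOne hX),
    ← integral_inner_const h1, ← integral_inner_const (integrable_tensor hX hX)]
  simp only [inner_tensor, InnerProductSpace.rankOne_apply, inner_smul_left]
  rfl

/-- The empirical covariance operator as a continuous linear map. -/
def empCovCLM (Z : ℤ → Ω → H) (N : ℕ) (ω : Ω) : H →L[ℝ] H :=
  (N : ℝ)⁻¹ • ∑ k ∈ Finset.Icc 1 N, InnerProductSpace.rankOne ℝ (Z k ω) (Z k ω)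

omit [MeasurableSpace Ω] in
theorem empCovOp_eq_empCovCLM (N : ℕ) (ω : Ω) (x : H) :
    empCovOp Z N ω x = empCovCLM Z N ω x := by
  simp [empCovOp, empCovCLM]

omit [MeasurableSpace Ω] in
theorem empCovCLM_mem_compactPositive (N : ℕ) (ω : Ω) :
    empCovCLM Z N ω ∈ compactPositive H := by
  refine smul_mem_compactPositive ?_ (by positivity)
  refine Finset.sum_induction _ (· ∈ compactPositive H) (fun _ _ => add_mem_compactPositive) ?_
    fun k _ => rankOne_mem_compactPositive _
  simpa using rankOne_mem_compactPositive (0 : H)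

omit [MeasurableSpace Ω] in
theorem inner_empCovCLM (N : ℕ) (ω : Ω) (x y : H) :
    (inner ℝ (empCovCLM Z N ω x) y : ℝ) =
      inner ℝ ((N : ℝ)⁻¹ • ∑ k ∈ Finset.Icc 1 N, tensor (Z k ω) (Z k ω)) (tensor x y) := by
  simp [empCovCLM, inner_smul_left, sum_inner, inner_tensor]

end Tensor

/-! ### Linear growth of the second moments of centred tensor sums. -/

section SampleMoments

theorem sum_Icc_one_eq_sum_range {M : Type*} [AddCommMonoid M] (f : ℕ → M) (n : ℕ) :
    ∑ k ∈ Finset.Icc 1 n, f k = ∑ k ∈ Finset.range n, f (k + 1) := by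
  induction n with
  | zero => simp
  | succ n ih => rw [Finset.sum_Icc_succ_top (by omega), Finset.sum_range_succ, ih]

theorem norm_sub_sub_sq_le {G : Type*} [NormedAddCommGroup G]
    (a b c : G) :
    ‖a - b - c‖ ^ 2 ≤ 3 * (‖a‖ ^ 2 + ‖b‖ ^ 2 + ‖c‖ ^ 2) := by
  have h : ‖a - b - c‖ ≤ ‖a‖ + ‖b‖ + ‖c‖ :=
    (norm_sub_le _ _).trans (add_le_add_left (norm_sub_le _ _) _)
  calc ‖a - b - c‖ ^ 2 ≤ (‖a‖ + ‖b‖ + ‖c‖) ^ 2 := by gcongr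
    _ ≤ _ := by
      nlinarith [sq_nonneg (‖a‖ - ‖b‖), sq_nonneg (‖a‖ - ‖c‖), sq_nonneg (‖b‖ - ‖c‖)]

variable {Ω : Type*} [mΩ : MeasurableSpace Ω] {P : Measure Ω} [IsProbabilityMeasure P]
  {G : Type*} [NormedAddCommGroup G] [InnerProductSpace ℝ G]

variable [CompleteSpace G] {β : unitInterval → unitInterval → ℝ} {δ : H} {ε Y : ℤ → Ω → H}
  {B : H →L[ℝ] H →L[ℝ] G}

/-- The centred sums of `(Y_k - m) ⊗ (Y_{k+d} - m)` have second moments of linear growth. -/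
theorem IsSquaredARCH.exists_integral_norm_sq_sum_tensor_le
    (hB : ∀ x y u v, (inner ℝ (B x y) (B u v) : ℝ) = inner ℝ x u * inner ℝ y v)
    (h : IsSquaredARCH P β δ ε Y)
    (hcausal : ∀ k, Measurable[innovSigma ε (Set.Iic k)] (Y k)) (d : ℕ) {m : H} {t : G}
    (hm : ∀ k, ∫ ω, Y k ω ∂P = m) (ht : ∀ k, ∫ ω, B (Y k ω) (Y (k + d) ω) ∂P = t) :
    ∃ c : ℝ, 0 ≤ c ∧ ∀ n : ℕ,
      MemLp (fun ω => ∑ k ∈ Finset.Icc 1 n, (B (Y k ω - m) (Y (k + d) ω - m) -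
        ∫ ω, B (Y 1 ω - m) (Y (1 + d) ω - m) ∂P)) 2 P ∧
      ∫ ω, ‖∑ k ∈ Finset.Icc 1 n, (B (Y k ω - m) (Y (k + d) ω - m) -
        ∫ ω, B (Y 1 ω - m) (Y (1 + d) ω - m) ∂P)‖ ^ 2 ∂P ≤ c * n := by
  obtain ⟨C₁, θ₁, hC₁, hθ₁, hθ₁', h₁⟩ := h.integral_inner_centred_process_le hcausal
  obtain ⟨C₂, θ₂, hC₂, hθ₂, hθ₂', h₂⟩ := integral_inner_centred_tensor_le hB h hcausal d
  obtain ⟨M, hMt, hM⟩ := h.moment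
  simp only [hm] at h₁
  simp only [ht] at h₂
  let U : ℤ → Ω → H := fun k ω => Y k ω - m
  let W : ℤ → Ω → G := fun k ω => B (Y k ω) (Y (k + d) ω) - t
  have hYm : ∀ k, MemLp (Y k) 2 P := h.memLp_process
  have hU : ∀ k, MemLp (U k) 2 P := fun k => (hYm k).sub (memLp_const m)
  have hBY : ∀ k, MemLp (fun ω => B (Y k ω) (Y (k + d) ω)) 2 P := fun k =>
    memLp_tensor hB hMt (h.measurable _) (h.measurable _) (h.measurable _) (h.measurable _)
      (hM _) (hM _) (ae_of_all _ fun _ => le_rfl) (ae_of_all _ fun _ => le_rfl)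
  have hW : ∀ k, MemLp (W k) 2 P := fun k => (hBY k).sub (memLp_const t)
  have hUsum : ∀ (a : ℤ) (n : ℕ),
      ∫ ω, ‖∑ k ∈ Finset.range n, U (k + a) ω‖ ^ 2 ∂P ≤ 2 * C₁ / (1 - θ₁) * n := fun a n => by
    refine integral_norm_sq_sum_le (X := fun k ω => U (k + a) ω) (fun k => hU _) hC₁ hθ₁.le hθ₁'
      (fun k j => ?_) n
    have := h₁ (k + a) j
    rwa [show (k : ℤ) + a + j = (k + j : ℕ) + a by push_cast; ring] at this
  have hWsum : ∀ n : ℕ,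
      ∫ ω, ‖∑ k ∈ Finset.range n, W (k + 1) ω‖ ^ 2 ∂P ≤ 2 * C₂ / (1 - θ₂) * n := fun n => by
    refine integral_norm_sq_sum_le (X := fun k ω => W (k + 1) ω) (fun k => hW _) hC₂ hθ₂.le hθ₂'
      (fun k j => ?_) n
    have := h₂ (k + 1) j
    rwa [show (k : ℤ) + 1 + j = (k + j : ℕ) + 1 by push_cast; ring] at this
  have hmean : ∫ ω, B (Y 1 ω - m) (Y (1 + d) ω - m) ∂P = t - B m m := by
    have i1 : Integrable (fun ω => B (Y 1 ω) (Y (1 + d) ω)) P := (hBY 1).integrable one_le_two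
    have i2 : Integrable (fun ω => B (Y 1 ω) m) P :=
      (B.flip m).integrable_comp ((hYm 1).integrable one_le_two)
    have i3 : Integrable (fun ω => B m (Y (1 + d) ω)) P :=
      (B m).integrable_comp ((hYm (1 + d)).integrable one_le_two)
    have e1 : ∀ ω, B (Y 1 ω - m) (Y (1 + d) ω - m) =
        B (Y 1 ω) (Y (1 + d) ω) - B (Y 1 ω) m - B m (Y (1 + d) ω) + B m m := fun ω => by
      simp only [map_sub, sub_apply]
      abel
    have j2 : ∫ ω, B (Y 1 ω) m ∂P = B m m := by
      have := (B.flip m).integral_comp_comm ((hYm 1).integrable one_le_two)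
      rw [hm] at this
      exact this
    have j3 : ∫ ω, B m (Y (1 + d) ω) ∂P = B m m := by
      rw [(B m).integral_comp_comm ((hYm (1 + d)).integrable one_le_two), hm]
    have i12 : Integrable (fun ω => B (Y 1 ω) (Y (1 + d) ω) - B (Y 1 ω) m) P := i1.sub i2
    have i123 : Integrable
        (fun ω => B (Y 1 ω) (Y (1 + d) ω) - B (Y 1 ω) m - B m (Y (1 + d) ω)) P := i12.sub i3
    simp only [e1]
    rw [integral_add i123 (integrable_const _), integral_sub i12 i3, integral_sub i1 i2, ht, j2, j3]
    simp
  -- The covariance bounds rest on nonnegativity and so are available for `Y`, not for `Y - m`.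
  -- Expanding the tensor expresses the sum through centred sums of `Y k ⊗ Y (k+d)` and of `Y` at
  -- two shifts.
  have hdec : ∀ (n : ℕ) ω, ∑ k ∈ Finset.Icc 1 n, (B (Y k ω - m) (Y (k + d) ω - m) -
        ∫ ω, B (Y 1 ω - m) (Y (1 + d) ω - m) ∂P) =
      ∑ k ∈ Finset.range n, W (k + 1) ω - B (∑ k ∈ Finset.range n, U (k + 1) ω) m -
        B m (∑ k ∈ Finset.range n, U (k + (1 + d)) ω) := fun n ω => by
    rw [sum_Icc_one_eq_sum_range (fun k : ℕ => B (Y k ω - m) (Y (k + d) ω - m) -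
        ∫ ω, B (Y 1 ω - m) (Y (1 + d) ω - m) ∂P), hmean, map_sum, map_sum, sum_apply,
      ← Finset.sum_sub_distrib, ← Finset.sum_sub_distrib]
    refine Finset.sum_congr rfl fun k _ => ?_
    simp only [W, U, map_sub, sub_apply, Nat.cast_add, Nat.cast_one, add_assoc]
    abel
  have hUm : ∀ (a : ℤ) (n : ℕ), MemLp (fun ω => ∑ k ∈ Finset.range n, U (k + a) ω) 2 P :=
    fun a n => memLp_finsetSum _ fun k _ => hU _
  have hWm : ∀ n : ℕ, MemLp (fun ω => ∑ k ∈ Finset.range n, W (k + 1) ω) 2 P :=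
    fun n => memLp_finsetSum _ fun k _ => hW _
  have m2 : ∀ n : ℕ, MemLp (fun ω => B (∑ k ∈ Finset.range n, U (k + 1) ω) m) 2 P := fun n =>
    (B.flip m).comp_memLp' (hUm 1 n)
  have m3 : ∀ n : ℕ, MemLp (fun ω => B m (∑ k ∈ Finset.range n, U (k + (1 + d)) ω)) 2 P :=
    fun n => (B m).comp_memLp' (hUm (1 + d) n)
  have hnorm : ∀ x y, ‖B x y‖ = ‖x‖ * ‖y‖ := fun x y => by
    rw [← toReal_enorm, enorm_tensor hB, ENNReal.toReal_mul, toReal_enorm, toReal_enorm]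
  refine ⟨3 * (2 * C₂ / (1 - θ₂) + 2 * (‖m‖ ^ 2 * (2 * C₁ / (1 - θ₁)))), ?_, fun n => ⟨?_, ?_⟩⟩
  · have := sub_pos.2 hθ₁'
    have := sub_pos.2 hθ₂'
    positivity
  · simp only [hdec]
    exact ((hWm n).sub (m2 n)).sub (m3 n)
  · simp only [hdec]
    have k1 : Integrable (fun ω => ‖∑ k ∈ Finset.range n, W (k + 1) ω‖ ^ 2) P :=
      (hWm n).integrable_norm_pow two_ne_zero
    have k2 : ∀ a : ℤ, Integrable (fun ω => ‖∑ k ∈ Finset.range n, U (k + a) ω‖ ^ 2) P :=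
      fun a => (hUm a n).integrable_norm_pow two_ne_zero
    have k12 : Integrable (fun ω => ‖∑ k ∈ Finset.range n, W (k + 1) ω‖ ^ 2 +
        ‖m‖ ^ 2 * ‖∑ k ∈ Finset.range n, U (k + 1) ω‖ ^ 2) P := k1.add ((k2 1).const_mul _)
    calc _ ≤ ∫ ω, 3 * (‖∑ k ∈ Finset.range n, W (k + 1) ω‖ ^ 2 +
          ‖m‖ ^ 2 * ‖∑ k ∈ Finset.range n, U (k + 1) ω‖ ^ 2 +
          ‖m‖ ^ 2 * ‖∑ k ∈ Finset.range n, U (k + (1 + d)) ω‖ ^ 2) ∂P := by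
          refine integral_mono_of_nonneg (ae_of_all _ fun ω => by positivity)
            ((k12.add ((k2 (1 + d)).const_mul _)).const_mul _) (ae_of_all _ fun ω => ?_)
          refine (norm_sub_sub_sq_le _ _ _).trans (le_of_eq ?_)
          rw [hnorm, hnorm]
          ring
      _ ≤ _ := by
          rw [integral_const_mul, integral_add k12 ((k2 (1 + d)).const_mul _),
            integral_add k1 ((k2 1).const_mul _), integral_const_mul, integral_const_mul]
          have q1 := hWsum n
          have q2 := mul_le_mul_of_nonneg_left (hUsum 1 n) (sq_nonneg ‖m‖)
          have q3 := mul_le_mul_of_nonneg_left (hUsum (1 + d) n) (sq_nonneg ‖m‖)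
          linarith

end SampleMoments

/-! ### Root-`N` consistency of the sample moments. -/

section Consistency

variable {Ω : Type*} [MeasurableSpace Ω] {P : Measure Ω}

theorem integral_comp_eq_of_identDistrib {E G : Type*} [MeasurableSpace E] [NormedAddCommGroup G]
    [NormedSpace ℝ G] {X X' : Ω → E} (h : IdentDistrib X X' P P) {f : E → G}
    (hf : StronglyMeasurable f) : ∫ ω, f (X ω) ∂P = ∫ ω, f (X' ω) ∂P := by
  rw [← integral_map h.aemeasurable_fst hf.aestronglyMeasurable, h.map_eq,
    integral_map h.aemeasurable_snd hf.aestronglyMeasurable]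

variable [IsProbabilityMeasure P] {β : unitInterval → unitInterval → ℝ} {δ : H} {ε y : ℤ → Ω → H}

theorem memLp_centredSq (h : IsSquaredARCH P β δ ε fun k ω => sq (y k ω)) (k : ℤ) :
    MemLp (centredSq P y k) 2 P :=
  (h.memLp_process k).sub (memLp_const _)

variable {G : Type*} [NormedAddCommGroup G] [InnerProductSpace ℝ G] [CompleteSpace G]
  {B : H →L[ℝ] H →L[ℝ] G}

/-- The bound is proved for the causal version and carried over almost surely. Stationarity makes
the mean and the lag-`d` moment independent of `k`. -/
theorem exists_integral_norm_sq_sum_centredSq_le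
    (hB : ∀ x y u v, (inner ℝ (B x y) (B u v) : ℝ) = inner ℝ x u * inner ℝ y v)
    (h : IsSquaredARCH P β δ ε fun k ω => sq (y k ω)) (hstat : IsStrictlyStationary P y) (d : ℕ) :
    ∃ c : ℝ, 0 ≤ c ∧ ∀ n : ℕ,
      MemLp (fun ω => ∑ k ∈ Finset.Icc 1 n, (B (centredSq P y k ω) (centredSq P y (k + d) ω) -
        ∫ ω, B (centredSq P y 1 ω) (centredSq P y (1 + d) ω) ∂P)) 2 P ∧
      ∫ ω, ‖∑ k ∈ Finset.Icc 1 n, (B (centredSq P y k ω) (centredSq P y (k + d) ω) -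
        ∫ ω, B (centredSq P y 1 ω) (centredSq P y (1 + d) ω) ∂P)‖ ^ 2 ∂P ≤ c * n := by
  obtain ⟨Y, hY, hcausal, hYy⟩ := h.exists_causal
  have hm : ∀ k, ∫ ω, Y k ω ∂P = meanSq P y := fun k => by
    rw [integral_congr_ae (hYy k)]
    exact integral_comp_eq_of_identDistrib (hstat.identDistrib k) measurable_sq.stronglyMeasurable
  have ht : ∀ k, ∫ ω, B (Y k ω) (Y (k + d) ω) ∂P =
      ∫ ω, B (sq (y 0 ω)) (sq (y (0 + d) ω)) ∂P := fun k => by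
    have h1 : ∫ ω, B (Y k ω) (Y (k + d) ω) ∂P = ∫ ω, B (sq (y k ω)) (sq (y (k + d) ω)) ∂P := by
      refine integral_congr_ae ?_
      filter_upwards [hYy k, hYy (k + d)] with ω h1 h2
      rw [h1, h2]
    have hf : StronglyMeasurable fun p : H × H => B (sq p.1) (sq p.2) :=
      B.continuous₂.stronglyMeasurable.comp_measurable
        ((measurable_sq.comp measurable_fst).prodMk (measurable_sq.comp measurable_snd))
    rw [h1]
    exact integral_comp_eq_of_identDistrib (hstat.identDistrib_pair k d) hf
  obtain ⟨c, hc, hcn⟩ := hY.exists_integral_norm_sq_sum_tensor_le hB hcausal d hm ht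
  have hae : ∀ᵐ ω ∂P, ∀ k, Y k ω - meanSq P y = centredSq P y k ω :=
    ae_all_iff.2 fun k => (hYy k).mono fun ω hω => by rw [hω, centredSq]
  have hD : ∫ ω, B (Y 1 ω - meanSq P y) (Y (1 + d) ω - meanSq P y) ∂P =
      ∫ ω, B (centredSq P y 1 ω) (centredSq P y (1 + d) ω) ∂P :=
    integral_congr_ae (hae.mono fun ω hω => by simp only [hω])
  rw [hD] at hcn
  refine ⟨c, hc, fun n => ⟨(hcn n).1.ae_eq ?_, (integral_congr_ae ?_).trans_le (hcn n).2⟩⟩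
  · exact hae.mono fun ω hω => by simp only [hω]
  · exact hae.mono fun ω hω => by simp only [hω]

/-- The free sample size `n N` covers both the `N` terms of the covariance estimator and the `N - 1`
terms at lag one; `N ≤ 2 * n N` keeps the rate. -/
theorem isBigOP_norm_mean_tensor_sub
    (hB : ∀ x y u v, (inner ℝ (B x y) (B u v) : ℝ) = inner ℝ x u * inner ℝ y v)
    (h : IsSquaredARCH P β δ ε fun k ω => sq (y k ω)) (hstat : IsStrictlyStationary P y) (d : ℕ)
    {n : ℕ → ℕ} (hn : ∀ᶠ N in atTop, 0 < n N ∧ N ≤ 2 * n N) :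
    IsBigOP P (fun N ω => ‖(n N : ℝ)⁻¹ • ∑ k ∈ Finset.Icc 1 (n N),
        B (centredSq P y k ω) (centredSq P y (k + d) ω) -
        ∫ ω, B (centredSq P y 1 ω) (centredSq P y (1 + d) ω) ∂P‖)
      fun N => (N : ℝ) ^ (-(1 / 2) : ℝ) := by
  obtain ⟨c, hc, hcn⟩ := exists_integral_norm_sq_sum_centredSq_le hB h hstat d
  set D := ∫ ω, B (centredSq P y 1 ω) (centredSq P y (1 + d) ω) ∂P
  have hmem : ∀ m : ℕ, MemLp (fun ω => (m : ℝ)⁻¹ • ∑ k ∈ Finset.Icc 1 m,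
      B (centredSq P y k ω) (centredSq P y (k + d) ω) - D) 2 P := fun m => by
    have e1 : ∀ ω, ∑ k ∈ Finset.Icc 1 m, B (centredSq P y k ω) (centredSq P y (k + d) ω) =
        ∑ k ∈ Finset.Icc 1 m, (B (centredSq P y k ω) (centredSq P y (k + d) ω) - D) +
          (m : ℝ) • D := fun ω => by
      rw [Finset.sum_sub_distrib]
      simp [Nat.cast_smul_eq_nsmul]
    simp only [e1]
    exact (((hcn m).1.add (memLp_const _)).const_smul _).sub (memLp_const _)
  refine isBigOP_of_integral_sq_le (c := 2 * c) (by positivity)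
    (fun N => (hmem (n N)).integrable_norm_pow two_ne_zero) ?_
  filter_upwards [hn, eventually_gt_atTop 0] with N hN hN0
  have hn0 : (0 : ℝ) < n N := by exact_mod_cast hN.1
  have hN0' : (0 : ℝ) < N := by exact_mod_cast hN0
  have hNn : (N : ℝ) ≤ 2 * n N := by exact_mod_cast hN.2
  have e2 : ∀ ω, ‖(n N : ℝ)⁻¹ • ∑ k ∈ Finset.Icc 1 (n N),
      B (centredSq P y k ω) (centredSq P y (k + d) ω) - D‖ ^ 2 =
      ((n N : ℝ)⁻¹) ^ 2 * ‖∑ k ∈ Finset.Icc 1 (n N),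
        (B (centredSq P y k ω) (centredSq P y (k + d) ω) - D)‖ ^ 2 := fun ω => by
    rw [← mul_pow]
    congr 1
    rw [← norm_smul_of_nonneg (inv_pos.2 hn0).le, Finset.sum_sub_distrib, smul_sub]
    simp [← Nat.cast_smul_eq_nsmul ℝ, smul_smul, hn0.ne']
  simp only [e2]
  rw [integral_const_mul]
  calc ((n N : ℝ)⁻¹) ^ 2 * _ ≤ ((n N : ℝ)⁻¹) ^ 2 * (c * n N) := by
        gcongr
        exact (hcn (n N)).2
    _ = c / n N := by field_simp
    _ ≤ 2 * c / N := by
        rw [div_le_div_iff₀ hn0 hN0']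
        nlinarith

end Consistency

end FunctionalARCH

end

/-! ### The two sample moments inserted into the perturbation bound. -/

theorem theorem3p1 {Ω : Type*} [MeasurableSpace Ω] (P : Measure Ω) [IsProbabilityMeasure P]
    (β : unitInterval → unitInterval → ℝ) (δ : H) (ε σ y : ℤ → Ω → H)
    (hARCH : IsFARCH P β δ ε σ y)
    (hstat : IsStrictlyStationary P y)
    (hunit : HasUnitSecondMoment P (ε 0))
    (hcontr : ∫⁻ ω, contraction β (ε 1 ω) ^ (4 : ℝ) ∂P < 1)
    (hmoment : ∫⁻ ω, ‖centredSq P y 0 ω‖ₑ ^ (4 : ℝ) ∂P < ∞)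
    (K : ℕ) (hK : 1 ≤ K)
    (lam : Fin (K + 1) → ℝ) (e : Fin (K + 1) → H)
    (heig : IsLeadingEigensystem (covOp P (centredSq P y)) lam e)
    (hdistinct : StrictAnti lam) (hpos : 0 < lam (Fin.last K))
    (lamHat : ℕ → Ω → Fin K → ℝ) (eHat : ℕ → Ω → Fin K → H)
    (heigHat : ∀ N, ∀ᵐ ω ∂P,
      IsLeadingEigensystem (empCovOp (centredSq P y) N ω) (lamHat N ω) (eHat N ω)) :
    IsBigOP P
      (fun N ω => hsNorm fun t s =>
        betaK P (centredSq P y) (fun j : Fin K => lam j.castSucc) (fun j => e j.castSucc) t s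
          - betaHat (centredSq P y) N ω (lamHat N ω) (eHat N ω) t s)
      (fun N => (N : ℝ) ^ (-(1 / 2) : ℝ)) := by
  have hS := hARCH.isSquaredARCH hstat hunit hcontr hmoment
  have hZ : ∀ k, MemLp (centredSq P y k) 2 P := memLp_centredSq hS
  have hA := heig.isTopSystem (covOp_eq_covCLM (hZ 1)) (covCLM_mem_compactPositive (hZ 1))
  obtain ⟨c, r, hc, hr, hpert⟩ := hA.exists_hsNorm_tensorKernel_sub_le inner_tensor hdistinct hpos
    (∫ ω, tensor (centredSq P y 1 ω) (centredSq P y 2 ω) ∂P)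
  have hU := isBigOP_norm_mean_tensor_sub inner_tensor hS hstat 0 (n := fun N => N)
    ((eventually_gt_atTop 0).mono fun N hN => ⟨hN, by omega⟩)
  have hV := isBigOP_norm_mean_tensor_sub inner_tensor hS hstat 1 (n := fun N => N - 1)
    ((eventually_gt_atTop 1).mono fun N hN => ⟨by omega, by omega⟩)
  have hrate : Tendsto (fun N : ℕ => (N : ℝ) ^ (-(1 / 2) : ℝ)) atTop (𝓝 0) :=
    (tendsto_rpow_neg_atTop (by norm_num)).comp tendsto_natCast_atTop_atTop
  refine IsBigOP.of_le_mul_add hrate hU hV hc hr ?_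
  filter_upwards [eventually_gt_atTop 0] with N hN
  filter_upwards [heigHat N] with ω hω hUr hVr
  have hcast : ((N - 1 : ℕ) : ℝ) = (N : ℝ) - 1 := by
    rw [Nat.cast_sub hN, Nat.cast_one]
  simp only [Nat.cast_zero, Nat.cast_one, add_zero, abs_norm, hcast,
    show (1 : ℤ) + 1 = 2 from rfl] at hUr hVr ⊢
  rw [abs_of_nonneg (a := hsNorm _) (Real.sqrt_nonneg _), betaK_eq_tensorKernel (hZ 1) (hZ 2)]
  simp only [betaHat_eq_tensorKernel]
  -- The operator error is measured by the norm of the lag-zero tensor mean error, and the lag-one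
  -- error enters directly.
  refine hpert (empCovCLM (centredSq P y) N ω) _ _ _ _ _
    (hω.isTopSystem (empCovOp_eq_empCovCLM N ω) (empCovCLM_mem_compactPositive N ω))
    (fun x => ?_) (norm_nonneg _) hUr le_rfl hVr
  rw [norm_sub_rev]
  refine norm_apply_le_of_inner_tensor inner_tensor (fun x v => ?_) x
  rw [sub_apply, inner_sub_left, inner_sub_left, inner_covCLM (hZ 1), inner_empCovCLM]
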